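/- All manifolds are smooth, finite-dimensional, Hausdorff and second countable. Let $G$ be a Lie group and $p:P\to M$ a right principal $G$-bundle. Let $\pi_P$ be a $G$-invariant Poisson structure on $P$ and $\pi_M$ a Poisson structure on $M$ such that $p:(P,\pi_P)\to(M,\pi_M)$ is a coregular Poisson submersion, i.e. $p$ is a Poisson map and each fibre $F=p^{-1}(m)$ is a coregular submanifold: $\pi_P^\sharp(N^*F)$ is a vector subbundle of $TP|_F$ that meets $TF$ trivially. Let $G$ act smoothly from the left, by Poisson diffeomorphisms, on a Poisson manifold $(X,\pi_X)$, with each $G$-orbit contained in a symplectic leaf of $\pi_X$. Assume that either a) the fibres of $p:P\to M$ inherit the zero Poisson structure from $\pi_P$, that is, for each fibre $F$ and $y\in F$ one has $\{(u,\xi|_{T_yF}) : u\in T_yF,\ \xi\in T_y^*P,\ u=\pi_P^\sharp(\xi)\}=0\oplus T_y^*F$; or b) the orbits of $G$ on $X$ are isotropic in the symplectic leaves of $(X,\pi_X)$. Let $\Sigma=P\times_GX$ be the associated bundle, i.e. the quotient manifold of $P\times X$ by $g\cdot(y,x)=(yg^{-1},gx)$, with quotient map $q:P\times X\to\Sigma$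 and projection $\Sigma\to M$, $[y,x]\mapsto p(y)$. Then there is a unique Poisson structure $\pi_\Sigma$ on $\Sigma$ for which $q:(P,\pi_P)\times(X,\pi_X)\to(\Sigma,\pi_\Sigma)$ is a Poisson submersion, and: 1. $\Sigma\to M$ has locally trivial foliation with model fibre $(X,\pi_X)$: each point of $M$ has an open neighbourhood $U$ with a smooth trivialization $\phi:U\times X\to\Sigma|_U$ (a diffeomorphism over $U$) such that $\phi^*\pi_\Sigma$ and $\pi_M|_U\times\pi_X$ have the same singular foliation on $U\times X$, in the sense that they have the same symplectic leaves, with the same tangent spaces. 2. Let the leaf space of a Poisson manifold be the quotient by the equivalence relation whose classes are the symplectic leaves, with the quotient topology. The leaf space of $(\Sigma,\pi_\Sigma)$ is homeomorphic to the leaf space of the product Poisson manifold $(M,\pi_M)\times(X,\pi_X)$, and to the product of the leaf space of $(M,\pi_M)$ and that of $(X,\pi_X)$. -/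

import Mathlib

open Set
open scoped Manifold ContDiff Topology RightActions

noncomputable section

section Poisson

variable {E : Type*} [NormedAddCommGroup E] [NormedSpace ℝ E]
  {H : Type*} [TopologicalSpace H] {I : ModelWithCorners ℝ E H}
  {N : Type*} [TopologicalSpace N] [ChartedSpace H N]
  {E' : Type*} [NormedAddCommGroup E'] [NormedSpace ℝ E']
  {H' : Type*} [TopologicalSpace H'] {I' : ModelWithCorners ℝ E' H'}
  {N' : Type*} [TopologicalSpace N'] [ChartedSpace H' N']

variable (I N) in
/-- A (not necessarily smooth) field of bivectors `π` on `N`, given by the skew maps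
`π♯ : T*N → TN`; the bivector itself is `π(α, β) = β (π♯ α)`. -/
@[ext]
structure BivectorField where
  /-- The map `π♯` at each point. -/
  sharp : ∀ x : N, (TangentSpace I x →L[ℝ] ℝ) →ₗ[ℝ] TangentSpace I x
  skew : ∀ (x : N) (α β : TangentSpace I x →L[ℝ] ℝ), β (sharp x α) = -α (sharp x β)

namespace BivectorField

/-- The Hamiltonian vector field `H_f = π♯(df)`. -/
def hamiltonian (π : BivectorField I N) (f : N → ℝ) (x : N) : TangentSpace I x :=
  π.sharp x (mvfderiv I f x)

/-- The bracket `{f, g} = π(df, dg)`. -/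
def bracket (π : BivectorField I N) (f g : N → ℝ) (x : N) : ℝ :=
  mvfderiv I g x (π.hamiltonian f x)

/-- `π` is a Poisson structure: it is smooth (on a Hausdorff finite-dimensional manifold a bivector
field is smooth iff it maps pairs of smooth functions to smooth functions), and the bracket that it
defines on smooth functions satisfies the Jacobi identity. -/
structure IsPoisson (π : BivectorField I N) : Prop where
  smooth : ∀ f g : N → ℝ, ContMDiff I 𝓘(ℝ, ℝ) ∞ f → ContMDiff I 𝓘(ℝ, ℝ) ∞ g →
    ContMDiff I 𝓘(ℝ, ℝ) ∞ (π.bracket f g)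
  jacobi : ∀ f g h : N → ℝ, ContMDiff I 𝓘(ℝ, ℝ) ∞ f → ContMDiff I 𝓘(ℝ, ℝ) ∞ g →
    ContMDiff I 𝓘(ℝ, ℝ) ∞ h → ∀ x,
    π.bracket f (π.bracket g h) x + π.bracket g (π.bracket h f) x
      + π.bracket h (π.bracket f g) x = 0

/-- The product `(π, π')` on `N × N'`. -/
def prod (π : BivectorField I N) (π' : BivectorField I' N') :
    BivectorField (I.prod I') (N × N') where
  sharp z :=
    { toFun := fun α =>
        ((π.sharp z.1 ((show E × E' →L[ℝ] ℝ from α).comp (ContinuousLinearMap.inl ℝ E E')),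
          π'.sharp z.2 ((show E × E' →L[ℝ] ℝ from α).comp (ContinuousLinearMap.inr ℝ E E'))) :
          TangentSpace I z.1 × TangentSpace I' z.2)
      map_add' := fun α β => Prod.ext
        ((π.sharp z.1).map_add
          ((show E × E' →L[ℝ] ℝ from α).comp (ContinuousLinearMap.inl ℝ E E'))
          ((show E × E' →L[ℝ] ℝ from β).comp (ContinuousLinearMap.inl ℝ E E')))
        ((π'.sharp z.2).map_add
          ((show E × E' →L[ℝ] ℝ from α).comp (ContinuousLinearMap.inr ℝ E E'))
          ((show E × E' →L[ℝ] ℝ from β).comp (ContinuousLinearMap.inr ℝ E E')))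
      map_smul' := fun c α => Prod.ext
        ((π.sharp z.1).map_smul c
          ((show E × E' →L[ℝ] ℝ from α).comp (ContinuousLinearMap.inl ℝ E E')))
        ((π'.sharp z.2).map_smul c
          ((show E × E' →L[ℝ] ℝ from α).comp (ContinuousLinearMap.inr ℝ E E'))) }
  skew z α β := by
    have key : ∀ (γ : E × E' →L[ℝ] ℝ) (u : E) (v : E'), γ (u, v) =
        (γ.comp (ContinuousLinearMap.inl ℝ E E')) u
          + (γ.comp (ContinuousLinearMap.inr ℝ E E')) v := by
      intro γ u v
      simp [← map_add]
    have h1 := π.skew z.1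
      ((show E × E' →L[ℝ] ℝ from α).comp (ContinuousLinearMap.inl ℝ E E'))
      ((show E × E' →L[ℝ] ℝ from β).comp (ContinuousLinearMap.inl ℝ E E'))
    have h2 := π'.skew z.2
      ((show E × E' →L[ℝ] ℝ from α).comp (ContinuousLinearMap.inr ℝ E E'))
      ((show E × E' →L[ℝ] ℝ from β).comp (ContinuousLinearMap.inr ℝ E E'))
    refine (key β _ _).trans (Eq.trans ?_ (congrArg Neg.neg (key α _ _)).symm)
    rw [neg_add]
    exact congrArg₂ (· + ·) h1 h2

/-- Two points of the open set `W` are related if a concatenation of integral curves, staying in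
`W`, of Hamiltonian vector fields of smooth functions on `W` joins them: they are in the same
symplectic leaf of `π|_W`. -/
def LeafRelOn (π : BivectorField I N) (W : Set N) : N → N → Prop :=
  Relation.EqvGen fun x y =>
    ∃ f : N → ℝ, ContMDiffOn I 𝓘(ℝ, ℝ) ∞ f W ∧
      ∃ γ : ℝ → N, (∀ t ∈ Icc (0 : ℝ) 1, γ t ∈ W) ∧
        IsMIntegralCurveOn γ (π.hamiltonian f) (Icc 0 1) ∧ γ 0 = x ∧ γ 1 = y

/-- The partition of `N` into symplectic leaves. -/
def leafSetoid (π : BivectorField I N) : Setoid N where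
  r := π.LeafRelOn univ
  iseqv := Relation.EqvGen.is_equivalence _

/-- The symplectic leaf through `x`. -/
def leaf (π : BivectorField I N) (x : N) : Set N := {y | π.leafSetoid x y}

/-- The leaf space, with the quotient topology. -/
def LeafSpace (π : BivectorField I N) : Type _ := Quotient π.leafSetoid

instance (π : BivectorField I N) : TopologicalSpace π.LeafSpace :=
  inferInstanceAs (TopologicalSpace (Quotient π.leafSetoid))

/-- The annihilator in `T*_x N` of a subspace of `T_x N`. -/
def conormal {x : N} (V : Submodule ℝ (TangentSpace I x)) :
    Submodule ℝ (TangentSpace I x →L[ℝ] ℝ) where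
  carrier := {ξ | ∀ u ∈ V, ξ u = 0}
  zero_mem' := fun _ _ => rfl
  add_mem' := by
    intro ξ η hξ hη u hu
    change ξ u + η u = 0
    rw [hξ u hu, hη u hu, add_zero]
  smul_mem' := by
    intro c ξ hξ u hu
    change c • ξ u = 0
    rw [hξ u hu, smul_zero]

/-- The family `{(u, ξ|_V) | u ∈ V, u = π♯ ξ}` in `V ⊕ V*` that the graph of `π` induces on a
subspace `V ⊆ T_x N`. -/
def inducedFamily (π : BivectorField I N) (x : N) (V : Submodule ℝ (TangentSpace I x)) :
    Set (V × (V →L[ℝ] ℝ)) :=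
  {w | ∃ ξ : TangentSpace I x →L[ℝ] ℝ, π.sharp x ξ = w.1 ∧ ξ.comp V.subtypeL = w.2}

/-- A smooth Poisson map. -/
structure IsPoissonMap (π : BivectorField I N) (π' : BivectorField I' N') (φ : N → N') : Prop where
  contMDiff : ContMDiff I I' ∞ φ
  map_sharp : ∀ (x : N) (α : TangentSpace I' (φ x) →L[ℝ] ℝ),
    mfderiv I I' φ x (π.sharp x (α.comp (mfderiv I I' φ x))) = π'.sharp (φ x) α

/-- A Poisson submersion: a Poisson map which is a surjective submersion. -/
structure IsPoissonSubmersion (π : BivectorField I N) (π' : BivectorField I' N') (φ : N → N') :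
    Prop extends IsPoissonMap π π' φ where
  surjective : Function.Surjective φ
  submersion : ∀ x, Function.Surjective (mfderiv I I' φ x)

/-- A family `D` of subspaces of the tangent spaces of `N` is a smooth vector subbundle of `TN|_S`
along the (embedded) submanifold `S`: locally it has a smooth frame. -/
def IsSubbundleAlong [IsManifold I ∞ N] (S : Set N)
    (D : ∀ x : N, Submodule ℝ (TangentSpace I x)) : Prop :=
  ∀ x ∈ S, ∃ (k : ℕ) (U : Set N) (V : Fin k → ∀ y : N, TangentSpace I y),
    IsOpen U ∧ x ∈ U ∧
    (∀ i, ContMDiffOn I I.tangent ∞ (fun y => (⟨y, V i y⟩ : TangentBundle I N)) U) ∧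
    ∀ y ∈ S ∩ U, LinearIndependent ℝ (fun i => V i y) ∧
      Submodule.span ℝ (range fun i => V i y) = D y

/-- The (embedded) submanifold `S` with tangent spaces `TS` is coregular: `π♯(N*S)` is a vector
subbundle of `TN|_S` which meets `TS` trivially. -/
def IsCoregular [IsManifold I ∞ N] (π : BivectorField I N) (S : Set N)
    (TS : ∀ x : N, Submodule ℝ (TangentSpace I x)) : Prop :=
  IsSubbundleAlong S (fun x => (conormal (TS x)).map (π.sharp x)) ∧
    ∀ x ∈ S, Disjoint ((conormal (TS x)).map (π.sharp x)) (TS x)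

variable (I I') in
/-- The vertical spaces of a map. -/
def vertical (p : N → N') (x : N) : Submodule ℝ (TangentSpace I x) :=
  LinearMap.ker (mfderiv I I' p x).toLinearMap

/-- A coregular Poisson submersion: a Poisson submersion with coregular fibres. -/
structure IsCoregularPoissonSubmersion [IsManifold I ∞ N]
    (π : BivectorField I N) (π' : BivectorField I' N') (p : N → N') : Prop
    extends IsPoissonSubmersion π π' p where
  coregular_fibres : ∀ m : N', π.IsCoregular (p ⁻¹' {m}) (vertical I I' p)

variable (I') in
/-- All fibres of the submersion `p` inherit the zero Poisson structure: the family induced on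
each tangent space `V` of a fibre is `{(u, η) | u = 0} = 0 ⊕ V*`, the graph of the zero
bivector. -/
def FibresInheritZero (π : BivectorField I N) (p : N → N') : Prop :=
  ∀ x : N, π.inducedFamily x (vertical I I' p x) = {w | w.1 = 0}

/-- Every right translation is a Poisson map. -/
def IsRightInvariant (G : Type*) [Group G] [MulAction Gᵐᵒᵖ N] (π : BivectorField I N) : Prop :=
  ∀ g : G, IsPoissonMap π π fun y : N => y <• g

/-- Every left translation is a Poisson map. -/
def IsLeftInvariant (G : Type*) [Group G] [MulAction G N] (π : BivectorField I N) : Prop :=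
  ∀ g : G, IsPoissonMap π π fun x : N => g • x

/-- The orbits of the action of `G` are isotropic in the symplectic leaves of `π`, whose symplectic
forms are given by `ω(π♯ α, π♯ β) = π(α, β)` up to an overall sign. The tangent space at `x` of the
orbit is the image of the differential at `1` of `g ↦ g • x`. -/
def OrbitsIsotropic {EG : Type*} [NormedAddCommGroup EG] [NormedSpace ℝ EG]
    {HG : Type*} [TopologicalSpace HG] (IG : ModelWithCorners ℝ EG HG)
    (G : Type*) [TopologicalSpace G] [ChartedSpace HG G] [Group G] [MulAction G N]
    (π : BivectorField I N) : Prop :=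
  ∀ (x : N) (α β : TangentSpace I x →L[ℝ] ℝ),
    (∃ v : TangentSpace IG (1 : G), mfderiv IG I (fun g : G => g • x) 1 v = π.sharp x α) →
    (∃ w : TangentSpace IG (1 : G), mfderiv IG I (fun g : G => g • x) 1 w = π.sharp x β) →
    β (π.sharp x α) = 0

end BivectorField

end Poisson

section Bundles

variable {EP : Type*} [NormedAddCommGroup EP] [NormedSpace ℝ EP]
  {HP : Type*} [TopologicalSpace HP] {IP : ModelWithCorners ℝ EP HP}
  {P : Type*} [TopologicalSpace P] [ChartedSpace HP P]
  {EM : Type*} [NormedAddCommGroup EM] [NormedSpace ℝ EM]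
  {HM : Type*} [TopologicalSpace HM] {IM : ModelWithCorners ℝ EM HM}
  {M : Type*} [TopologicalSpace M] [ChartedSpace HM M]
  {EX : Type*} [NormedAddCommGroup EX] [NormedSpace ℝ EX]
  {HX : Type*} [TopologicalSpace HX] {IX : ModelWithCorners ℝ EX HX}
  {X : Type*} [TopologicalSpace X] [ChartedSpace HX X]
  {EG : Type*} [NormedAddCommGroup EG] [NormedSpace ℝ EG]
  {HG : Type*} [TopologicalSpace HG] {IG : ModelWithCorners ℝ EG HG}
  {G : Type*} [TopologicalSpace G] [ChartedSpace HG G] [Group G]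

variable (IP IM IX) in
/-- The local trivialization `e : p⁻¹(U) → U × X` of `p : P → M` is a diffeomorphism. -/
structure IsSmoothTrivialization {p : P → M} (e : Bundle.Trivialization X p) : Prop where
  contMDiffOn : ContMDiffOn IP (IM.prod IX) ∞ e e.source
  contMDiffOn_symm : ContMDiffOn (IM.prod IX) IP ∞ e.toOpenPartialHomeomorph.symm e.target

/-- `p : Z → M`, with Poisson structures `πZ` and `πM`, has locally trivial foliation with model
fibre `(X, πX)`: around each point of `M` there is a smooth trivialization `p⁻¹(U) ≃ U × X` which
identifies the singular foliation of `πZ` on `p⁻¹(U)` with that of `πM × πX` on `U × X`, both the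
partition into leaves and the tangent spaces of the leaves. -/
def HasLocallyTrivialFoliation (p : P → M) (πZ : BivectorField IP P) (πM : BivectorField IM M)
    (πX : BivectorField IX X) : Prop :=
  ∀ m : M, ∃ e : Bundle.Trivialization X p, m ∈ e.baseSet ∧ IsSmoothTrivialization IP IM IX e ∧
    (∀ a ∈ e.source, ∀ b ∈ e.source,
      πZ.LeafRelOn e.source a b ↔ (πM.prod πX).LeafRelOn e.target (e a) (e b)) ∧
    ∀ a ∈ e.source,
      (LinearMap.range (πZ.sharp a)).map (mfderiv IP (IM.prod IX) e a).toLinearMap =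
        LinearMap.range ((πM.prod πX).sharp (e a))

variable (IP IM IG G) in
/-- `p : P → M` is a smooth right principal `G`-bundle. -/
structure IsPrincipalBundle [MulAction Gᵐᵒᵖ P] (p : P → M) : Prop where
  contMDiff_proj : ContMDiff IP IM ∞ p
  contMDiff_act : ContMDiff (IP.prod IG) IP ∞ fun z : P × G => z.1 <• z.2
  proj_act : ∀ (y : P) (g : G), p (y <• g) = p y
  locally_trivial : ∀ m : M, ∃ e : Bundle.Trivialization G p, m ∈ e.baseSet ∧
    IsSmoothTrivialization IP IM IG e ∧
    ∀ y ∈ e.source, ∀ g : G, (e (y <• g)).2 = (e y).2 * g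

variable (P X G) in
/-- The orbit relation of the action `g · (y, x) = (y g⁻¹, g x)` on `P × X`. -/
def associatedSetoid [MulAction Gᵐᵒᵖ P] [MulAction G X] : Setoid (P × X) where
  r z w := ∃ g : G, w = (z.1 <• g⁻¹, g • z.2)
  iseqv :=
    { refl := fun z => ⟨1, by simp⟩
      symm := by
        rintro z w ⟨g, rfl⟩
        exact ⟨g⁻¹, by simp [smul_smul]⟩
      trans := by
        rintro z w v ⟨g, rfl⟩ ⟨k, rfl⟩
        exact ⟨k * g, by simp [smul_smul]⟩ }

variable (X) in
/-- The associated bundle `Σ = P ×_G X`, the quotient of `P × X` by `g · (y, x) = (y g⁻¹, g x)`. -/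
def AssociatedBundle [MulAction Gᵐᵒᵖ P] [MulAction G X] {p : P → M}
    (_h : IsPrincipalBundle IP IM IG G p) : Type _ :=
  Quotient (associatedSetoid P X G)

namespace AssociatedBundle

variable [MulAction Gᵐᵒᵖ P] [MulAction G X] {p : P → M} (h : IsPrincipalBundle IP IM IG G p)

instance : TopologicalSpace (AssociatedBundle X h) :=
  inferInstanceAs (TopologicalSpace (Quotient (associatedSetoid P X G)))

/-- The quotient map `q : P × X → Σ`. -/
def mk (z : P × X) : AssociatedBundle X h := Quotient.mk (associatedSetoid P X G) z

variable (X) in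
/-- The projection `Σ → M`, `[y, x] ↦ p y`. -/
def proj : AssociatedBundle X h → M :=
  Quotient.lift (fun z : P × X => p z.1) (by
    rintro z w ⟨g, rfl⟩
    exact (h.proj_act z.1 g⁻¹).symm)

set_option linter.unusedSectionVars false in
theorem mk_act (y : P) (x : X) (g : G) : mk h (y <• g, x) = mk h (y, g • x) :=
  Quotient.sound ⟨g, by simp⟩

theorem isQuotientMap_mk : Topology.IsQuotientMap (mk h : P × X → AssociatedBundle X h) :=
  isQuotientMap_quotient_mk'

theorem continuous_proj : Continuous (proj X h) :=
  (isQuotientMap_mk h).continuous_iff.2 (h.contMDiff_proj.continuous.comp continuous_fst)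

variable (X) in
/-- The map `[y, x] ↦ (p y, e₂(y) • x)` over the domain of an equivariant local trivialization
`e = (p, e₂)` of `P`, computed on a representative. -/
def trivFun (e : Bundle.Trivialization G p) (σ : AssociatedBundle X h) : M × X :=
  let z : P × X := Quotient.out (s := associatedSetoid P X G) σ
  (p z.1, (e z.1).2 • z.2)

set_option linter.unusedSectionVars false in
theorem trivFun_mk (e : Bundle.Trivialization G p)
    (he : ∀ y ∈ e.source, ∀ g : G, (e (y <• g)).2 = (e y).2 * g)
    (z : P × X) (hz : z.1 ∈ e.source) :
    trivFun X h e (mk h z) = (p z.1, (e z.1).2 • z.2) := by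
  obtain ⟨g, hg⟩ := Quotient.mk_out (s := associatedSetoid P X G) z
  set w : P × X := Quotient.out (s := associatedSetoid P X G) (mk h z) with hw
  have hg' : z = (w.1 <• g⁻¹, g • w.2) := hg
  have hwz : w.1 = z.1 <• g := by rw [hg']; simp
  have hw2 : g • w.2 = z.2 := by rw [hg']
  change (p w.1, (e w.1).2 • w.2) = _
  rw [hwz, he _ hz, h.proj_act, mul_smul, hw2]

/-- The local trivialization `[y, x] ↦ (p y, e₂(y) • x)` of `Σ` induced by an equivariant local
trivialization `e = (p, e₂)` of `P`. -/
def trivialization [ContinuousSMul G X] (e : Bundle.Trivialization G p)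
    (he : ∀ y ∈ e.source, ∀ g : G, (e (y <• g)).2 = (e y).2 * g) :
    Bundle.Trivialization X (proj X h) where
  toFun := trivFun X h e
  invFun w := mk h (e.toOpenPartialHomeomorph.symm (w.1, 1), w.2)
  source := proj X h ⁻¹' e.baseSet
  target := e.baseSet ×ˢ univ
  map_source' := by
    refine Quotient.ind fun z hz => ?_
    have hz' : p z.1 ∈ e.baseSet := hz
    change trivFun X h e (mk h z) ∈ _
    rw [trivFun_mk h e he z (e.mem_source.2 hz')]
    exact ⟨hz', mem_univ _⟩
  map_target' := by
    rintro ⟨m, x⟩ ⟨hm, -⟩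
    change p (e.toOpenPartialHomeomorph.symm (m, 1)) ∈ e.baseSet
    rw [e.proj_symm_apply' hm]
    exact hm
  left_inv' := by
    refine Quotient.ind fun z hz => ?_
    have hb : p z.1 ∈ e.baseSet := hz
    have hz' : z.1 ∈ e.source := e.mem_source.2 hb
    change mk h (e.toOpenPartialHomeomorph.symm ((trivFun X h e (mk h z)).1, 1),
      (trivFun X h e (mk h z)).2) = mk h z
    rw [trivFun_mk h e he z hz', ← mk_act]
    congr 2
    have h1 : e.toOpenPartialHomeomorph.symm (p z.1, 1) ∈ e.source :=
      e.map_target (e.mem_target.2 hb)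
    apply e.injOn ((e.mem_source).2 (by rw [h.proj_act]; exact e.mem_source.1 h1)) hz'
    change e (e.toOpenPartialHomeomorph.symm (p z.1, 1) <• (e z.1).2) = e z.1
    refine Prod.ext ?_ ?_
    · rw [e.coe_fst' (by rw [h.proj_act]; exact e.mem_source.1 h1), h.proj_act,
        e.proj_symm_apply' hb, e.coe_fst' hb]
    · rw [he _ h1, e.apply_symm_apply' hb, one_mul]
  right_inv' := by
    rintro ⟨m, x⟩ ⟨hm, -⟩
    have h1 : e.toOpenPartialHomeomorph.symm (m, 1) ∈ e.source :=
      e.map_target (e.mem_target.2 hm)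
    rw [trivFun_mk h e he _ h1, e.proj_symm_apply' hm, e.apply_symm_apply' hm, one_smul]
  open_source := e.open_baseSet.preimage (continuous_proj h)
  open_target := e.open_baseSet.prod isOpen_univ
  continuousOn_toFun := by
    rw [(isQuotientMap_mk h).continuousOn_isOpen_iff (e.open_baseSet.preimage (continuous_proj h))]
    have hs : ∀ z ∈ mk h ⁻¹' (proj X h ⁻¹' e.baseSet), z.1 ∈ e.source :=
      fun z hz => e.mem_source.2 hz
    refine ContinuousOn.congr (f := fun z : P × X => (p z.1, (e z.1).2 • z.2)) ?_
      fun z hz => trivFun_mk h e he z (hs z hz)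
    refine (h.contMDiff_proj.continuous.comp continuous_fst).continuousOn.prodMk ?_
    exact (continuous_snd.comp_continuousOn
      (e.continuousOn_toFun.comp continuousOn_fst hs)).smul continuousOn_snd
  continuousOn_invFun := by
    refine (isQuotientMap_mk h).continuous.comp_continuousOn ?_
    refine ContinuousOn.prodMk ?_ continuousOn_snd
    refine e.continuousOn_invFun.comp (by fun_prop) ?_
    rintro ⟨m, x⟩ ⟨hm, -⟩
    exact e.mem_target.2 hm
  baseSet := e.baseSet
  open_baseSet := e.open_baseSet
  source_eq := rfl
  target_eq := rfl
  proj_toFun := by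
    refine Quotient.ind fun z hz => ?_
    exact congrArg Prod.fst (trivFun_mk h e he z (e.mem_source.2 hz))

/-- A choice of an equivariant smooth local trivialization of `P` around each point. -/
def principalTriv (m : M) : Bundle.Trivialization G p := (h.locally_trivial m).choose

theorem principalTriv_mem (m : M) : m ∈ (principalTriv h m).baseSet :=
  (h.locally_trivial m).choose_spec.1

theorem principalTriv_smooth (m : M) : IsSmoothTrivialization IP IM IG (principalTriv h m) :=
  (h.locally_trivial m).choose_spec.2.1

theorem principalTriv_act (m : M) : ∀ y ∈ (principalTriv h m).source, ∀ g : G,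
    (principalTriv h m (y <• g)).2 = (principalTriv h m y).2 * g :=
  (h.locally_trivial m).choose_spec.2.2

variable (X) in
/-- The induced local trivializations of `Σ`. -/
def triv [ContinuousSMul G X] (m : M) : Bundle.Trivialization X (proj X h) :=
  trivialization h (principalTriv h m) (principalTriv_act h m)

/-- The atlas of `Σ` given by local trivializations, with values in `M × X`. -/
@[reducible]
def chartedSpaceProd [ContinuousSMul G X] : ChartedSpace (M × X) (AssociatedBundle X h) where
  atlas := range fun m => (triv X h m).toOpenPartialHomeomorph
  chartAt σ := (triv X h (proj X h σ)).toOpenPartialHomeomorph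
  mem_chart_source σ := (triv X h (proj X h σ)).mem_source.2 (principalTriv_mem h _)
  chart_mem_atlas _ := mem_range_self _

/-- The smooth structure of `Σ`: the charts are the local trivializations `Σ|_U ≃ U × X`
followed by charts of `M × X`. -/
instance [ContinuousSMul G X] : ChartedSpace (ModelProd HM HX) (AssociatedBundle X h) :=
  letI := chartedSpaceProd (X := X) h
  ChartedSpace.comp (ModelProd HM HX) (M × X) (AssociatedBundle X h)

theorem contMDiffOn_coordChange [IsManifold IM ∞ M] [ContinuousSMul G X]
    [ContMDiffSMul IG IX ∞ G X] (m m' : M) :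
    ContMDiffOn (IM.prod IX) (IM.prod IX) ∞
      ((triv X h m).toOpenPartialHomeomorph.symm ≫ₕ (triv X h m').toOpenPartialHomeomorph)
      ((triv X h m).toOpenPartialHomeomorph.symm ≫ₕ
        (triv X h m').toOpenPartialHomeomorph).source := by
  set e := principalTriv h m with he
  set e' := principalTriv h m' with he'
  have hS : ∀ z ∈ ((triv X h m).toOpenPartialHomeomorph.symm ≫ₕ
        (triv X h m').toOpenPartialHomeomorph).source, (z.1, (1 : G)) ∈ e.target ∧
        e.toOpenPartialHomeomorph.symm (z.1, 1) ∈ e'.source := by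
    rintro z ⟨hz1, hz2⟩
    exact ⟨e.mem_target.2 hz1.1, e'.mem_source.2 hz2⟩
  have h1 : ContMDiffOn (IM.prod IX) IP ∞
      (fun z : M × X => e.toOpenPartialHomeomorph.symm (z.1, 1))
      ((triv X h m).toOpenPartialHomeomorph.symm ≫ₕ
        (triv X h m').toOpenPartialHomeomorph).source :=
    (principalTriv_smooth h m).contMDiffOn_symm.comp
      (contMDiff_fst.prodMk contMDiff_const).contMDiffOn fun z hz => (hS z hz).1
  have h2 : ContMDiffOn (IM.prod IX) IG ∞
      (fun z : M × X => (e' (e.toOpenPartialHomeomorph.symm (z.1, 1))).2)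
      ((triv X h m).toOpenPartialHomeomorph.symm ≫ₕ
        (triv X h m').toOpenPartialHomeomorph).source :=
    contMDiff_snd.comp_contMDiffOn
      ((principalTriv_smooth h m').contMDiffOn.comp h1 fun z hz => (hS z hz).2)
  have h3 : ContMDiffOn (IM.prod IX) IX ∞
      (fun z : M × X => (e' (e.toOpenPartialHomeomorph.symm (z.1, 1))).2 • z.2)
      ((triv X h m).toOpenPartialHomeomorph.symm ≫ₕ
        (triv X h m').toOpenPartialHomeomorph).source :=
    (contMDiff_smul (I := IG) (I' := IX) (n := ∞) (G := G) (M := X)).comp_contMDiffOn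
      (h2.prodMk contMDiffOn_snd)
  have h4 : ContMDiffOn (IM.prod IX) IM ∞
      (fun z : M × X => p (e.toOpenPartialHomeomorph.symm (z.1, 1)))
      ((triv X h m).toOpenPartialHomeomorph.symm ≫ₕ
        (triv X h m').toOpenPartialHomeomorph).source :=
    h.contMDiff_proj.comp_contMDiffOn h1
  refine (h4.prodMk h3).congr fun z hz => ?_
  exact trivFun_mk h e' (principalTriv_act h m')
    (e.toOpenPartialHomeomorph.symm (z.1, 1), z.2) (hS z hz).2

/-- `Σ` is a smooth manifold. -/
instance [IsManifold IM ∞ M] [IsManifold IX ∞ X] [ContinuousSMul G X]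
    [ContMDiffSMul IG IX ∞ G X] : IsManifold (IM.prod IX) ∞ (AssociatedBundle X h) := by
  refine isManifold_of_contDiffOn _ _ _ ?_
  rintro _ _ ⟨_, ⟨m, rfl⟩, c, hc, rfl⟩ ⟨_, ⟨m', rfl⟩, c', hc', rfl⟩
  rw [← contMDiffOn_iff_contDiffOn]
  have hT := contMDiffOn_coordChange (IX := IX) (X := X) h m m'
  have hcs := contMDiffOn_symm_of_mem_maximalAtlas (I := IM.prod IX) (n := ∞)
    (StructureGroupoid.subset_maximalAtlas _ hc)
  have hc's := contMDiffOn_of_mem_maximalAtlas (I := IM.prod IX) (n := ∞)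
    (StructureGroupoid.subset_maximalAtlas _ hc')
  dsimp only at *
  set t := (triv X h m).toOpenPartialHomeomorph
  set t' := (triv X h m').toOpenPartialHomeomorph
  refine (IM.prod IX).contMDiff.comp_contMDiffOn ?_
  refine hc's.comp (hT.comp (hcs.comp ((IM.prod IX).contMDiffOn_symm.mono ?_) ?_) ?_) ?_
  · exact inter_subset_right
  · intro z hz
    simp only [mfld_simps] at hz ⊢
    grind
  · intro z hz
    simp only [mfld_simps] at hz ⊢
    grind
  · intro z hz
    simp only [mfld_simps] at hz ⊢
    grind

end AssociatedBundle
end Bundles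
end

/-! Existence and uniqueness of `π_Σ`: the group acts on `P × X` by Poisson maps that preserve the
fibres of the quotient map, so the product bivector has the same image at all points of a fibre.

The distribution of `π_Σ`. An equivariant trivialization `e = (p, e₂)` of `P` identifies `Σ` over
`U` with `U × X` by `[y, x] ↦ (p y, e₂(y) • x)`. At a representative with `e₂(y) = 1` the map `P × X
→ U × X` has differential `(u, w) ↦ (p_* u, ρ(ε u) + w)`, where `ε` is the differential of `e₂` and
`ρ` the infinitesimal action at `x`. Hence the range of `π_Σ♯` becomes the set of pairs `(p_* πP ζ,
ρ ε πP ζ + πX ν)` with `ζ = p^*μ + (ρ ε)^*ν`. Coregularity puts the first entry in the range of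
`πM`; as orbits lie in leaves, the second is in the range of `πX`. Either of a) and b) makes every
such pair occur. So the trivializations match the characteristic distributions, though in general
not the bivectors (`AssociatedBundle.map_range_triv`).

From distributions to leaves. Leaves are defined by Hamiltonian curves, which the trivializations
need not preserve; they preserve tangent curves of constant rank. Constant rank is essential: for `x
∂x ∧ ∂y` the tangent curve `(t³, 0)` passes through several leaves. The rank is constant along
Hamiltonian curves (`PoissonTensorOn.finrank_eq_of_curve`), and a tangent curve of constant rank
stays in a leaf (`IsPoisson.leafRelOn_of_isTangentCurve`). The latter uses foliated boxes
(`IsPoisson.exists_box`) in place of the splitting theorem. Near `z₀`, a projection `p` onto the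
range of the tensor at `z₀` admits fields `Y w` in the range of the tensor with `p (Y w) = w`. They
commute at the points of the same rank as `z₀`. Following them with constant coefficients to the
fibre of `p` through `z₀` gives a coordinate `β` which is constant along tangent curves of that
rank, and whose level sets lie in leaves because the lines followed are Hamiltonian curves.

Boxes have two further uses. Saturations of open sets are open, so projections to leaf spaces are
open. A leaf meets a box in countably many plaques at its rank, so a curve inside a leaf is tangent
to it; this makes the fundamental vector fields tangent to the leaves of `X`.

Leaf spaces. By `AssociatedBundle.leafRelOn_mk_iff`, `[y, x]` and `[y', x']` share a leaf iff `p y`,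
`p y'` do and `x`, `x'` do. The three leaf spaces are thus quotients of `P × X` by one relation. -/

noncomputable section

set_option maxSynthPendingDepth 3

/-! ### Poisson tensors on open sets of a vector space, and frames of Hamiltonian directions. -/

section LinearPoisson

open Filter

variable {E : Type*} [NormedAddCommGroup E] [NormedSpace ℝ E]

/-- A smooth Poisson tensor on an open subset `Ω` of a vector space. -/
structure PoissonTensorOn (Q : E → (E →L[ℝ] ℝ) →L[ℝ] E) (Ω : Set E) : Prop where
  isOpen : IsOpen Ω
  contDiffOn : ContDiffOn ℝ ∞ Q Ω
  skew : ∀ z ∈ Ω, ∀ α β : E →L[ℝ] ℝ, β (Q z α) = -α (Q z β)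
  jacobi : ∀ z ∈ Ω, ∀ α β γ : E →L[ℝ] ℝ,
    γ (fderiv ℝ Q z (Q z α) β) + α (fderiv ℝ Q z (Q z β) γ) + β (fderiv ℝ Q z (Q z γ) α) = 0

/-- With the discrete topology on the target the hypothesis is continuity, and intervals are
connected. All local-to-global arguments along curves below go through this. -/
theorem eq_left_of_eventually_eq {α : Type*} {F : ℝ → α} {a b : ℝ}
    (h : ∀ t ∈ Icc a b, ∀ᶠ s in 𝓝[Icc a b] t, F s = F t) : ∀ t ∈ Icc a b, F t = F a := by
  intro t ht
  let _ : TopologicalSpace α := ⊥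
  have : DiscreteTopology α := ⟨rfl⟩
  have hc : ContinuousOn F (Icc a b) := by
    intro s hs
    have h1 : Tendsto (fun _ : ℝ => F s) (𝓝[Icc a b] s) (𝓝 (F s)) := tendsto_const_nhds
    exact h1.congr' ((h s hs).mono fun _ hr => hr.symm)
  exact isPreconnected_Icc.constant hc ht (left_mem_Icc.2 (ht.1.trans ht.2))

theorem ext_dual {x y : E} (h : ∀ γ : E →L[ℝ] ℝ, γ x = γ y) : x = y :=
  (SeparatingDual.eq_iff_forall_dual_eq (R := ℝ)).2 h

theorem HasFDerivAt.clm_pairing {B C D : Type*} [NormedAddCommGroup B] [NormedSpace ℝ B]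
    [NormedAddCommGroup C] [NormedSpace ℝ C] [NormedAddCommGroup D] [NormedSpace ℝ D]
    {c : E → B →L[ℝ] C} {c' : E →L[ℝ] B →L[ℝ] C} {z : E} (h : HasFDerivAt c c' z)
    (b : B) (β : C →L[ℝ] D) : HasFDerivAt (fun y => β (c y b)) (β.comp (c'.flip b)) z := by
  have h1 := h.clm_apply (hasFDerivAt_const b z)
  have h2 := (β.hasFDerivAt (x := c z b)).comp z h1
  refine h2.congr_fderiv ?_
  ext v
  simp

namespace PoissonTensorOn

variable {Q : E → (E →L[ℝ] ℝ) →L[ℝ] E} {Ω : Set E}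

theorem contDiffAt (h : PoissonTensorOn Q Ω) {z : E} (hz : z ∈ Ω) : ContDiffAt ℝ ∞ Q z :=
  h.contDiffOn.contDiffAt (h.isOpen.mem_nhds hz)

theorem differentiableAt (h : PoissonTensorOn Q Ω) {z : E} (hz : z ∈ Ω) :
    DifferentiableAt ℝ Q z :=
  (h.contDiffAt hz).differentiableAt (by simp)

theorem mono (h : PoissonTensorOn Q Ω) {U : Set E} (hU : IsOpen U) (hs : U ⊆ Ω) :
    PoissonTensorOn Q U :=
  ⟨hU, h.contDiffOn.mono hs, fun z hz => h.skew z (hs hz), fun z hz => h.jacobi z (hs hz)⟩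

variable (Q) in
/-- The covector `v ↦ β ((D_v Q) α)`. -/
def dbracket (z : E) (α β : E →L[ℝ] ℝ) : E →L[ℝ] ℝ :=
  β.comp ((fderiv ℝ Q z).flip α)

theorem dbracket_apply (z v : E) (α β : E →L[ℝ] ℝ) :
    dbracket Q z α β v = β (fderiv ℝ Q z v α) := rfl

theorem hasFDerivAt_pairing {z : E} (hd : DifferentiableAt ℝ Q z) (α β : E →L[ℝ] ℝ) :
    HasFDerivAt (fun y => β (Q y α)) (dbracket Q z α β) z :=
  hd.hasFDerivAt.clm_pairing α β

theorem skew_fderiv (h : PoissonTensorOn Q Ω) {z : E} (hz : z ∈ Ω) (v : E) (α β : E →L[ℝ] ℝ) :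
    β (fderiv ℝ Q z v α) = -α (fderiv ℝ Q z v β) := by
  have h1 := hasFDerivAt_pairing (h.differentiableAt hz) α β
  have h2 := (hasFDerivAt_pairing (h.differentiableAt hz) β α).neg
  have h3 : (fun y => β (Q y α)) =ᶠ[𝓝 z] (-fun y => α (Q y β)) :=
    Filter.mem_of_superset (h.isOpen.mem_nhds hz) fun y hy => h.skew y hy α β
  exact DFunLike.congr_fun (h1.unique (h2.congr_of_eventuallyEq h3)) v

/-- The Jacobi identity in the form `[H_α, H_β] = H_{π(α, β)}` for constant covectors: the left side
is the Lie bracket of the fields `Q α` and `Q β`. -/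
theorem fderiv_comm (h : PoissonTensorOn Q Ω) {z : E} (hz : z ∈ Ω) (α β : E →L[ℝ] ℝ) :
    fderiv ℝ Q z (Q z α) β - fderiv ℝ Q z (Q z β) α = Q z (dbracket Q z α β) := by
  refine ext_dual fun γ => ?_
  have h1 := h.jacobi z hz α β γ
  have h2 := h.skew_fderiv hz (Q z β) α γ
  have h3 := h.skew z hz γ (dbracket Q z α β)
  rw [dbracket_apply] at h3
  rw [map_sub]
  linarith

end PoissonTensorOn

/-- Functions of the coordinate `p` whose Hamiltonian vector fields span a complement to the
fibres of `p`: the covectors `θ z u = σ z u ∘ p` satisfy `p (Q z (θ z u)) = u`. -/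
structure PoissonFrame (Q : E → (E →L[ℝ] ℝ) →L[ℝ] E) (U : Set E)
    (A : Type*) [NormedAddCommGroup A] [NormedSpace ℝ A] where
  p : E →L[ℝ] A
  σ : E → A →L[ℝ] A →L[ℝ] ℝ
  contDiffOn : ContDiffOn ℝ ∞ σ U
  p_sharp : ∀ z ∈ U, ∀ u, p (Q z ((σ z u).comp p)) = u

namespace PoissonFrame

variable {Q : E → (E →L[ℝ] ℝ) →L[ℝ] E} {U Ω : Set E}
  {A : Type*} [NormedAddCommGroup A] [NormedSpace ℝ A]

/-- The covector fields of a frame. -/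
def θ (F : PoissonFrame Q U A) (z : E) : A →L[ℝ] E →L[ℝ] ℝ :=
  (ContinuousLinearMap.precomp ℝ F.p).comp (F.σ z)

theorem θ_apply (F : PoissonFrame Q U A) (z : E) (u : A) : F.θ z u = (F.σ z u).comp F.p := rfl

/-- The vector fields of a frame. -/
def Y (F : PoissonFrame Q U A) (z : E) : A →L[ℝ] E := (Q z).comp (F.θ z)

theorem Y_apply (F : PoissonFrame Q U A) (z : E) (u : A) : F.Y z u = Q z (F.θ z u) := rfl

theorem p_Y (F : PoissonFrame Q U A) {z : E} (hz : z ∈ U) (u : A) : F.p (F.Y z u) = u :=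
  F.p_sharp z hz u

theorem contDiffOn_θ (F : PoissonFrame Q U A) : ContDiffOn ℝ ∞ F.θ U :=
  contDiffOn_const.clm_comp F.contDiffOn

theorem contDiffOn_Y (F : PoissonFrame Q U A) (hQ : ContDiffOn ℝ ∞ Q U) :
    ContDiffOn ℝ ∞ F.Y U := hQ.clm_comp F.contDiffOn_θ

/-- `σ z` inverts a skew map, so it is alternating. This removes the unwanted term in the
differential computed in `LineChart.exists_hamiltonian`. -/
theorem σ_self (F : PoissonFrame Q U A) (h : PoissonTensorOn Q U) {z : E} (hz : z ∈ U) (u : A) :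
    F.σ z u u = 0 := by
  have h1 := h.skew z hz (F.θ z u) (F.θ z u)
  have h2 : F.θ z u (Q z (F.θ z u)) = F.σ z u u := congrArg (F.σ z u) (F.p_sharp z hz u)
  rw [h2] at h1
  linarith

variable [FiniteDimensional ℝ E]

theorem finrank_le (F : PoissonFrame Q U A) {z : E} (hz : z ∈ U) :
    Module.finrank ℝ A ≤ Module.finrank ℝ (LinearMap.range (Q z).toLinearMap) := by
  have hinj : Function.Injective (F.Y z) := fun u v h => by
    rw [← F.p_Y hz u, h, F.p_Y hz]
  have := LinearMap.finrank_range_of_inj (f := (F.Y z).toLinearMap) hinj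
  rw [← this]
  refine Submodule.finrank_mono ?_
  rintro _ ⟨u, rfl⟩
  exact ⟨F.θ z u, rfl⟩

/-- The frame spans a subspace of the range of dimension `dim A`; when this is the whole rank it
spans the range, and `p` inverts `Y` there. -/
theorem eq_Y_of_mem_range (F : PoissonFrame Q U A) {z : E} (hz : z ∈ U)
    (hr : Module.finrank ℝ (LinearMap.range (Q z).toLinearMap) = Module.finrank ℝ A)
    {v : E} (hv : v ∈ LinearMap.range (Q z).toLinearMap) : v = F.Y z (F.p v) := by
  have hinj : Function.Injective (F.Y z) := fun u v h => by
    rw [← F.p_Y hz u, h, F.p_Y hz]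
  have h1 := LinearMap.finrank_range_of_inj (f := (F.Y z).toLinearMap) hinj
  have hle : LinearMap.range (F.Y z).toLinearMap ≤ LinearMap.range (Q z).toLinearMap := by
    rintro _ ⟨u, rfl⟩
    exact ⟨F.θ z u, rfl⟩
  have heq := Submodule.eq_of_le_of_finrank_eq hle (h1.trans hr.symm)
  rw [← heq] at hv
  obtain ⟨u, rfl⟩ := hv
  change F.Y z u = F.Y z (F.p (F.Y z u))
  rw [F.p_Y hz]

omit [FiniteDimensional ℝ E] in
theorem p_fderiv_Y (F : PoissonFrame Q U A) (hU : PoissonTensorOn Q U) {z : E} (hz : z ∈ U)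
    (v : E) (u : A) : F.p (fderiv ℝ F.Y z v u) = 0 := by
  have hY : DifferentiableAt ℝ F.Y z := ((F.contDiffOn_Y hU.contDiffOn).contDiffAt
    (hU.isOpen.mem_nhds hz)).differentiableAt (by simp)
  have h1 := hY.hasFDerivAt.clm_pairing u F.p
  have h2 : (fun y => F.p (F.Y y u)) =ᶠ[𝓝 z] fun _ => u :=
    Filter.mem_of_superset (hU.isOpen.mem_nhds hz) fun y hy => F.p_Y hy u
  have h3 := (hasFDerivAt_const (𝕜 := ℝ) u z).congr_of_eventuallyEq h2
  exact DFunLike.congr_fun (h1.unique h3) v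

/-- The vector fields of a frame commute where the rank is minimal. -/
theorem fderiv_Y_comm (F : PoissonFrame Q U A) (hU : PoissonTensorOn Q U) {z : E} (hz : z ∈ U)
    (hr : Module.finrank ℝ (LinearMap.range (Q z).toLinearMap) = Module.finrank ℝ A) (u v : A) :
    fderiv ℝ F.Y z (F.Y z u) v = fderiv ℝ F.Y z (F.Y z v) u := by
  have hθ : DifferentiableAt ℝ F.θ z := (F.contDiffOn_θ.contDiffAt
    (hU.isOpen.mem_nhds hz)).differentiableAt (by simp)
  have key : ∀ (w : E) (u : A), fderiv ℝ F.Y z w u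
      = fderiv ℝ Q z w (F.θ z u) + Q z (fderiv ℝ F.θ z w u) := by
    intro w u
    have h1 : HasFDerivAt F.Y _ z :=
      (hU.differentiableAt hz).hasFDerivAt.clm_comp hθ.hasFDerivAt
    rw [h1.fderiv]
    simp [add_comm]
  have hc := hU.fderiv_comm hz (F.θ z u) (F.θ z v)
  -- The difference is the Lie bracket of two frame fields. Jacobi puts it in the range of `Q z`;
  -- `p` kills it because `p (Y u)` is constant; at minimal rank `p` is injective on that range.
  have hmem : fderiv ℝ F.Y z (F.Y z u) v - fderiv ℝ F.Y z (F.Y z v) u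
      ∈ LinearMap.range (Q z).toLinearMap := by
    refine ⟨PoissonTensorOn.dbracket Q z (F.θ z u) (F.θ z v) + fderiv ℝ F.θ z (F.Y z u) v
      - fderiv ℝ F.θ z (F.Y z v) u, ?_⟩
    change Q z _ = _
    rw [key, key, map_sub, map_add, ← hc, Y_apply, Y_apply]
    abel
  have := F.eq_Y_of_mem_range hz hr hmem
  rw [map_sub, F.p_fderiv_Y hU hz, F.p_fderiv_Y hU hz, sub_zero, map_zero] at this
  exact sub_eq_zero.1 this

-- The map `κ ↦ p (Q z (κ ∘ p))` from `A*` to `A` is injective at `z₀`: if it kills `κ`, then `Q z₀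
-- (κ ∘ p) = 0`, and by skewness `κ` vanishes on `p (range Q z₀) = A`. Hence it is invertible near
-- `z₀`, and `σ` is its inverse.
omit [FiniteDimensional ℝ E] in
theorem exists_of_leftInverse [FiniteDimensional ℝ A] (h : PoissonTensorOn Q Ω) {z₀ : E}
    (hz₀ : z₀ ∈ Ω) (p : E →L[ℝ] A) (hp : ∀ u, ∃ β, p (Q z₀ β) = u)
    (hp' : ∀ β, p (Q z₀ β) = 0 → Q z₀ β = 0) :
    ∃ U, IsOpen U ∧ z₀ ∈ U ∧ U ⊆ Ω ∧ Nonempty (PoissonFrame Q U A) := by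
  set T : E → (A →L[ℝ] ℝ) →L[ℝ] A := fun z =>
    p.comp ((Q z).comp (ContinuousLinearMap.precomp ℝ p)) with hT
  have hTa : ∀ z κ, T z κ = p (Q z (κ.comp p)) := fun z κ => rfl
  have hTinj : Function.Injective (T z₀) := by
    refine (injective_iff_map_eq_zero (T z₀)).2 fun κ hκ => ?_
    have h1 : Q z₀ (κ.comp p) = 0 := hp' _ hκ
    ext u
    obtain ⟨β, rfl⟩ := hp u
    have h3 := h.skew z₀ hz₀ β (κ.comp p)
    rw [h1, map_zero, neg_zero] at h3
    exact h3
  have hdim : Module.finrank ℝ (A →L[ℝ] ℝ) = Module.finrank ℝ A := by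
    rw [← LinearEquiv.finrank_eq (LinearMap.toContinuousLinearMap (𝕜 := ℝ) (E := A) (F' := ℝ))]
    exact Subspace.dual_finrank_eq
  let e : (A →L[ℝ] ℝ) ≃L[ℝ] A :=
    (LinearEquiv.ofInjectiveOfFinrankEq (T z₀).toLinearMap hTinj hdim).toContinuousLinearEquiv
  have he : (e : (A →L[ℝ] ℝ) →L[ℝ] A) = T z₀ := by
    ext κ
    rfl
  have hTs : ContDiffOn ℝ ∞ T Ω :=
    contDiffOn_const.clm_comp (h.contDiffOn.clm_comp contDiffOn_const)
  have hopen : IsOpen (Ω ∩ T ⁻¹' range ((↑) : ((A →L[ℝ] ℝ) ≃L[ℝ] A) → _)) :=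
    hTs.continuousOn.isOpen_inter_preimage h.isOpen ContinuousLinearEquiv.isOpen
  refine ⟨_, hopen, ⟨hz₀, e, he⟩, inter_subset_left, ⟨⟨p, fun z => (T z).inverse, ?_, ?_⟩⟩⟩
  · rintro z ⟨hz, e', he'⟩
    have h1 : ContDiffAt ℝ ∞ ContinuousLinearMap.inverse (T z) := by
      rw [← he']
      exact contDiffAt_map_inverse e'
    exact (h1.comp z (hTs.contDiffAt (h.isOpen.mem_nhds hz))).contDiffWithinAt
  · rintro z ⟨hz, e', he'⟩ u
    change T z ((T z).inverse u) = u
    rw [← he', ContinuousLinearMap.inverse_equiv]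
    exact e'.apply_symm_apply u

theorem exists_frame (h : PoissonTensorOn Q Ω) {z₀ : E} (hz₀ : z₀ ∈ Ω) :
    ∃ U, IsOpen U ∧ z₀ ∈ U ∧ U ⊆ Ω ∧
      Nonempty (PoissonFrame Q U (LinearMap.range (Q z₀).toLinearMap)) := by
  obtain ⟨p', hp'⟩ := (LinearMap.range (Q z₀).toLinearMap).subtype.exists_leftInverse_of_injective
    (by simp)
  have hpA : ∀ β, p' (Q z₀ β) = ⟨Q z₀ β, ⟨β, rfl⟩⟩ := fun β => LinearMap.congr_fun hp' ⟨_, β, rfl⟩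
  refine exists_of_leftInverse h hz₀ (LinearMap.toContinuousLinearMap p') ?_ ?_
  · rintro ⟨_, β, rfl⟩
    exact ⟨β, hpA β⟩
  · intro β hβ
    exact congrArg Subtype.val ((hpA β).symm.trans hβ)

end PoissonFrame

end LinearPoisson

end

noncomputable section

set_option maxSynthPendingDepth 3

/-! ### Constancy of the rank along Hamiltonian curves. -/

section RankConstant

open Filter

theorem exists_linearODE_solution {B : Type*} [NormedAddCommGroup B] [NormedSpace ℝ B]
    [CompleteSpace B] {L : ℝ → B →L[ℝ] B} (hL : Continuous L) (t₀ : ℝ) :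
    ∃ ε > 0, ∃ V : ℝ → B →L[ℝ] B, V t₀ = 1 ∧ ∀ t ∈ Icc (t₀ - ε) (t₀ + ε),
      HasDerivWithinAt V ((L t).comp (V t)) (Icc (t₀ - ε) (t₀ + ε)) t := by
  set C : NNReal := ‖L t₀‖₊ + 1 with hC
  have h1 : ∀ᶠ t in 𝓝 t₀, ‖L t‖₊ < C :=
    (hL.nnnorm.tendsto t₀).eventually_lt_const (by simp [hC])
  obtain ⟨δ, hδ, hb⟩ := Metric.eventually_nhds_iff.1 h1
  -- The first bound keeps `‖L‖ ≤ C`; the second makes `ε C (‖1‖ + 1) ≤ 1 / 2`, so that the solution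
  -- does not leave the unit ball around the identity.
  set ε : ℝ := min (δ / 2) (1 / (2 * (C * (‖(1 : B →L[ℝ] B)‖ + 1)))) with hε
  have hC0 : (0 : ℝ) < C := by positivity
  have hε0 : 0 < ε := by positivity
  have hbd : ∀ t ∈ Icc (t₀ - ε) (t₀ + ε), ‖L t‖₊ ≤ C := fun t ht => by
    refine (hb ?_).le
    rw [Real.dist_eq, abs_lt]
    have := min_le_left (δ / 2) (1 / (2 * (C * (‖(1 : B →L[ℝ] B)‖ + 1))))
    constructor <;> linarith [ht.1, ht.2]
  have hpl : IsPicardLindelof (fun t (V : B →L[ℝ] B) => (L t).comp V)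
      (tmin := t₀ - ε) (tmax := t₀ + ε) ⟨t₀, by constructor <;> linarith⟩ 1 1 0
      (C * (‖(1 : B →L[ℝ] B)‖₊ + 1)) C := by
    refine ⟨fun t ht => ?_, fun V _ => ?_, fun t ht V hV => ?_, ?_⟩
    · refine LipschitzOnWith.of_dist_le_mul fun V _ W _ => ?_
      rw [dist_eq_norm, dist_eq_norm, ← ContinuousLinearMap.comp_sub]
      exact (ContinuousLinearMap.opNorm_comp_le _ _).trans (by gcongr; exact hbd t ht)
    · exact (hL.clm_comp continuous_const).continuousOn
    · refine (ContinuousLinearMap.opNorm_comp_le _ _).trans ?_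
      have : ‖V‖ ≤ ‖(1 : B →L[ℝ] B)‖ + 1 := by
        have h2 := norm_sub_norm_le V 1
        have h3 : ‖V - 1‖ ≤ 1 := by simpa [dist_eq_norm] using hV
        linarith
      push_cast
      gcongr
      exact hbd t ht
    · have h4 : max (t₀ + ε - t₀) (t₀ - (t₀ - ε)) = ε := by simp
      have h5 : ε ≤ 1 / (2 * (C * (‖(1 : B →L[ℝ] B)‖ + 1))) := min_le_right _ _
      push_cast
      rw [h4, sub_zero]
      calc _ ≤ (C : ℝ) * (‖(1 : B →L[ℝ] B)‖ + 1) * (1 / (2 * (C * (‖(1 : B →L[ℝ] B)‖ + 1)))) := by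
            gcongr
        _ ≤ 1 := by
            have : 0 < (C : ℝ) * (‖(1 : B →L[ℝ] B)‖ + 1) := by positivity
            rw [mul_one_div, div_le_one (by positivity)]
            linarith
  obtain ⟨V, hV1, hV2⟩ := hpl.exists_eq_forall_mem_Icc_hasDerivWithinAt₀
  exact ⟨ε, hε0, V, hV1, hV2⟩

theorem eq_zero_of_hasDerivWithinAt_linear {B : Type*} [NormedAddCommGroup B] [NormedSpace ℝ B]
    {L : ℝ → B →L[ℝ] B} {y : ℝ → B} {a b t₀ : ℝ} (hL : ContinuousOn L (Icc a b))
    (hy : ∀ t ∈ Icc a b, HasDerivWithinAt y (L t (y t)) (Icc a b) t) (ht₀ : t₀ ∈ Icc a b)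
    (h0 : y t₀ = 0) : ∀ t ∈ Icc a b, y t = 0 := by
  obtain ⟨C, hC⟩ := isCompact_Icc.exists_bound_of_continuousOn hL
  have hlip : ∀ t ∈ Icc a b, LipschitzOnWith C.toNNReal (fun x => L t x) univ := fun t ht => by
    refine LipschitzOnWith.of_dist_le_mul fun x _ y _ => ?_
    rw [dist_eq_norm, dist_eq_norm, ← map_sub]
    refine ((L t).le_opNorm _).trans ?_
    gcongr
    exact (hC t ht).trans (Real.le_coe_toNNReal C)
  have hyc : ContinuousOn y (Icc a b) := fun t ht => (hy t ht).continuousWithinAt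
  intro t ht
  rcases le_total t₀ t with h | h
  · have hs : Icc t₀ t ⊆ Icc a b := Icc_subset_Icc ht₀.1 ht.2
    refine ODE_solution_unique_of_mem_Icc_right (v := fun t x => L t x) (s := fun _ => univ)
      (K := C.toNNReal) (g := fun _ => 0)
      (fun s hs' => hlip s (hs (Ico_subset_Icc_self hs'))) (hyc.mono hs) (fun s hs' => ?_)
      (fun _ _ => mem_univ _) continuousOn_const (fun s hs' => ?_) (fun _ _ => mem_univ _) h0
      (right_mem_Icc.2 h)
    · exact (hy s (hs (Ico_subset_Icc_self hs'))).mono_of_mem_nhdsWithin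
        (mem_of_superset (Icc_mem_nhdsGE hs'.2)
          (Icc_subset_Icc (ht₀.1.trans hs'.1) ht.2))
    · simpa using hasDerivWithinAt_const s (Ici s) (0 : B)
  · have hs : Icc t t₀ ⊆ Icc a b := Icc_subset_Icc ht.1 ht₀.2
    refine ODE_solution_unique_of_mem_Icc_left (v := fun t x => L t x) (s := fun _ => univ)
      (K := C.toNNReal) (g := fun _ => 0)
      (fun s hs' => hlip s (hs (Ioc_subset_Icc_self hs'))) (hyc.mono hs) (fun s hs' => ?_)
      (fun _ _ => mem_univ _) continuousOn_const (fun s hs' => ?_) (fun _ _ => mem_univ _) h0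
      (left_mem_Icc.2 h)
    · exact (hy s (hs (Ioc_subset_Icc_self hs'))).mono_of_mem_nhdsWithin
        (mem_of_superset (Icc_mem_nhdsLE hs'.1)
          (Icc_subset_Icc ht.1 (hs'.2.trans ht₀.2)))
    · simpa using hasDerivWithinAt_const s (Iic s) (0 : B)

theorem ContinuousOn.clm_flip {T B C D : Type*} [TopologicalSpace T] [NormedAddCommGroup B]
    [NormedSpace ℝ B] [NormedAddCommGroup C] [NormedSpace ℝ C] [NormedAddCommGroup D]
    [NormedSpace ℝ D] {c : T → B →L[ℝ] C →L[ℝ] D} {s : Set T} (h : ContinuousOn c s) :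
    ContinuousOn (fun t => (c t).flip) s :=
  (ContinuousLinearMap.flipₗᵢ ℝ B C D).continuous.comp_continuousOn h

theorem DifferentiableAt.comp_curve {B C : Type*} [NormedAddCommGroup B]
    [NormedSpace ℝ B] [NormedAddCommGroup C] [NormedSpace ℝ C] {f : B → C} {γ : ℝ → B} {v : B}
    {t : ℝ} {s : Set ℝ} (hf : DifferentiableAt ℝ f (γ t)) (hγ : HasDerivWithinAt γ v s t) :
    HasDerivWithinAt (fun t => f (γ t)) (fderiv ℝ f (γ t) v) s t :=
  hf.hasFDerivAt.comp_hasDerivWithinAt t hγ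

namespace PoissonTensorOn

variable {E : Type*} [NormedAddCommGroup E] [NormedSpace ℝ E] [FiniteDimensional ℝ E]
  {Q : E → (E →L[ℝ] ℝ) →L[ℝ] E} {Ω : Set E}

/-- The vectors of a frame at `z₀` stay independent, and in the range, at nearby points. -/
theorem eventually_finrank_ge (h : PoissonTensorOn Q Ω) {z₀ : E} (hz₀ : z₀ ∈ Ω) :
    ∀ᶠ z in 𝓝 z₀, Module.finrank ℝ (LinearMap.range (Q z₀).toLinearMap)
      ≤ Module.finrank ℝ (LinearMap.range (Q z).toLinearMap) := by
  obtain ⟨U, hU, hzU, -, ⟨F⟩⟩ := PoissonFrame.exists_frame h hz₀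
  exact mem_of_superset (hU.mem_nhds hzU) fun z hz => F.finrank_le hz

theorem finrank_le_of_injective {z₀ z : E} {V : (E →L[ℝ] ℝ) →L[ℝ] (E →L[ℝ] ℝ)}
    (hV : Function.Injective V) (h : ∀ ξ, Q z₀ ξ = 0 → Q z (V ξ) = 0) :
    Module.finrank ℝ (LinearMap.range (Q z).toLinearMap)
      ≤ Module.finrank ℝ (LinearMap.range (Q z₀).toLinearMap) := by
  have h1 := LinearMap.finrank_range_add_finrank_ker (Q z).toLinearMap
  have h2 := LinearMap.finrank_range_add_finrank_ker (Q z₀).toLinearMap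
  have h3 : Module.finrank ℝ (LinearMap.ker (Q z₀).toLinearMap)
      ≤ Module.finrank ℝ (LinearMap.ker (Q z).toLinearMap) := by
    refine LinearMap.finrank_le_finrank_of_injective
      (f := V.toLinearMap.restrict (p := LinearMap.ker (Q z₀).toLinearMap)
        (q := LinearMap.ker (Q z).toLinearMap) fun ξ hξ => h ξ hξ) ?_
    intro x y hxy
    exact Subtype.ext (hV (congrArg Subtype.val hxy))
  omega

/-- The rank of a Poisson tensor is constant along a curve with velocity `Q (θ t)`, `θ`
continuous. -/
theorem finrank_eq_of_curve (h : PoissonTensorOn Q Ω) {γ : ℝ → E} {θ : ℝ → E →L[ℝ] ℝ} {a b : ℝ}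
    (hθ : ContinuousOn θ (Icc a b)) (hΩ : ∀ t ∈ Icc a b, γ t ∈ Ω)
    (hγ : ∀ t ∈ Icc a b, HasDerivWithinAt γ (Q (γ t) (θ t)) (Icc a b) t) :
    ∀ t ∈ Icc a b, Module.finrank ℝ (LinearMap.range (Q (γ t)).toLinearMap)
      = Module.finrank ℝ (LinearMap.range (Q (γ a)).toLinearMap) := by
  refine eq_left_of_eventually_eq fun t₀ ht₀ => ?_
  have hab : a ≤ b := ht₀.1.trans ht₀.2
  have hγc : ContinuousOn γ (Icc a b) := fun t ht => (hγ t ht).continuousWithinAt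
  have hDc : ContinuousOn (fun t => fderiv ℝ Q (γ t)) (Icc a b) :=
    (h.contDiffOn.continuousOn_fderiv_of_isOpen h.isOpen (by simp)).comp hγc hΩ
  have hflip : ContinuousOn (fun t => (fderiv ℝ Q (γ t)).flip) (Icc a b) :=
    hDc.clm_flip
  -- `L₀` is the linearized flow on covectors, `ξ ↦ d(θ (Q ξ))` with `ξ`, `θ` held constant. Its
  -- fundamental solution `V` will carry the kernel of `Q (γ t₀)` into that of `Q (γ t)`, which
  -- bounds the rank at `t` from above; semicontinuity gives the other inequality.
  set L₀ : ℝ → (E →L[ℝ] ℝ) →L[ℝ] (E →L[ℝ] ℝ) := fun t =>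
    (ContinuousLinearMap.compL ℝ E E ℝ (θ t)).comp (fderiv ℝ Q (γ t)).flip with hL₀
  have hL₀c : ContinuousOn L₀ (Icc a b) :=
    ((ContinuousLinearMap.compL ℝ E E ℝ).continuous.comp_continuousOn hθ).clm_comp hflip
  obtain ⟨ε, hε, V, hV0, hV⟩ := exists_linearODE_solution
    (L := IccExtend hab ((Icc a b).domRestrict L₀)) hL₀c.domRestrict.Icc_extend' t₀
  have hVc : ContinuousAt V t₀ := (hV t₀ (by constructor <;> linarith)).continuousWithinAt.continuousAt
    (Icc_mem_nhds (by linarith) (by linarith))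
  have hinj : ∀ᶠ t in 𝓝[Icc a b] t₀, Function.Injective (V t) := by
    have h1 : ∀ᶠ W in 𝓝 (V t₀), IsUnit W := by
      rw [hV0]
      exact Units.isOpen.mem_nhds isUnit_one
    refine nhdsWithin_le_nhds ((hVc.eventually h1).mono fun t ht => ?_)
    obtain ⟨u, hu⟩ := ht
    refine Function.LeftInverse.injective (g := (↑u⁻¹ : (E →L[ℝ] ℝ) →L[ℝ] (E →L[ℝ] ℝ))) fun x => ?_
    rw [← hu]
    exact DFunLike.congr_fun u.inv_mul x
  have hball : ∀ᶠ t in 𝓝[Icc a b] t₀, t ∈ Icc (max a (t₀ - ε)) (min b (t₀ + ε)) := by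
    filter_upwards [self_mem_nhdsWithin, nhdsWithin_le_nhds
      (Icc_mem_nhds (show t₀ - ε < t₀ by linarith) (show t₀ < t₀ + ε by linarith))] with t h1 h2
    exact ⟨max_le h1.1 h2.1, le_min h1.2 h2.2⟩
  have hge : ∀ᶠ t in 𝓝[Icc a b] t₀, Module.finrank ℝ (LinearMap.range (Q (γ t₀)).toLinearMap)
      ≤ Module.finrank ℝ (LinearMap.range (Q (γ t)).toLinearMap) :=
    (hγc t₀ ht₀).eventually (h.eventually_finrank_ge (hΩ t₀ ht₀))
  filter_upwards [hinj, hball, hge] with t hti htb htg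
  refine le_antisymm (finrank_le_of_injective hti fun ξ hξ => ?_) htg
  have hsub1 : Icc (max a (t₀ - ε)) (min b (t₀ + ε)) ⊆ Icc a b :=
    Icc_subset_Icc (le_max_left _ _) (min_le_left _ _)
  have hsub2 : Icc (max a (t₀ - ε)) (min b (t₀ + ε)) ⊆ Icc (t₀ - ε) (t₀ + ε) :=
    Icc_subset_Icc (le_max_right _ _) (min_le_right _ _)
  -- By `fderiv_comm`, `y = Q (γ t) (V t ξ)` satisfies `y' = (D_y Q) θ`, which is linear in `y`; it
  -- vanishes at `t₀`, hence identically.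
  refine eq_zero_of_hasDerivWithinAt_linear (y := fun t => Q (γ t) (V t ξ)) (t₀ := t₀)
    (L := fun t => (fderiv ℝ Q (γ t)).flip (θ t)) (a := max a (t₀ - ε)) (b := min b (t₀ + ε))
    ((hflip.clm_apply hθ).mono hsub1) (fun s hs => ?_) ?_ ?_ t htb
  · have hs1 := hsub1 hs
    have hd1 : HasDerivWithinAt (fun t => Q (γ t)) (fderiv ℝ Q (γ s) (Q (γ s) (θ s)))
        (Icc (max a (t₀ - ε)) (min b (t₀ + ε))) s :=
      ((h.differentiableAt (hΩ s hs1)).comp_curve (hγ s hs1)).mono hsub1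
    have hd2 := ((hV s (hsub2 hs)).mono hsub2).clm_apply
      (hasDerivWithinAt_const s (Icc (max a (t₀ - ε)) (min b (t₀ + ε))) ξ)
    refine (hd1.clm_apply hd2).congr_deriv ?_
    have hc := h.fderiv_comm (hΩ s hs1) (V s ξ) (θ s)
    have hLs : IccExtend hab ((Icc a b).domRestrict L₀) s = L₀ s := by
      rw [IccExtend_of_mem _ _ hs1]
      rfl
    rw [hLs]
    have h6 : L₀ s (V s ξ) = dbracket Q (γ s) (V s ξ) (θ s) := rfl
    have h7 : ((L₀ s).comp (V s)) ξ = dbracket Q (γ s) (V s ξ) (θ s) := rfl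
    rw [map_zero, add_zero, h7, ← hc]
    simp
  · exact ⟨max_le ht₀.1 (by linarith), le_min ht₀.2 (by linarith)⟩
  · rw [hV0]
    exact hξ

end PoissonTensorOn

end RankConstant

end

noncomputable section

set_option maxSynthPendingDepth 3

/-! ### Integral curves of the frame fields, with uniform domains and estimates. -/

section LineChart

open Filter Metric

theorem norm_sub_sub_fderiv_le {B C : Type*} [NormedAddCommGroup B] [NormedSpace ℝ B]
    [NormedAddCommGroup C] [NormedSpace ℝ C] {f : B → C} {s : Set B} {K : NNReal}
    (hs : Convex ℝ s) (hf : ∀ z ∈ s, DifferentiableAt ℝ f z)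
    (hK : LipschitzOnWith K (fderiv ℝ f) s) {x y : B} (hx : x ∈ s) (hy : y ∈ s) :
    ‖f y - f x - fderiv ℝ f x (y - x)‖ ≤ K * ‖y - x‖ ^ 2 := by
  have hc : Convex ℝ (s ∩ closedBall x ‖y - x‖) := hs.inter (convex_closedBall _ _)
  have h1 := hc.norm_image_sub_le_of_norm_hasFDerivWithin_le' (f := f) (f' := fderiv ℝ f)
    (φ := fderiv ℝ f x) (C := K * ‖y - x‖) (x := x) (y := y)
    (fun z hz => (hf z hz.1).hasFDerivAt.hasFDerivWithinAt) (fun z hz => ?_)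
    ⟨hx, mem_closedBall_self (norm_nonneg _)⟩ ⟨hy, by simp [dist_eq_norm]⟩
  · calc _ ≤ _ := h1
      _ = _ := by ring
  · have h2 := hK.dist_le_mul z hz.1 x hx
    rw [dist_eq_norm] at h2
    refine h2.trans ?_
    gcongr
    exact hz.2

/-- The Picard–Lindelöf theorem, with a flow that stays in the closed ball. -/
theorem IsPicardLindelof.exists_flow {B : Type*} [NormedAddCommGroup B] [NormedSpace ℝ B]
    [CompleteSpace B] {f : ℝ → B → B} {tmin tmax : ℝ} {t₀ : Icc tmin tmax} {x₀ : B}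
    {a r L K : NNReal} (hf : IsPicardLindelof f t₀ x₀ a r L K) :
    ∃ α : B → ℝ → B, (∀ x ∈ closedBall x₀ r, α x t₀ = x ∧ ∀ t ∈ Icc tmin tmax,
      α x t ∈ closedBall x₀ a ∧ HasDerivWithinAt (α x) (f t (α x t)) (Icc tmin tmax) t) := by
  have key : ∀ x ∈ closedBall x₀ r, ∃ α : ℝ → B, α t₀ = x ∧ ∀ t ∈ Icc tmin tmax,
      α t ∈ closedBall x₀ a ∧ HasDerivWithinAt α (f t (α t)) (Icc tmin tmax) t := by
    intro x hx
    obtain ⟨α, hα⟩ := ODE.FunSpace.exists_isFixedPt_next hf hx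
    refine ⟨α.compProj, by rw [ODE.FunSpace.compProj_val, ← hα, ODE.FunSpace.next_apply₀],
      fun t ht => ⟨α.compProj_mem_closedBall hf.mul_max_le, ?_⟩⟩
    apply ODE.hasDerivWithinAt_picard_Icc t₀.2 hf.continuousOn_uncurry
      α.continuous_compProj.continuousOn (fun _ ht' ↦ α.compProj_mem_closedBall hf.mul_max_le)
      x ht |>.congr_of_mem _ ht
    intro t' ht'
    nth_rw 1 [← hα]
    rw [ODE.FunSpace.compProj_of_mem ht', ODE.FunSpace.next_apply]
  classical
  choose α hα using key
  refine ⟨fun x => if hx : x ∈ closedBall x₀ r then α x hx else fun _ => 0, fun x hx => ?_⟩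
  simp only [dif_pos hx]
  exact hα x hx

variable {E : Type*} [NormedAddCommGroup E] [NormedSpace ℝ E]
  {A : Type*} [NormedAddCommGroup A] [NormedSpace ℝ A]
  {Q : E → (E →L[ℝ] ℝ) →L[ℝ] E} {U : Set E}

/-- A uniform family of integral curves `Γ z w` of the vector fields `Y w` of a frame, for initial
points `z` near `z₀` and small constant coefficients `w`. -/
structure LineChart (F : PoissonFrame Q U A) (z₀ : E) where
  R : ℝ
  r : ℝ
  ρ : ℝ
  K : NNReal
  Γ : E → A → ℝ → E
  R_pos : 0 < R
  r_pos : 0 < r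
  ρ_pos : 0 < ρ
  r_le : r ≤ R
  one_le : 1 ≤ K
  ball_subset : closedBall z₀ (2 * R) ⊆ U
  lip : LipschitzOnWith K F.Y (closedBall z₀ (2 * R))
  bound : ∀ z ∈ closedBall z₀ (2 * R), ‖F.Y z‖ ≤ K
  bound_fderiv : ∀ z ∈ closedBall z₀ (2 * R), ‖fderiv ℝ F.Y z‖ ≤ K
  taylor : ∀ z ∈ closedBall z₀ (2 * R), ∀ z' ∈ closedBall z₀ (2 * R),
    ‖F.Y z' - F.Y z - fderiv ℝ F.Y z (z' - z)‖ ≤ K * ‖z' - z‖ ^ 2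
  Γ_zero : ∀ z ∈ closedBall z₀ r, ∀ w, ‖w‖ ≤ ρ → Γ z w 0 = z
  Γ_mem : ∀ z ∈ closedBall z₀ r, ∀ w, ‖w‖ ≤ ρ → ∀ t ∈ Icc (-1 : ℝ) 2,
    Γ z w t ∈ closedBall z₀ R
  hasDeriv : ∀ z ∈ closedBall z₀ r, ∀ w, ‖w‖ ≤ ρ → ∀ t ∈ Icc (-1 : ℝ) 2,
    HasDerivWithinAt (Γ z w) (F.Y (Γ z w t) w) (Icc (-1) 2) t

namespace LineChart

theorem exists_bounds {B C : Type*} [NormedAddCommGroup B] [NormedSpace ℝ B]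
    [NormedAddCommGroup C] [NormedSpace ℝ C] {f : B → C} {U : Set B} (hU : IsOpen U)
    (hf : ContDiffOn ℝ ∞ f U) {z₀ : B} (hz₀ : z₀ ∈ U) :
    ∃ R > 0, ∃ K : NNReal, 1 ≤ K ∧ closedBall z₀ (2 * R) ⊆ U ∧
      LipschitzOnWith K f (closedBall z₀ (2 * R)) ∧
      (∀ z ∈ closedBall z₀ (2 * R), ‖f z‖ ≤ K) ∧
      (∀ z ∈ closedBall z₀ (2 * R), ‖fderiv ℝ f z‖ ≤ K) ∧
      ∀ z ∈ closedBall z₀ (2 * R), ∀ z' ∈ closedBall z₀ (2 * R),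
        ‖f z' - f z - fderiv ℝ f z (z' - z)‖ ≤ K * ‖z' - z‖ ^ 2 := by
  have hfa := hf.contDiffAt (hU.mem_nhds hz₀)
  have hda : ContDiffAt ℝ 1 (fderiv ℝ f) z₀ := hfa.fderiv_right (m := 1) (by norm_cast)
  obtain ⟨K₁, s₁, hs₁, hl₁⟩ := (hfa.of_le (by norm_cast) :
    ContDiffAt ℝ 1 f z₀).exists_lipschitzOnWith
  obtain ⟨K₂, s₂, hs₂, hl₂⟩ := hda.exists_lipschitzOnWith
  have hb₁ : ∀ᶠ z in 𝓝 z₀, ‖f z‖₊ < ‖f z₀‖₊ + 1 :=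
    hfa.continuousAt.nnnorm.eventually_lt_const (by simp)
  have hb₂ : ∀ᶠ z in 𝓝 z₀, ‖fderiv ℝ f z‖₊ < ‖fderiv ℝ f z₀‖₊ + 1 :=
    hda.continuousAt.nnnorm.eventually_lt_const (by simp)
  obtain ⟨δ, hδ, hball⟩ := nhds_basis_closedBall.mem_iff.1
    (inter_mem (inter_mem hs₁ hs₂) (inter_mem (inter_mem hb₁ hb₂) (hU.mem_nhds hz₀)))
  set K : NNReal := max (max (max K₁ K₂) (max (‖f z₀‖₊ + 1) (‖fderiv ℝ f z₀‖₊ + 1))) 1 with hK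
  have h2 : 2 * (δ / 2) = δ := by ring
  refine ⟨δ / 2, by positivity, K, le_max_right _ _, ?_⟩
  rw [h2]
  have hKK₁ : K₁ ≤ K := by simp [hK]
  have hKK₂ : K₂ ≤ K := by simp [hK]
  refine ⟨fun z hz => (hball hz).2.2, (hl₁.mono fun z hz => (hball hz).1.1).weaken hKK₁,
    fun z hz => ?_, fun z hz => ?_, fun z hz z' hz' => ?_⟩
  · have h3 : ‖f z‖₊ < ‖f z₀‖₊ + 1 := (hball hz).2.1.1
    have h4 : ‖f z₀‖₊ + 1 ≤ K := by simp [hK]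
    exact_mod_cast h3.le.trans h4
  · have h3 : ‖fderiv ℝ f z‖₊ < ‖fderiv ℝ f z₀‖₊ + 1 := (hball hz).2.1.2
    have h4 : ‖fderiv ℝ f z₀‖₊ + 1 ≤ K := by simp [hK]
    exact_mod_cast h3.le.trans h4
  · exact norm_sub_sub_fderiv_le (convex_closedBall _ _)
      (fun y hy => (hf.contDiffAt (hU.mem_nhds (hball hy).2.2)).differentiableAt (by simp))
      ((hl₂.mono fun z hz => (hball hz).1.2).weaken hKK₂) hz hz'

/-- The coefficient `w` is carried along as a constant coordinate, so one application of
Picard–Lindelöf covers all `(z, w)`. The factor `c = 1 / (4K)` lowers the speed on the ball of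
radius `R` to `R / 4`, so that during times of length at most 2 a point starting within `R / 2`
stays in that ball; the curve for `w` is the one of the rescaled field for `c⁻¹ w`. The interval
`[-1, 2]` leaves room around `[0, 1]` for a cutoff in time. -/
theorem exists_lineChart [CompleteSpace E] [CompleteSpace A] (F : PoissonFrame Q U A)
    (hU : PoissonTensorOn Q U) {z₀ : E} (hz₀ : z₀ ∈ U) : Nonempty (LineChart F z₀) := by
  obtain ⟨R, hR, K, hK, hball, hlip, hb, hb', htay⟩ :=
    exists_bounds hU.isOpen (F.contDiffOn_Y hU.contDiffOn) hz₀
  have hK0 : (0 : ℝ) < K := by exact_mod_cast one_pos.trans_le hK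
  set Rn : NNReal := ⟨R, hR.le⟩ with hRn
  have hsub : closedBall z₀ R ⊆ closedBall z₀ (2 * R) := closedBall_subset_closedBall (by linarith)
  -- the field `(z, w) ↦ (c Y z w, 0)` on the ball of radius `R`
  set c : ℝ := 1 / (4 * K) with hc
  have hc0 : 0 < c := by positivity
  set v : E × A → E × A := fun x => (c • F.Y x.1 x.2, 0) with hv
  have hmem : ∀ x ∈ closedBall (z₀, (0 : A)) Rn, x.1 ∈ closedBall z₀ (2 * R) ∧ ‖x.2‖ ≤ R := by
    intro x hx
    rw [← closedBall_prod_same] at hx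
    exact ⟨hsub hx.1, mem_closedBall_zero_iff.1 hx.2⟩
  have hpl : IsPicardLindelof (fun _ => v) (tmin := -1) (tmax := 2) ⟨0, by simp⟩ (z₀, (0 : A))
      Rn (Rn / 2) (Rn / 4) (1 / 4 * (Rn + 1)) := by
    refine IsPicardLindelof.of_time_independent (fun x hx => ?_) ?_ ?_
    · obtain ⟨h1, h2⟩ := hmem x hx
      have h3 : ‖F.Y x.1 x.2‖ ≤ K * R :=
        ((F.Y x.1).le_opNorm _).trans (mul_le_mul (hb _ h1) h2 (norm_nonneg _) hK0.le)
      have h4 : ‖v x‖ = c * ‖F.Y x.1 x.2‖ := by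
        simp [hv, Prod.norm_def, norm_smul, abs_of_pos hc0]
        positivity
      rw [h4]
      push_cast
      calc c * ‖F.Y x.1 x.2‖ ≤ c * (K * R) := by gcongr
        _ = R / 4 := by rw [hc]; field_simp
    · refine LipschitzOnWith.of_dist_le_mul fun x hx y hy => ?_
      obtain ⟨h1, h2⟩ := hmem x hx
      obtain ⟨h3, h4⟩ := hmem y hy
      have h5 : dist (v x) (v y) = c * ‖F.Y x.1 x.2 - F.Y y.1 y.2‖ := by
        simp [hv, dist_eq_norm, ← smul_sub, norm_smul, abs_of_pos hc0]
        positivity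
      have h6 : F.Y x.1 x.2 - F.Y y.1 y.2 = (F.Y x.1 - F.Y y.1) x.2 + F.Y y.1 (x.2 - y.2) := by
        simp
      have h7 : ‖F.Y x.1 - F.Y y.1‖ ≤ K * dist x y := by
        rw [← dist_eq_norm]
        refine (hlip.dist_le_mul _ h1 _ h3).trans ?_
        gcongr
        exact le_max_left _ _
      have h8 : ‖x.2 - y.2‖ ≤ dist x y := by
        rw [← dist_eq_norm]
        exact le_max_right _ _
      have h9 : ‖F.Y x.1 x.2 - F.Y y.1 y.2‖ ≤ K * dist x y * R + K * dist x y := by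
        rw [h6]
        refine (norm_add_le _ _).trans (add_le_add ?_ ?_)
        · exact ((F.Y x.1 - F.Y y.1).le_opNorm _).trans
            (mul_le_mul h7 h2 (norm_nonneg _) (by positivity))
        · exact ((F.Y y.1).le_opNorm _).trans
            (mul_le_mul (hb _ h3) h8 (norm_nonneg _) hK0.le)
      rw [h5]
      push_cast
      calc _ ≤ c * (K * dist x y * R + K * dist x y) := by gcongr
        _ = 1 / 4 * (R + 1) * dist x y := by rw [hc]; field_simp
    · have : max ((2 : ℝ) - 0) (0 - -1) = 2 := by norm_num
      push_cast
      rw [this]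
      change R / 4 * 2 ≤ R - R / 2
      linarith
  obtain ⟨α, hα⟩ := hpl.exists_flow
  have hinit : ∀ z ∈ closedBall z₀ (R / 2), ∀ w : A, ‖w‖ ≤ c * (R / 2) →
      (z, c⁻¹ • w) ∈ closedBall (z₀, (0 : A)) ((Rn / 2 : NNReal) : ℝ) := by
    intro z hz w hw
    rw [← closedBall_prod_same]
    refine ⟨hz, ?_⟩
    rw [mem_closedBall_zero_iff, norm_smul, norm_inv, Real.norm_of_nonneg hc0.le]
    change c⁻¹ * ‖w‖ ≤ R / 2
    rwa [inv_mul_le_iff₀ hc0]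
  have hsnd : ∀ x ∈ closedBall (z₀, (0 : A)) ((Rn / 2 : NNReal) : ℝ), ∀ t ∈ Icc (-1 : ℝ) 2,
      (α x t).2 = x.2 := by
    intro x hx t ht
    have hd : ∀ s ∈ Icc (-1 : ℝ) 2,
        HasDerivWithinAt (fun s => (α x s).2) 0 (Icc (-1) 2) s := fun s hs =>
      (hasFDerivAt_snd (𝕜 := ℝ) (E := E) (F := A) (p := α x s)).comp_hasDerivWithinAt s
        ((hα x hx).2 s hs).2
    have h1 := Convex.is_const_of_fderivWithin_eq_zero (𝕜 := ℝ) (convex_Icc (-1 : ℝ) 2)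
      (f := fun s => (α x s).2) (fun s hs => (hd s hs).differentiableWithinAt) (fun s hs => ?_)
      ht (show (0 : ℝ) ∈ Icc (-1 : ℝ) 2 by simp)
    · have h2 : α x 0 = x := (hα x hx).1
      change (α x t).2 = (α x 0).2 at h1
      rw [h1, h2]
    · have h3 := (hd s hs).hasFDerivWithinAt.fderivWithin
        (uniqueDiffOn_Icc (show (-1 : ℝ) < 2 by norm_num) s hs)
      rw [h3]
      ext
      simp
  refine ⟨⟨R, R / 2, c * (R / 2), K, fun z w t => (α (z, c⁻¹ • w) t).1, hR, by positivity,
    by positivity, by linarith, hK, hball, hlip, hb, hb', htay, fun z hz w hw => ?_,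
    fun z hz w hw t ht => ?_, fun z hz w hw t ht => ?_⟩⟩
  · exact congrArg Prod.fst (hα _ (hinit z hz w hw)).1
  · have h1 := ((hα _ (hinit z hz w hw)).2 t ht).1
    rw [← closedBall_prod_same] at h1
    exact h1.1
  · have h1 := ((hα _ (hinit z hz w hw)).2 t ht).2
    have h2 := (hasFDerivAt_fst (𝕜 := ℝ) (E := E) (F := A)
      (p := α (z, c⁻¹ • w) t)).comp_hasDerivWithinAt t h1
    refine h2.congr_deriv ?_
    change c • F.Y _ _ = F.Y _ w
    rw [hsnd _ (hinit z hz w hw) t ht, map_smul, smul_smul, mul_inv_cancel₀ hc0.ne', one_smul]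

end LineChart

end LineChart

end

noncomputable section

set_option maxSynthPendingDepth 3

/-! ### Dependence of the lines on their data, and the plaque coordinate. -/

section LineChartLemmas

open Filter Metric Asymptotics

variable {E : Type*} [NormedAddCommGroup E] [NormedSpace ℝ E]
  {A : Type*} [NormedAddCommGroup A] [NormedSpace ℝ A]
  {Q : E → (E →L[ℝ] ℝ) →L[ℝ] E} {U : Set E}

namespace LineChart

variable {F : PoissonFrame Q U A} {z₀ : E} (L : LineChart F z₀)
include L

theorem K_pos : (0 : ℝ) < L.K := by exact_mod_cast one_pos.trans_le L.one_le

theorem closedBall_subset_two : closedBall z₀ L.R ⊆ closedBall z₀ (2 * L.R) :=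
  closedBall_subset_closedBall (by linarith [L.R_pos])

theorem closedBall_r_subset : closedBall z₀ L.r ⊆ closedBall z₀ L.R :=
  closedBall_subset_closedBall L.r_le

theorem mem_U {z : E} (hz : z ∈ closedBall z₀ L.R) : z ∈ U :=
  L.ball_subset (L.closedBall_subset_two hz)

section

variable {z : E} (hz : z ∈ closedBall z₀ L.r) {w : A} (hw : ‖w‖ ≤ L.ρ)
include hz hw

theorem hasDeriv_unit {t : ℝ} (ht : t ∈ Icc (0 : ℝ) 1) :
    HasDerivWithinAt (L.Γ z w) (F.Y (L.Γ z w t) w) (Icc 0 1) t :=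
  (L.hasDeriv z hz w hw t ⟨by linarith [ht.1], by linarith [ht.2]⟩).mono
    (Icc_subset_Icc (by norm_num) (by norm_num))

theorem Γ_mem_unit {t : ℝ} (ht : t ∈ Icc (0 : ℝ) 1) : L.Γ z w t ∈ closedBall z₀ L.R :=
  L.Γ_mem z hz w hw t ⟨by linarith [ht.1], by linarith [ht.2]⟩

/-- Since `p (Y w) = w`, lines project to straight segments run at constant speed. -/
theorem p_Γ {t : ℝ} (ht : t ∈ Icc (0 : ℝ) 1) : F.p (L.Γ z w t) = F.p z + t • w := by
  have hd : ∀ s ∈ Icc (0 : ℝ) 1,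
      HasDerivWithinAt (fun s => F.p (L.Γ z w s) - s • w) 0 (Icc 0 1) s := by
    intro s hs
    have h1 := F.p.hasFDerivAt.comp_hasDerivWithinAt s (L.hasDeriv_unit hz hw hs)
    have h2 := ((hasDerivAt_id s).smul_const w).hasDerivWithinAt (s := Icc 0 1)
    refine (h1.sub h2).congr_deriv ?_
    rw [F.p_Y (L.mem_U (L.Γ_mem_unit hz hw hs)), one_smul, sub_self]
  have h1 := constant_of_has_deriv_right_zero (fun s hs => (hd s hs).continuousWithinAt)
    (fun s hs => (hd s (Ico_subset_Icc_self hs)).mono_of_mem_nhdsWithin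
      (mem_of_superset (Icc_mem_nhdsGE hs.2) (Icc_subset_Icc hs.1 le_rfl))) t ht
  rw [zero_smul, sub_zero, L.Γ_zero z hz w hw] at h1
  rw [← h1, sub_add_cancel]

theorem norm_Γ_sub_Γ_le {s t : ℝ} (hs : s ∈ Icc (0 : ℝ) 1) (ht : t ∈ Icc (0 : ℝ) 1) :
    ‖L.Γ z w t - L.Γ z w s‖ ≤ L.K * ‖w‖ := by
  have h1 := (convex_Icc (0 : ℝ) 1).norm_image_sub_le_of_norm_hasDerivWithin_le
    (C := L.K * ‖w‖) (fun s hs => L.hasDeriv_unit hz hw hs) (fun s hs => ?_) hs ht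
  · refine h1.trans (mul_le_of_le_one_right (by positivity) ?_)
    rw [Real.norm_eq_abs, abs_le]
    constructor <;> linarith [hs.1, hs.2, ht.1, ht.2]
  · exact ((F.Y _).le_opNorm _).trans (mul_le_mul_of_nonneg_right
      (L.bound _ (L.closedBall_subset_two (L.Γ_mem_unit hz hw hs))) (norm_nonneg _))

theorem norm_Γ_sub_le {t : ℝ} (ht : t ∈ Icc (0 : ℝ) 1) : ‖L.Γ z w t - z‖ ≤ L.K * ‖w‖ := by
  have := L.norm_Γ_sub_Γ_le hz hw (left_mem_Icc.2 zero_le_one) ht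
  rwa [L.Γ_zero z hz w hw] at this

omit hz in
theorem lipschitz_Y_apply :
    LipschitzOnWith (L.K * ⟨L.ρ, L.ρ_pos.le⟩) (fun y => F.Y y w) (closedBall z₀ (2 * L.R)) := by
  refine LipschitzOnWith.of_dist_le_mul fun x hx y hy => ?_
  have h1 := L.lip.dist_le_mul x hx y hy
  rw [dist_eq_norm] at h1 ⊢
  change ‖(F.Y x - F.Y y) w‖ ≤ L.K * L.ρ * dist x y
  calc _ ≤ ‖F.Y x - F.Y y‖ * ‖w‖ := (F.Y x - F.Y y).le_opNorm _
    _ ≤ (L.K * dist x y) * L.ρ := by gcongr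
    _ = _ := by ring

/-- The Grönwall estimate for an approximate integral curve. -/
theorem norm_Γ_one_sub_le {g g' : ℝ → E} {δ ε : ℝ}
    (hg : ∀ t ∈ Icc (0 : ℝ) 1, HasDerivWithinAt g (g' t) (Icc 0 1) t)
    (hgm : ∀ t ∈ Icc (0 : ℝ) 1, g t ∈ closedBall z₀ (2 * L.R))
    (hε : ∀ t ∈ Icc (0 : ℝ) 1, ‖g' t - F.Y (g t) w‖ ≤ ε) (hδ : ‖g 0 - z‖ ≤ δ) :
    ‖L.Γ z w 1 - g 1‖
      ≤ (δ + ε) * (Real.exp (L.K * L.ρ) + (Real.exp (L.K * L.ρ) - 1) / (L.K * L.ρ)) := by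
  have hmono : ∀ t ∈ Ico (0 : ℝ) 1, Icc (0 : ℝ) 1 ∈ 𝓝[Ici t] t := fun t ht =>
    mem_of_superset (Icc_mem_nhdsGE ht.2) (Icc_subset_Icc ht.1 le_rfl)
  have h1 := dist_le_of_approx_trajectories_ODE_of_mem (v := fun _ y => F.Y y w)
    (s := fun _ => closedBall z₀ (2 * L.R)) (a := 0) (b := 1) (εf := 0) (εg := ε) (δ := δ)
    (f := L.Γ z w) (f' := fun t => F.Y (L.Γ z w t) w) (g := g) (g' := g')
    (fun _ _ => L.lipschitz_Y_apply hw)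
    (fun t ht => (L.hasDeriv_unit hz hw ht).continuousWithinAt)
    (fun t ht => (L.hasDeriv_unit hz hw (Ico_subset_Icc_self ht)).mono_of_mem_nhdsWithin
      (hmono t ht)) (fun t ht => (dist_self _).le)
    (fun t ht => L.closedBall_subset_two (L.Γ_mem_unit hz hw (Ico_subset_Icc_self ht)))
    (fun t ht => (hg t ht).continuousWithinAt)
    (fun t ht => (hg t (Ico_subset_Icc_self ht)).mono_of_mem_nhdsWithin (hmono t ht))
    (fun t ht => (dist_eq_norm _ _).trans_le (hε t (Ico_subset_Icc_self ht)))
    (fun t ht => hgm t (Ico_subset_Icc_self ht))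
    (by rw [L.Γ_zero z hz w hw, dist_comm, dist_eq_norm]; exact hδ) 1 (right_mem_Icc.2 zero_le_one)
  have hK : (0 : ℝ) < L.K * L.ρ := mul_pos L.K_pos L.ρ_pos
  have hcoe : ((L.K * ⟨L.ρ, L.ρ_pos.le⟩ : NNReal) : ℝ) = L.K * L.ρ := rfl
  have hδ0 : 0 ≤ δ := (norm_nonneg _).trans hδ
  have hε0 : 0 ≤ ε := (norm_nonneg _).trans (hε 0 (left_mem_Icc.2 zero_le_one))
  rw [hcoe, gronwallBound_of_K_ne_0 hK.ne', dist_eq_norm, zero_add, sub_zero] at h1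
  beta_reduce at h1
  rw [mul_one] at h1
  refine h1.trans ?_
  have h2 : 0 ≤ (Real.exp (L.K * L.ρ) - 1) / (L.K * L.ρ) :=
    div_nonneg (sub_nonneg.2 (Real.one_le_exp hK.le)) hK.le
  have h3 := (Real.exp_pos (L.K * L.ρ)).le
  have h4 : ε / (L.K * L.ρ) * (Real.exp (L.K * L.ρ) - 1)
      = ε * ((Real.exp (L.K * L.ρ) - 1) / (L.K * L.ρ)) := by ring
  rw [h4]
  nlinarith [mul_nonneg hδ0 h2, mul_nonneg hε0 h3]

theorem eq_Γ_one {g : ℝ → E}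
    (hg : ∀ t ∈ Icc (0 : ℝ) 1, HasDerivWithinAt g (F.Y (g t) w) (Icc 0 1) t)
    (hgm : ∀ t ∈ Icc (0 : ℝ) 1, g t ∈ closedBall z₀ (2 * L.R)) (h0 : g 0 = z) :
    g 1 = L.Γ z w 1 := by
  have := L.norm_Γ_one_sub_le hz hw (δ := 0) (ε := 0) hg hgm (fun t ht => by simp) (by simp [h0])
  rw [zero_add, zero_mul, norm_le_zero_iff, sub_eq_zero] at this
  exact this.symm

theorem Γ_reverse (h1 : L.Γ z w 1 ∈ closedBall z₀ L.r) : L.Γ (L.Γ z w 1) (-w) 1 = z := by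
  have h2 : MapsTo (fun t : ℝ => 1 - t) (Icc 0 1) (Icc 0 1) := fun t ht =>
    ⟨by linarith [ht.2], by linarith [ht.1]⟩
  have h3 := L.eq_Γ_one (g := fun t => L.Γ z w (1 - t)) h1 (w := -w) (by rwa [norm_neg])
    (fun t ht => ?_) (fun t ht => L.closedBall_subset_two (L.Γ_mem_unit hz hw (h2 ht)))
    (by simp)
  · rw [← h3, sub_self, L.Γ_zero z hz w hw]
  · have h4 : HasDerivWithinAt (fun t : ℝ => 1 - t) (-1) (Icc 0 1) t := by
      simpa using ((hasDerivAt_id t).const_sub 1).hasDerivWithinAt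
    have h5 := (L.hasDeriv_unit hz hw (h2 ht)).scomp t h4 h2
    refine h5.congr_deriv ?_
    simp

end

/-- Grönwall, with the line of `(z', w')` regarded as an approximate line of `(z, w)`: its defect is
at most `K ‖w' - w‖`. -/
theorem continuousOn_Γ_one :
    ContinuousOn (fun x : E × A => L.Γ x.1 x.2 1) (closedBall z₀ L.r ×ˢ closedBall 0 L.ρ) := by
  rintro ⟨z, w⟩ ⟨hz, hw⟩
  rw [mem_closedBall_zero_iff] at hw
  set C := Real.exp (L.K * L.ρ) + (Real.exp (L.K * L.ρ) - 1) / (L.K * L.ρ)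
  have key : ∀ x ∈ closedBall z₀ L.r ×ˢ closedBall (0 : A) L.ρ,
      dist (L.Γ x.1 x.2 1) (L.Γ z w 1) ≤ (‖x.1 - z‖ + L.K * ‖x.2 - w‖) * C := by
    rintro ⟨z', w'⟩ ⟨hz', hw'⟩
    rw [mem_closedBall_zero_iff] at hw'
    rw [dist_comm, dist_eq_norm]
    refine L.norm_Γ_one_sub_le hz hw (fun t ht => L.hasDeriv_unit hz' hw' ht)
      (fun t ht => L.closedBall_subset_two (L.Γ_mem_unit hz' hw' ht)) (fun t ht => ?_) ?_
    · rw [← map_sub]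
      exact ((F.Y _).le_opNorm _).trans (mul_le_mul_of_nonneg_right
        (L.bound _ (L.closedBall_subset_two (L.Γ_mem_unit hz' hw' ht))) (norm_nonneg _))
    · rw [L.Γ_zero z' hz' w' hw']
  refine tendsto_iff_dist_tendsto_zero.2 (squeeze_zero' (Eventually.of_forall fun _ => dist_nonneg)
    (eventually_mem_nhdsWithin.mono key) ?_)
  have h1 : Continuous fun x : E × A => (‖x.1 - z‖ + L.K * ‖x.2 - w‖) * C := by fun_prop
  have h2 := (h1.tendsto (z, w)).mono_left
    (nhdsWithin_le_nhds (s := closedBall z₀ L.r ×ˢ closedBall (0 : A) L.ρ))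
  simpa using h2

/-- The radius of the domain of the plaque coordinate `β`. -/
def δ : ℝ := min (L.r / (1 + L.K * ‖F.p‖)) (L.ρ / (2 * (‖F.p‖ + 1)))

/-- The domain of the plaque coordinate `β`. -/
def dom : Set E := ball z₀ L.δ

/-- The plaque coordinate: the point at which the plaque of `z` meets the fibre of `p` through
`z₀`. -/
def β (z : E) : E := L.Γ z (F.p z₀ - F.p z) 1

theorem δ_pos : 0 < L.δ := by
  have := L.r_pos
  have := L.ρ_pos
  exact lt_min (by positivity) (by positivity)

theorem isOpen_dom : IsOpen L.dom := isOpen_ball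

theorem mem_dom : z₀ ∈ L.dom := mem_ball_self L.δ_pos

/-- The two terms of the minimum `δ`: the first keeps the endpoint `β z` where lines can start
again, the second keeps differences of `p` between points of `dom` below `ρ`. -/
theorem dom_bound {z : E} (hz : z ∈ L.dom) :
    (1 + L.K * ‖F.p‖) * ‖z - z₀‖ ≤ L.r ∧ 2 * (‖F.p‖ * ‖z - z₀‖) ≤ L.ρ := by
  have h0 : ‖z - z₀‖ < L.δ := (dist_eq_norm z z₀).symm.trans_lt (mem_ball.1 hz)
  have h1 : ‖z - z₀‖ ≤ L.r / (1 + L.K * ‖F.p‖) := h0.le.trans (min_le_left _ _)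
  have h2 : ‖z - z₀‖ ≤ L.ρ / (2 * (‖F.p‖ + 1)) := h0.le.trans (min_le_right _ _)
  rw [le_div_iff₀ (by positivity)] at h1 h2
  constructor
  · linarith
  · nlinarith [norm_nonneg (z - z₀)]

theorem dom_subset : L.dom ⊆ closedBall z₀ L.r := fun z hz => by
  have h1 := (L.dom_bound hz).1
  rw [mem_closedBall, dist_eq_norm]
  have : 0 ≤ L.K * ‖F.p‖ * ‖z - z₀‖ := by positivity
  linarith

theorem dom_subset_U : L.dom ⊆ U := fun _ hz => L.mem_U (L.closedBall_r_subset (L.dom_subset hz))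

theorem norm_p_sub_le {z z' : E} (hz : z ∈ L.dom) (hz' : z' ∈ L.dom) :
    ‖F.p z' - F.p z‖ ≤ L.ρ := by
  have h1 := (L.dom_bound hz).2
  have h2 := (L.dom_bound hz').2
  have h3 : F.p z' - F.p z = F.p (z' - z₀) - F.p (z - z₀) := by simp
  rw [h3]
  refine (norm_sub_le _ _).trans ?_
  linarith [F.p.le_opNorm (z' - z₀), F.p.le_opNorm (z - z₀)]

theorem β_mem {z : E} (hz : z ∈ L.dom) : L.β z ∈ closedBall z₀ L.r := by
  have h1 := L.norm_Γ_sub_le (L.dom_subset hz) (L.norm_p_sub_le hz L.mem_dom)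
    (right_mem_Icc.2 zero_le_one)
  have h2 := (L.dom_bound hz).1
  rw [mem_closedBall, dist_eq_norm]
  have h3 : ‖F.p z₀ - F.p z‖ ≤ ‖F.p‖ * ‖z - z₀‖ := by
    rw [← map_sub, ← norm_sub_rev]
    exact F.p.le_opNorm _
  calc ‖L.β z - z₀‖ = ‖(L.β z - z) + (z - z₀)‖ := by congr 1; abel
    _ ≤ ‖L.β z - z‖ + ‖z - z₀‖ := norm_add_le _ _
    _ ≤ L.K * (‖F.p‖ * ‖z - z₀‖) + ‖z - z₀‖ := by
        gcongr
        exact h1.trans (by gcongr)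
    _ ≤ L.r := by linarith

theorem continuousOn_β : ContinuousOn L.β L.dom := by
  refine L.continuousOn_Γ_one.comp (f := fun z => (z, F.p z₀ - F.p z)) (by fun_prop) fun z hz => ?_
  exact ⟨L.dom_subset hz, mem_closedBall_zero_iff.2 (L.norm_p_sub_le hz L.mem_dom)⟩

theorem Γ_β {z : E} (hz : z ∈ L.dom) : L.Γ (L.β z) (F.p z - F.p z₀) 1 = z := by
  have := L.Γ_reverse (L.dom_subset hz) (L.norm_p_sub_le hz L.mem_dom) (L.β_mem hz)
  rwa [neg_sub] at this

/-- A point is recovered by running its line backwards from `β z`, so `(β, p)` are injective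
coordinates on `dom`. -/
theorem eq_of_β_eq {z z' : E} (hz : z ∈ L.dom) (hz' : z' ∈ L.dom) (hβ : L.β z = L.β z')
    (hp : F.p z = F.p z') : z = z' := by
  rw [← L.Γ_β hz, ← L.Γ_β hz', hβ, hp]

theorem β_self : L.β z₀ = z₀ := by
  have h1 := L.norm_Γ_sub_le (L.dom_subset L.mem_dom) (L.norm_p_sub_le L.mem_dom L.mem_dom)
    (right_mem_Icc.2 zero_le_one)
  rw [sub_self, norm_zero, mul_zero, norm_le_zero_iff, sub_eq_zero] at h1
  rw [β, sub_self]
  exact h1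

/-- A curve in the plaque of `z₀` has its velocity at `z₀` in the span of the frame. -/
theorem deriv_eq_of_β_eq {c : ℝ → E} {v : E} (hc : HasDerivAt c v 0) (h0 : c 0 = z₀)
    (hm : ∀ᶠ t in 𝓝 0, c t ∈ L.dom ∧ L.β (c t) = z₀) : v = F.Y z₀ (F.p v) := by
  -- The line from `c t` ends at `z₀`, so `c t - z₀` equals `Y z₀ (p (c t) - p z₀)` up to a
  -- quadratic error. Thus `b` has derivative zero at 0, and that derivative is `v - Y z₀ (p v)`.
  set b : ℝ → E := fun t => c t - F.Y z₀ (F.p (c t)) with hb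
  have h1 : HasDerivAt b (v - F.Y z₀ (F.p v)) 0 :=
    hc.sub (((F.Y z₀).comp F.p).hasFDerivAt.comp_hasDerivAt 0 hc)
  have hO : (fun t => F.p (c t) - F.p z₀) =O[𝓝 0] fun t : ℝ => t - 0 := by
    have h2 := (F.p.hasFDerivAt.comp_hasDerivAt (0 : ℝ) hc).hasFDerivAt.isBigO_sub
    simpa [h0] using h2
  have h2 : HasDerivAt b 0 0 := by
    rw [hasDerivAt_iff_isLittleO]
    have h3 : (fun t => b t - b 0 - (t - 0) • (0 : E)) =O[𝓝 0]
        fun t => ‖F.p (c t) - F.p z₀‖ ^ 2 := by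
      refine IsBigO.of_bound (L.K * L.K) (hm.mono fun t ht => ?_)
      obtain ⟨htd, hβ⟩ := ht
      have hw := L.norm_p_sub_le htd L.mem_dom
      have hz := L.dom_subset htd
      set w := F.p z₀ - F.p (c t) with hwdef
      have hmv := (convex_Icc (0 : ℝ) 1).norm_image_sub_le_of_norm_hasDerivWithin_le
        (f := fun s => L.Γ (c t) w s - s • F.Y z₀ w)
        (C := L.K * (L.K * ‖w‖) * ‖w‖)
        (fun s hs => (L.hasDeriv_unit hz hw hs).sub
          ((hasDerivAt_id s).smul_const (F.Y z₀ w)).hasDerivWithinAt)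
        (fun s hs => ?_) (left_mem_Icc.2 zero_le_one) (right_mem_Icc.2 zero_le_one)
      · rw [L.Γ_zero _ hz _ hw, one_smul, zero_smul, sub_zero, sub_zero, norm_one, mul_one] at hmv
        have h4 : L.Γ (c t) w 1 = z₀ := hβ
        rw [h4] at hmv
        have h5 : b t - b 0 - (t - 0) • (0 : E) = -(z₀ - F.Y z₀ w - c t) := by
          simp only [hb, h0, hwdef, map_sub, smul_zero]
          abel
        rw [h5, norm_neg, norm_pow, norm_norm, norm_sub_rev (F.p (c t))]
        refine hmv.trans (le_of_eq ?_)
        ring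
      · have h6 : L.Γ (c t) w s ∈ closedBall z₀ (2 * L.R) :=
          L.closedBall_subset_two (L.Γ_mem_unit hz hw hs)
        have h7 : z₀ ∈ closedBall z₀ (2 * L.R) :=
          mem_closedBall_self (by linarith [L.R_pos])
        have h8 := L.lip.dist_le_mul _ h6 _ h7
        have h9 : dist (L.Γ (c t) w s) z₀ ≤ L.K * ‖w‖ := by
          have := L.norm_Γ_sub_Γ_le hz hw (right_mem_Icc.2 zero_le_one) hs
          have h4 : L.Γ (c t) w 1 = z₀ := hβ
          rwa [h4, ← dist_eq_norm] at this
        rw [one_smul, ← sub_apply]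
        refine ((F.Y _ - F.Y z₀).le_opNorm _).trans ?_
        gcongr
        rw [← dist_eq_norm]
        exact h8.trans (by gcongr)
    refine h3.trans_isLittleO ?_
    have h4 : (fun t => ‖F.p (c t) - F.p z₀‖ ^ 2) =O[𝓝 0] fun t : ℝ => (t - 0) ^ 2 :=
      hO.norm_left.pow 2
    refine h4.trans_isLittleO ?_
    simp only [sub_zero]
    exact isLittleO_pow_id one_lt_two
  exact sub_eq_zero.1 (h1.unique h2)

end LineChart

end LineChartLemmas

end

noncomputable section

set_option maxSynthPendingDepth 3

/-! ### Invariance of the plaque coordinate, and lines as Hamiltonian curves. -/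

section PlaqueCoordinate

open Filter Metric Asymptotics

variable {E : Type*} [NormedAddCommGroup E] [NormedSpace ℝ E] [FiniteDimensional ℝ E]
  {A : Type*} [NormedAddCommGroup A] [NormedSpace ℝ A]
  {Q : E → (E →L[ℝ] ℝ) →L[ℝ] E} {U : Set E}

namespace LineChart

variable {F : PoissonFrame Q U A} {z₀ : E} (L : LineChart F z₀)
include L

theorem finrank_Γ (hU : PoissonTensorOn Q U) {z : E} (hz : z ∈ closedBall z₀ L.r) {w : A}
    (hw : ‖w‖ ≤ L.ρ) {t : ℝ} (ht : t ∈ Icc (0 : ℝ) 1) :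
    Module.finrank ℝ (LinearMap.range (Q (L.Γ z w t)).toLinearMap)
      = Module.finrank ℝ (LinearMap.range (Q z).toLinearMap) := by
  have hmem : ∀ t ∈ Icc (0 : ℝ) 1, L.Γ z w t ∈ U := fun t ht => L.mem_U (L.Γ_mem_unit hz hw ht)
  have h1 := hU.finrank_eq_of_curve (γ := L.Γ z w) (θ := fun t => F.θ (L.Γ z w t) w)
    (a := 0) (b := 1) ?_ hmem (fun t ht => L.hasDeriv_unit hz hw ht) t ht
  · rwa [L.Γ_zero z hz w hw] at h1
  · exact (F.contDiffOn_θ.continuousOn.comp (fun t ht =>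
      (L.hasDeriv_unit hz hw ht).continuousWithinAt) hmem).clm_apply continuousOn_const

/-- The plaque coordinate does not vary along curves tangent to the frame, at points of minimal
rank. -/
theorem hasDerivWithinAt_β (hU : PoissonTensorOn Q U) {γ : ℝ → E} {v : E} {S : Set ℝ} {t : ℝ}
    (hγ : HasDerivWithinAt γ v S t) (hd : γ t ∈ L.dom) (hv : v = F.Y (γ t) (F.p v))
    (hr : Module.finrank ℝ (LinearMap.range (Q (γ t)).toLinearMap) = Module.finrank ℝ A) :
    HasDerivWithinAt (fun s => L.β (γ s)) 0 S t := by
  set a := F.p v with ha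
  set w := F.p z₀ - F.p (γ t) with hw
  have hz := L.dom_subset hd
  have hwρ : ‖w‖ ≤ L.ρ := L.norm_p_sub_le hd L.mem_dom
  set K : ℝ := NNReal.toReal L.K with hK
  have hK0 : 0 < K := L.K_pos
  set e : ℝ → E := fun s => γ s - γ t - (s - t) • v with he
  have heo : e =o[𝓝[S] t] fun s => s - t := hasDerivWithinAt_iff_isLittleO.1 hγ
  set C := Real.exp (L.K * L.ρ) + (Real.exp (L.K * L.ρ) - 1) / (L.K * L.ρ) with hC
  -- The sum of the coefficients of the error terms `n1`, `n2`, `n3`, `n4` below.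
  set C₁ : ℝ := K * ‖F.p‖ + K * K * ‖a‖ ^ 2 + K * K * ‖a‖ * ‖F.p‖ + K * (K * ‖a‖) ^ 2 * L.ρ
    with hC₁
  have hρ0 := L.ρ_pos
  have hC₁0 : 0 ≤ C₁ := by positivity
  have hmemd : ∀ᶠ s in 𝓝[S] t, γ s ∈ L.dom :=
    hγ.continuousWithinAt.eventually (L.isOpen_dom.mem_nhds hd)
  have hsmall : ∀ᶠ s in 𝓝[S] t, |s - t| ≤ 1 ∧ |s - t| * (K * ‖a‖) ≤ L.R := by
    have h1 : Tendsto (fun s : ℝ => |s - t|) (𝓝[S] t) (𝓝 0) := by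
      have : Continuous fun s : ℝ => |s - t| := by fun_prop
      simpa using this.continuousWithinAt.tendsto (x := t) (s := S)
    have h2 : Tendsto (fun s : ℝ => |s - t| * (K * ‖a‖)) (𝓝[S] t) (𝓝 0) := by
      simpa using h1.mul_const (K * ‖a‖)
    exact (h1.eventually_le_const one_pos).and (h2.eventually_le_const L.R_pos)
  have key : ∀ᶠ s in 𝓝[S] t, ‖L.β (γ s) - L.β (γ t)‖
      ≤ (‖e s‖ + C₁ * (‖s - t‖ ^ 2 + ‖e s‖)) * C := by
    filter_upwards [hmemd, hsmall] with s hsd hss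
    obtain ⟨hs1, hsR⟩ := hss
    set h := s - t with hh
    have hpe : ‖F.p z₀ - F.p (γ s)‖ ≤ L.ρ := L.norm_p_sub_le hsd L.mem_dom
    have hws : F.p z₀ - F.p (γ s) = w - h • a - F.p (e s) := by
      simp only [he, hw, ha, map_sub, map_smul]
      abel
    -- Comparison curve between the lines of `γ t` and `γ s`: the line of `γ t` displaced by `h (1 -
    -- σ) Y a`. It starts at `γ t + h v`, which is `γ s` up to `e s`, and ends exactly at `β (γ t)`.
    -- Grönwall against the line of `γ s` then bounds `β (γ s) - β (γ t)`.
    set g : ℝ → E := fun σ => L.Γ (γ t) w σ + (h * (1 - σ)) • F.Y (L.Γ (γ t) w σ) a with hg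
    set D : ℝ → E →L[ℝ] A →L[ℝ] E := fun σ => fderiv ℝ F.Y (L.Γ (γ t) w σ) with hD
    set g' : ℝ → E := fun σ => F.Y (L.Γ (γ t) w σ) w + ((h * (1 - σ)) •
      D σ (F.Y (L.Γ (γ t) w σ) w) a + (-h) • F.Y (L.Γ (γ t) w σ) a) with hg'
    have hdle : ∀ σ ∈ Icc (0 : ℝ) 1,
        ‖(h * (1 - σ)) • F.Y (L.Γ (γ t) w σ) a‖ ≤ |h| * (K * ‖a‖) := by
      intro σ hσ
      rw [norm_smul, norm_mul, Real.norm_eq_abs, Real.norm_eq_abs, mul_assoc]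
      refine mul_le_mul_of_nonneg_left ?_ (abs_nonneg _)
      have h1 : |1 - σ| ≤ 1 := by
        rw [abs_le]
        constructor <;> linarith [hσ.1, hσ.2]
      have h2 : ‖F.Y (L.Γ (γ t) w σ) a‖ ≤ K * ‖a‖ := ((F.Y _).le_opNorm _).trans
        (mul_le_mul_of_nonneg_right (L.bound _ (L.closedBall_subset_two
          (L.Γ_mem_unit hz hwρ hσ))) (norm_nonneg _))
      calc _ ≤ 1 * (K * ‖a‖) := mul_le_mul h1 h2 (norm_nonneg _) zero_le_one
        _ = _ := one_mul _
    have hgm : ∀ σ ∈ Icc (0 : ℝ) 1, g σ ∈ closedBall z₀ (2 * L.R) := by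
      intro σ hσ
      have h1 := L.Γ_mem_unit hz hwρ hσ
      rw [mem_closedBall, dist_eq_norm] at h1 ⊢
      have h2 : g σ - z₀ = (L.Γ (γ t) w σ - z₀) + (h * (1 - σ)) • F.Y (L.Γ (γ t) w σ) a := by
        simp only [hg]
        abel
      rw [h2]
      refine (norm_add_le _ _).trans ?_
      linarith [hdle σ hσ]
    have hgd : ∀ σ ∈ Icc (0 : ℝ) 1, HasDerivWithinAt g (g' σ) (Icc 0 1) σ := by
      intro σ hσ
      have hmem := L.mem_U (L.Γ_mem_unit hz hwρ hσ)
      have hΓ := L.hasDeriv_unit hz hwρ hσ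
      have hYd : DifferentiableAt ℝ F.Y (L.Γ (γ t) w σ) :=
        ((F.contDiffOn_Y hU.contDiffOn).contDiffAt (hU.isOpen.mem_nhds hmem)).differentiableAt
          (by simp)
      have h1 := (hYd.comp_curve hΓ).clm_apply (hasDerivWithinAt_const σ (Icc 0 1) a)
      have h2 : HasDerivWithinAt (fun σ : ℝ => h * (1 - σ)) (-h) (Icc 0 1) σ := by
        simpa using (((hasDerivAt_id σ).const_sub 1).const_mul h).hasDerivWithinAt
      refine (hΓ.add (h2.smul h1)).congr_deriv ?_
      simp [hg', hD]
    have hε : ∀ σ ∈ Icc (0 : ℝ) 1,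
        ‖g' σ - F.Y (g σ) (F.p z₀ - F.p (γ s))‖ ≤ C₁ * (‖h‖ ^ 2 + ‖e s‖) := by
      intro σ hσ
      have hmem := L.Γ_mem_unit hz hwρ hσ
      have hmem2 := L.closedBall_subset_two hmem
      set y := L.Γ (γ t) w σ with hy
      set d := (h * (1 - σ)) • F.Y y a with hd'
      have hdn : ‖d‖ ≤ |h| * (K * ‖a‖) := hdle σ hσ
      have hgy : g σ = y + d := rfl
      -- The second-order Taylor remainder of `Y` along the displacement `d`.
      set τ := F.Y (g σ) - F.Y y - D σ d with hτ
      have hτn : ‖τ‖ ≤ K * (|h| * (K * ‖a‖)) ^ 2 := by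
        have h1 := L.taylor y hmem2 (g σ) (hgm σ hσ)
        have h2 : g σ - y = d := by rw [hgy, add_sub_cancel_left]
        rw [h2] at h1
        refine h1.trans ?_
        gcongr
      have hcomm : D σ d w = (h * (1 - σ)) • D σ (F.Y y w) a := by
        have h3 := F.fderiv_Y_comm hU (L.mem_U hmem)
          ((L.finrank_Γ hU hz hwρ hσ).trans hr) w a
        rw [hd', map_smul]
        change (h * (1 - σ)) • D σ (F.Y y a) w = _
        rw [← h3]
      have hsplit : g' σ - F.Y (g σ) (F.p z₀ - F.p (γ s))
          = F.Y y (F.p (e s)) + h • D σ d a + D σ d (F.p (e s))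
            - τ (F.p z₀ - F.p (γ s)) := by
        have h4 : F.Y (g σ) = F.Y y + D σ d + τ := by
          rw [hτ]
          abel
        have h5 : (F.Y y + D σ d) (F.p z₀ - F.p (γ s)) = F.Y y w - h • F.Y y a
            - F.Y y (F.p (e s)) + D σ d w - h • D σ d a - D σ d (F.p (e s)) := by
          rw [hws, add_apply]
          simp only [map_sub, map_smul]
          abel
        rw [h4, add_apply, h5, hcomm]
        simp only [hg', neg_smul]
        abel
      have hDn : ‖D σ‖ ≤ K := L.bound_fderiv y hmem2
      have hYn : ‖F.Y y‖ ≤ K := L.bound y hmem2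
      have hpn : ‖F.p (e s)‖ ≤ ‖F.p‖ * ‖e s‖ := F.p.le_opNorm _
      have hDd : ‖D σ d‖ ≤ K * (|h| * (K * ‖a‖)) :=
        ((D σ).le_opNorm _).trans (mul_le_mul hDn hdn (norm_nonneg _) hK0.le)
      have n1 : ‖F.Y y (F.p (e s))‖ ≤ K * (‖F.p‖ * ‖e s‖) :=
        ((F.Y y).le_opNorm _).trans (mul_le_mul hYn hpn (norm_nonneg _) hK0.le)
      have n2 : ‖h • D σ d a‖ ≤ |h| * (K * (|h| * (K * ‖a‖)) * ‖a‖) := by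
        rw [norm_smul, Real.norm_eq_abs]
        gcongr
        exact ((D σ d).le_opNorm _).trans (by gcongr)
      have n3 : ‖D σ d (F.p (e s))‖ ≤ K * (1 * (K * ‖a‖)) * (‖F.p‖ * ‖e s‖) := by
        refine ((D σ d).le_opNorm _).trans
          (mul_le_mul (hDd.trans ?_) hpn (norm_nonneg _) (by positivity))
        gcongr
      have n4 : ‖τ (F.p z₀ - F.p (γ s))‖ ≤ K * (|h| * (K * ‖a‖)) ^ 2 * L.ρ :=
        (τ.le_opNorm _).trans (mul_le_mul hτn hpe (norm_nonneg _) (by positivity))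
      rw [hsplit]
      have n5 := norm_sub_le (F.Y y (F.p (e s)) + h • D σ d a + D σ d (F.p (e s)))
        (τ (F.p z₀ - F.p (γ s)))
      have n6 := norm_add₃_le (a := F.Y y (F.p (e s))) (b := h • D σ d a)
        (c := D σ d (F.p (e s)))
      have hh2 : |h| ^ 2 = ‖h‖ ^ 2 := by rw [Real.norm_eq_abs]
      have n2' : |h| * (K * (|h| * (K * ‖a‖)) * ‖a‖) = K * K * ‖a‖ ^ 2 * ‖h‖ ^ 2 := by
        rw [← hh2]
        ring
      have n4' : K * (|h| * (K * ‖a‖)) ^ 2 * L.ρ = K * (K * ‖a‖) ^ 2 * L.ρ * ‖h‖ ^ 2 := by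
        rw [← hh2]
        ring
      have p1 : 0 ≤ (K * ‖F.p‖ + K * K * ‖a‖ * ‖F.p‖) * ‖h‖ ^ 2 := by positivity
      have p2 : 0 ≤ (K * K * ‖a‖ ^ 2 + K * (K * ‖a‖) ^ 2 * L.ρ) * ‖e s‖ := by positivity
      have hfin : C₁ * (‖h‖ ^ 2 + ‖e s‖) = K * (‖F.p‖ * ‖e s‖) + K * K * ‖a‖ ^ 2 * ‖h‖ ^ 2
          + K * (1 * (K * ‖a‖)) * (‖F.p‖ * ‖e s‖) + K * (K * ‖a‖) ^ 2 * L.ρ * ‖h‖ ^ 2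
          + (K * ‖F.p‖ + K * K * ‖a‖ * ‖F.p‖) * ‖h‖ ^ 2
          + (K * K * ‖a‖ ^ 2 + K * (K * ‖a‖) ^ 2 * L.ρ) * ‖e s‖ := by
        rw [hC₁]
        ring
      rw [n2'] at n2
      rw [n4'] at n4
      linarith
    have h0 : ‖g 0 - γ s‖ ≤ ‖e s‖ := by
      have h1 : g 0 - γ s = -e s := by
        simp only [hg, he, sub_zero, mul_one, L.Γ_zero _ hz _ hwρ]
        rw [← hv]
        abel
      rw [h1, norm_neg]
    have hfinal := L.norm_Γ_one_sub_le (L.dom_subset hsd) hpe hgd hgm hε h0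
    have hg1 : g 1 = L.β (γ t) := by
      simp only [hg, sub_self, mul_zero, zero_smul, add_zero]
      rfl
    rw [hg1] at hfinal
    exact hfinal
  have hsq : (fun s => ‖s - t‖ ^ 2) =o[𝓝[S] t] fun s => s - t := by
    have h1 : (fun s : ℝ => s - t) =o[𝓝[S] t] fun _ => (1 : ℝ) := by
      rw [isLittleO_one_iff]
      have : Continuous fun s : ℝ => s - t := by fun_prop
      simpa using this.continuousWithinAt.tendsto (x := t) (s := S)
    have h2 := (isBigO_refl (fun s : ℝ => s - t) (𝓝[S] t)).mul_isLittleO h1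
    have h3 : (fun s : ℝ => (s - t) * (s - t)) =o[𝓝[S] t] fun s => s - t :=
      h2.congr_right fun s => mul_one _
    exact h3.norm_left.congr_left fun s => by rw [norm_mul, sq]
  rw [hasDerivWithinAt_iff_isLittleO]
  refine IsBigO.trans_isLittleO (g := fun s => (‖e s‖ + C₁ * (‖s - t‖ ^ 2 + ‖e s‖)) * C) ?_ ?_
  · refine IsBigO.of_bound 1 (key.mono fun s hs => ?_)
    rw [smul_zero, sub_zero, one_mul]
    exact hs.trans (le_abs_self _)
  · have h1 : (fun s => ‖e s‖ + C₁ * (‖s - t‖ ^ 2 + ‖e s‖)) =o[𝓝[S] t] fun s => s - t :=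
      heo.norm_left.add ((hsq.add heo.norm_left).const_mul_left C₁)
    exact (h1.const_mul_left C).congr_left fun s => mul_comm _ _

theorem β_eq_of_curve (hU : PoissonTensorOn Q U) {γ : ℝ → E} {a b : ℝ} (hab : a ≤ b)
    (hd : ∀ t ∈ Icc a b, γ t ∈ L.dom)
    (hr : ∀ t ∈ Icc a b, Module.finrank ℝ (LinearMap.range (Q (γ t)).toLinearMap)
      = Module.finrank ℝ A)
    (hγ : ∀ t ∈ Icc a b, ∃ v ∈ LinearMap.range (Q (γ t)).toLinearMap,
      HasDerivWithinAt γ v (Icc a b) t) : L.β (γ b) = L.β (γ a) := by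
  have h1 : ∀ t ∈ Icc a b, HasDerivWithinAt (fun s => L.β (γ s)) 0 (Icc a b) t := by
    intro t ht
    obtain ⟨v, hv, hγ'⟩ := hγ t ht
    exact L.hasDerivWithinAt_β hU hγ' (hd t ht)
      (F.eq_Y_of_mem_range (L.dom_subset_U (hd t ht)) (hr t ht) hv) (hr t ht)
  exact constant_of_has_deriv_right_zero (fun s hs => (h1 s hs).continuousWithinAt)
    (fun s hs => (h1 s (Ico_subset_Icc_self hs)).mono_of_mem_nhdsWithin
      (mem_of_superset (Icc_mem_nhdsGE hs.2) (Icc_subset_Icc hs.1 le_rfl))) b (right_mem_Icc.2 hab)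

/-- The curves `Γ z w` are integral curves of a Hamiltonian vector field. -/
theorem exists_hamiltonian (hU : PoissonTensorOn Q U) {z : E} (hz : z ∈ closedBall z₀ L.r) {w : A}
    (hw : ‖w‖ ≤ L.ρ) : ∃ f : E → ℝ, ContDiff ℝ ∞ f ∧
      ∀ t ∈ Icc (0 : ℝ) 1, HasFDerivAt f (F.θ (L.Γ z w t) w) (L.Γ z w t) := by
  rcases eq_or_ne w 0 with rfl | hw0
  · exact ⟨fun _ => 0, contDiff_const, fun t _ => by
      rw [map_zero]
      exact hasFDerivAt_const _ _⟩
  obtain ⟨τ', -, hτ'⟩ := exists_dual_vector ℝ w (norm_ne_zero_iff.2 hw0)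
  set τ : A →L[ℝ] ℝ := ‖w‖⁻¹ • τ' with hτ
  have hτw : τ w = 1 := by
    simp only [hτ, smul_apply, hτ', smul_eq_mul]
    exact inv_mul_cancel₀ (norm_ne_zero_iff.2 hw0)
  have hΓ : ContDiffOn ℝ ∞ (L.Γ z w) (Icc (-1) 2) := by
    have hY : ContDiffOn ℝ ∞ (fun y => F.Y y w) U :=
      (F.contDiffOn_Y hU.contDiffOn).clm_apply contDiffOn_const
    exact ODE.contDiffOn_enat_Icc_of_hasDerivWithinAt (n := ⊤) (f := fun _ y => F.Y y w) (u := U)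
      (hY.comp contDiffOn_snd fun x hx => hx.2) (fun t ht => L.hasDeriv z hz w hw t ht)
      fun t ht => L.mem_U (L.Γ_mem z hz w hw t ht)
  -- `χ` is 1 on `[-1/4, 5/4]` and supported in `[-3/4, 7/4]`, inside the interval where the line
  -- exists, so `c` is smooth on all of `ℝ`.
  let χ : ContDiffBump (1 / 2 : ℝ) := ⟨3 / 4, 5 / 4, by norm_num, by norm_num⟩
  set c : ℝ → A →L[ℝ] ℝ := fun t => χ t • F.σ (L.Γ z w t) w with hc
  have hcs : ContDiff ℝ ∞ c := by
    rw [contDiff_iff_contDiffAt]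
    intro t
    by_cases ht : t ∈ Ioo (-1 : ℝ) 2
    · have h1 : ContDiffOn ℝ ∞ (fun t => F.σ (L.Γ z w t) w) (Icc (-1) 2) :=
        (F.contDiffOn.comp hΓ fun t ht => L.mem_U (L.Γ_mem z hz w hw t ht)).clm_apply
          contDiffOn_const
      exact χ.contDiffAt.smul (h1.contDiffAt (Icc_mem_nhds ht.1 ht.2))
    · have h2 : c =ᶠ[𝓝 t] fun _ => 0 := by
        have h3 : t ∈ (tsupport χ)ᶜ := by
          rw [χ.tsupport_eq]
          intro h4
          rw [mem_closedBall, Real.dist_eq, abs_le] at h4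
          have h5 : (χ.rOut : ℝ) = 5 / 4 := rfl
          rw [h5] at h4
          exact ht ⟨by linarith [h4.1], by linarith [h4.2]⟩
        filter_upwards [(isClosed_tsupport χ).isOpen_compl.mem_nhds h3] with s hs
        have : χ s = 0 := image_eq_zero_of_notMem_tsupport hs
        simp [hc, this]
      exact contDiffAt_const.congr_of_eventuallyEq h2
  have hc1 : ∀ t ∈ Icc (0 : ℝ) 1, c t = F.σ (L.Γ z w t) w := by
    intro t ht
    have h1 : χ t = 1 := χ.one_of_mem_closedBall (by
      rw [mem_closedBall, Real.dist_eq, abs_le]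
      have h5 : (χ.rIn : ℝ) = 3 / 4 := rfl
      rw [h5]
      constructor <;> linarith [ht.1, ht.2])
    simp [hc, h1]
  -- The function is `f y = c(τ (G y)) (H y)`, where `τ ∘ G` recovers the time along the line and
  -- `H` is the part of `G` transverse to it. On the line `H = 0`, so only the derivative of `H`
  -- contributes: `df = σ w ∘ p - (τ ∘ p) σ w w`, and the last term is zero.
  set G : E → A := fun y => F.p y - F.p z with hG
  set H : E → A := fun y => G y - τ (G y) • w with hH
  have hGs : ContDiff ℝ ∞ G := F.p.contDiff.sub contDiff_const
  have hHs : ContDiff ℝ ∞ H := hGs.sub ((τ.contDiff.comp hGs).smul contDiff_const)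
  refine ⟨fun y => c (τ (G y)) (H y), (hcs.comp (τ.contDiff.comp hGs)).clm_apply hHs,
    fun t ht => ?_⟩
  have hGt : G (L.Γ z w t) = t • w := by
    simp only [hG, L.p_Γ hz hw ht]
    abel
  have hτt : τ (G (L.Γ z w t)) = t := by
    rw [hGt, map_smul, hτw, smul_eq_mul, mul_one]
  have hHt : H (L.Γ z w t) = 0 := by
    simp only [hH, hτt]
    rw [hGt, sub_self]
  have hGd : HasFDerivAt G F.p (L.Γ z w t) := F.p.hasFDerivAt.sub_const _
  have hHd : HasFDerivAt H (F.p - (τ.comp F.p).smulRight w) (L.Γ z w t) :=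
    hGd.sub ((τ.hasFDerivAt.comp _ hGd).smul_const w)
  have hcd := ((hcs.comp (τ.contDiff.comp hGs)).differentiable (by simp)
    (L.Γ z w t)).hasFDerivAt
  refine (hcd.clm_apply hHd).congr_fderiv ?_
  have hσ0 := F.σ_self hU (L.mem_U (L.Γ_mem_unit hz hw ht)) w
  ext y
  have h6 : c (τ (G (L.Γ z w t))) = F.σ (L.Γ z w t) w := by rw [hτt, hc1 t ht]
  simp [h6, hHt, hσ0, PoissonFrame.θ_apply]

end LineChart

end PlaqueCoordinate

end

noncomputable section

set_option maxSynthPendingDepth 3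
set_option linter.unusedSectionVars false

/-! ### Bivector fields, velocities and brackets in charts. -/

section ChartTensor

open Filter

/-- The Jacobi identity of the bracket of a Poisson tensor on a vector space. -/
theorem PoissonTensorOn.jacobi_functions {E : Type*} [NormedAddCommGroup E] [NormedSpace ℝ E]
    {Q : E → (E →L[ℝ] ℝ) →L[ℝ] E} {Ω : Set E} (hQ : PoissonTensorOn Q Ω) {z : E} (hz : z ∈ Ω)
    {f g h : E → ℝ} (hf : ContDiffAt ℝ ∞ f z) (hg : ContDiffAt ℝ ∞ g z)
    (hh : ContDiffAt ℝ ∞ h z) :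
    fderiv ℝ (fun y => fderiv ℝ h y (Q y (fderiv ℝ g y))) z (Q z (fderiv ℝ f z))
      + fderiv ℝ (fun y => fderiv ℝ f y (Q y (fderiv ℝ h y))) z (Q z (fderiv ℝ g z))
      + fderiv ℝ (fun y => fderiv ℝ g y (Q y (fderiv ℝ f y))) z (Q z (fderiv ℝ h z)) = 0 := by
  have hd : ∀ {k : E → ℝ}, ContDiffAt ℝ ∞ k z →
      HasFDerivAt (fderiv ℝ k) (fderiv ℝ (fderiv ℝ k) z) z := fun hk =>
    ((hk.fderiv_right (m := 1) (by norm_cast)).differentiableAt (by simp)).hasFDerivAt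
  have hs : ∀ {k : E → ℝ}, ContDiffAt ℝ ∞ k z → ∀ u v : E,
      fderiv ℝ (fderiv ℝ k) z u v = fderiv ℝ (fderiv ℝ k) z v u := fun hk u v =>
    (hk.isSymmSndFDerivAt (by simp only [minSmoothness_of_isRCLikeNormedField]; norm_cast)).eq u v
  have hQd := (hQ.differentiableAt hz).hasFDerivAt
  have key : ∀ {k l : E → ℝ}, ContDiffAt ℝ ∞ k z → ContDiffAt ℝ ∞ l z → ∀ v : E,
      fderiv ℝ (fun y => fderiv ℝ l y (Q y (fderiv ℝ k y))) z v =
        fderiv ℝ (fderiv ℝ l) z v (Q z (fderiv ℝ k z))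
          + fderiv ℝ l z (fderiv ℝ Q z v (fderiv ℝ k z))
          - fderiv ℝ (fderiv ℝ k) z v (Q z (fderiv ℝ l z)) := by
    intro k l hk hl v
    have h1 := (hd hl).clm_apply (hQd.clm_apply (hd hk))
    rw [h1.fderiv]
    have h2 := hQ.skew z hz (fderiv ℝ (fderiv ℝ k) z v) (fderiv ℝ l z)
    simp only [add_apply, ContinuousLinearMap.comp_apply, ContinuousLinearMap.flip_apply, map_add]
    rw [h2]
    ring
  -- Each of the three terms contributes two Hessian terms; by symmetry of second derivatives these
  -- cancel in pairs, and the Jacobi identity for the covectors `df`, `dg`, `dh` remains.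
  rw [key hg hh, key hh hf, key hf hg]
  have hj := hQ.jacobi z hz (fderiv ℝ f z) (fderiv ℝ g z) (fderiv ℝ h z)
  rw [hs hh (Q z (fderiv ℝ f z)), hs hf (Q z (fderiv ℝ g z)), hs hg (Q z (fderiv ℝ h z))]
  linear_combination hj

variable {E : Type*} [NormedAddCommGroup E] [NormedSpace ℝ E]
  {H : Type*} [TopologicalSpace H] {I : ModelWithCorners ℝ E H}
  {N : Type*} [TopologicalSpace N] [ChartedSpace H N]

theorem comp_smulRight_one {V W : Type*} [TopologicalSpace V] [AddCommGroup V] [Module ℝ V]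
    [ContinuousSMul ℝ V] [TopologicalSpace W] [AddCommGroup W] [Module ℝ W]
    [ContinuousSMul ℝ W] {A : V →L[ℝ] W} {v : V} {w : W} (h : A v = w) :
    A.comp ((1 : ℝ →L[ℝ] ℝ).smulRight v) = (1 : ℝ →L[ℝ] ℝ).smulRight w := by
  ext
  simp [h]

/-- A curve has velocity `v` at `t` within `s`. -/
def HasVelocityWithinAt (I : ModelWithCorners ℝ E H) (γ : ℝ → N) (s : Set ℝ) (t : ℝ)
    (v : TangentSpace I (γ t)) : Prop :=
  HasMFDerivAt[s] γ t ((1 : ℝ →L[ℝ] ℝ).smulRight v)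

/-- The differential of a chart. -/
def chartDeriv (I : ModelWithCorners ℝ E H) (x₀ x : N) : TangentSpace I x →L[ℝ] E :=
  mvfderiv I (extChartAt I x₀) x

variable {x₀ x : N}

theorem mvfderiv_congr {f g : N → ℝ} (h : f =ᶠ[𝓝 x] g) : mvfderiv I f x = mvfderiv I g x := by
  have h1 := h.mfderiv_eq (I := I) (I' := 𝓘(ℝ, ℝ))
  ext v
  exact DFunLike.congr_fun h1 v

theorem eventuallyEq_comp_extChartAt (hx : x ∈ (extChartAt I x₀).source) {α : Type*}
    (f : N → α) : f =ᶠ[𝓝 x] (f ∘ (extChartAt I x₀).symm) ∘ extChartAt I x₀ := by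
  filter_upwards [(isOpen_extChartAt_source (I := I) x₀).mem_nhds hx] with y hy
  exact congrArg f ((extChartAt I x₀).left_inv hy).symm

section

variable [IsManifold I ∞ N]

theorem chartDeriv_bijective (hx : x ∈ (extChartAt I x₀).source) :
    Function.Bijective (chartDeriv I x₀ x) := by
  have h := (isInvertible_mfderiv_extChartAt (I := I) hx).bijective
  exact h

theorem mvfderiv_comp_extChartAt (hx : x ∈ (extChartAt I x₀).source) {f : E → ℝ}
    (hf : DifferentiableAt ℝ f (extChartAt I x₀ x)) :
    mvfderiv I (f ∘ extChartAt I x₀) x =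
      (fderiv ℝ f (extChartAt I x₀ x)).comp (chartDeriv I x₀ x) := by
  have hx' : x ∈ (chartAt H x₀).source := by rwa [← extChartAt_source I]
  have h1 := mvfderiv_comp (I := 𝓘(ℝ, E)) (I' := I) (g := f) x hf.mdifferentiableAt
    (mdifferentiableAt_extChartAt hx')
  rw [h1]
  ext v
  have h2 : mfderiv 𝓘(ℝ, E) 𝓘(ℝ, ℝ) f (extChartAt I x₀ x) = fderiv ℝ f (extChartAt I x₀ x) :=
    mfderiv_eq_fderiv
  exact DFunLike.congr_fun h2 _

variable [I.Boundaryless]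

theorem contDiffAt_comp_extChartAt_symm (hx : x ∈ (extChartAt I x₀).source) {f : N → ℝ}
    (hf : ContMDiffAt I 𝓘(ℝ, ℝ) ∞ f x) :
    ContDiffAt ℝ ∞ (f ∘ (extChartAt I x₀).symm) (extChartAt I x₀ x) := by
  rw [← contMDiffAt_iff_contDiffAt]
  have h1 : ContMDiffAt 𝓘(ℝ, E) I ∞ (extChartAt I x₀).symm (extChartAt I x₀ x) :=
    (contMDiffOn_extChartAt_symm x₀).contMDiffAt
      ((isOpen_extChartAt_target x₀).mem_nhds ((extChartAt I x₀).map_source hx))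
  refine ContMDiffAt.comp _ ?_ h1
  rwa [(extChartAt I x₀).left_inv hx]

theorem mvfderiv_eq_fderiv_comp_chartDeriv (hx : x ∈ (extChartAt I x₀).source) {f : N → ℝ}
    (hf : ContMDiffAt I 𝓘(ℝ, ℝ) ∞ f x) :
    mvfderiv I f x = (fderiv ℝ (f ∘ (extChartAt I x₀).symm) (extChartAt I x₀ x)).comp
      (chartDeriv I x₀ x) := by
  rw [mvfderiv_congr (eventuallyEq_comp_extChartAt hx f)]
  exact mvfderiv_comp_extChartAt hx
    ((contDiffAt_comp_extChartAt_symm hx hf).differentiableAt (by simp))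

/-- Velocities are computed in charts. -/
theorem hasVelocityWithinAt_iff {γ : ℝ → N} {s : Set ℝ} {t : ℝ} {v : TangentSpace I (γ t)}
    (hx : γ t ∈ (extChartAt I x₀).source) :
    HasVelocityWithinAt I γ s t v ↔ ContinuousWithinAt γ s t ∧
      HasDerivWithinAt (extChartAt I x₀ ∘ γ) (chartDeriv I x₀ (γ t) v) s t := by
  have hx' : γ t ∈ (chartAt H x₀).source := by rwa [← extChartAt_source I]
  have hφ := (mdifferentiableAt_extChartAt (I := I) hx').hasMFDerivAt
  constructor
  · intro h
    refine ⟨h.continuousWithinAt, ?_⟩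
    have h1 := hφ.comp_hasMFDerivWithinAt t h
    have h2 : HasFDerivWithinAt (extChartAt I x₀ ∘ γ)
        ((1 : ℝ →L[ℝ] ℝ).smulRight (chartDeriv I x₀ (γ t) v)) s t := by
      refine hasMFDerivWithinAt_iff_hasFDerivWithinAt.1 ?_
      have e : (chartDeriv I x₀ (γ t)).comp ((1 : ℝ →L[ℝ] ℝ).smulRight v) =
          (1 : ℝ →L[ℝ] ℝ).smulRight (chartDeriv I x₀ (γ t) v) := comp_smulRight_one rfl
      exact e ▸ h1
    exact h2.congr_fderiv (ContinuousLinearMap.ext fun r => by simp)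
  · rintro ⟨hc, hd⟩
    have h1 : HasMFDerivAt[s] (extChartAt I x₀ ∘ γ) t
        (ContinuousLinearMap.smulRight (1 : ℝ →L[ℝ] ℝ) (chartDeriv I x₀ (γ t) v)) := by
      apply HasFDerivWithinAt.hasMFDerivWithinAt
      refine hd.hasFDerivWithinAt.congr_fderiv (ContinuousLinearMap.ext fun r => ?_)
      simp
    have ht := (extChartAt I x₀).map_source hx
    have h2 : HasMFDerivAt% (extChartAt I x₀).symm ((extChartAt I x₀ ∘ γ) t)
        (mfderiv[range I] (extChartAt I x₀).symm (extChartAt I x₀ (γ t))) := by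
      have := (mdifferentiableWithinAt_extChartAt_symm ht).hasMFDerivWithinAt
      rw [I.range_eq_univ] at this
      rw [I.range_eq_univ]
      exact hasMFDerivWithinAt_univ.1 this
    have h3 := h2.comp_hasMFDerivWithinAt t h1
    have hev : γ =ᶠ[𝓝[s] t] (extChartAt I x₀).symm ∘ extChartAt I x₀ ∘ γ := by
      filter_upwards [hc ((isOpen_extChartAt_source (I := I) x₀).mem_nhds hx)] with r hr
      exact ((extChartAt I x₀).left_inv hr).symm
    have h4 := h3.congr_of_eventuallyEq hev ((extChartAt I x₀).left_inv hx).symm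
    have h5 := mfderivWithin_extChartAt_symm_comp_mfderiv_extChartAt' (I := I) hx
    unfold HasVelocityWithinAt
    have h7 : (1 : ℝ →L[ℝ] ℝ).smulRight v =
        (mfderiv[range I] (extChartAt I x₀).symm (extChartAt I x₀ (γ t))).comp
          ((1 : ℝ →L[ℝ] ℝ).smulRight (chartDeriv I x₀ (γ t) v)) := by
      have h8 : ∀ (A : E →L[ℝ] E) (u w : E), A u = w →
          A.comp ((1 : ℝ →L[ℝ] ℝ).smulRight u) = (1 : ℝ →L[ℝ] ℝ).smulRight w :=
        fun A u w => comp_smulRight_one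
      exact (h8 (mfderiv[range I] (extChartAt I x₀).symm (extChartAt I x₀ (γ t)))
        (chartDeriv I x₀ (γ t) v) v (DFunLike.congr_fun h5 v)).symm
    rw [h7]
    exact h4

end

/-- A smooth function on a neighbourhood of a point extends, as a germ, to the manifold. -/
theorem exists_contMDiff_germ [IsManifold I ∞ N] [FiniteDimensional ℝ E] [T2Space N]
    {f : N → ℝ} {x : N} {U : Set N} (hU : U ∈ 𝓝 x)
    (hf : ContMDiffOn I 𝓘(ℝ, ℝ) ∞ f U) :
    ∃ g : N → ℝ, ContMDiff I 𝓘(ℝ, ℝ) ∞ g ∧ g =ᶠ[𝓝 x] f := by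
  obtain ⟨V, hVU, hV, hxV⟩ := mem_nhds_iff.1 hU
  obtain ⟨χ, -, hχ⟩ := (SmoothBumpFunction.nhds_basis_tsupport (I := I) x).mem_iff.1
    (hV.mem_nhds hxV)
  refine ⟨fun y => χ y • f y, contMDiff_of_tsupport fun y hy => ?_, ?_⟩
  · have hy' : y ∈ V := hχ (tsupport_smul_subset_left _ _ hy)
    exact χ.contMDiffAt.smul ((hf.mono hVU).contMDiffAt (hV.mem_nhds hy'))
  · filter_upwards [χ.eventuallyEq_one] with y hy
    simp [hy]

namespace BivectorField

/-- The coordinate expression of a bivector field in the chart at `x₀`. -/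
def tensor [FiniteDimensional ℝ E] (π : BivectorField I N) (x₀ : N) (z : E) :
    (E →L[ℝ] ℝ) →L[ℝ] E :=
  LinearMap.toContinuousLinearMap
    { toFun := fun α => chartDeriv I x₀ ((extChartAt I x₀).symm z)
        (π.sharp _ (α.comp (chartDeriv I x₀ ((extChartAt I x₀).symm z))))
      map_add' := fun α β => by
        rw [ContinuousLinearMap.add_comp, map_add, map_add]
      map_smul' := fun c α => by
        rw [ContinuousLinearMap.smul_comp, map_smul, map_smul]; rfl }

variable [FiniteDimensional ℝ E] {π : BivectorField I N}

theorem tensor_extChartAt (hx : x ∈ (extChartAt I x₀).source) (α : E →L[ℝ] ℝ) :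
    π.tensor x₀ (extChartAt I x₀ x) α =
      chartDeriv I x₀ x (π.sharp x (α.comp (chartDeriv I x₀ x))) := by
  change chartDeriv I x₀ ((extChartAt I x₀).symm (extChartAt I x₀ x)) _ = _
  rw [(extChartAt I x₀).left_inv hx]

variable [IsManifold I ∞ N]

theorem range_tensor (hx : x ∈ (extChartAt I x₀).source) :
    LinearMap.range (π.tensor x₀ (extChartAt I x₀ x)).toLinearMap =
      (LinearMap.range (π.sharp x)).map (chartDeriv I x₀ x).toLinearMap := by
  have hD := chartDeriv_bijective (I := I) hx
  ext v
  constructor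
  · rintro ⟨α, rfl⟩
    exact ⟨_, ⟨_, rfl⟩, (tensor_extChartAt hx α).symm⟩
  · rintro ⟨_, ⟨ξ, rfl⟩, rfl⟩
    let e : TangentSpace I x ≃ₗ[ℝ] E := LinearEquiv.ofBijective (chartDeriv I x₀ x).toLinearMap hD
    have : FiniteDimensional ℝ (TangentSpace I x) := inferInstanceAs (FiniteDimensional ℝ E)
    refine ⟨ξ.comp (LinearMap.toContinuousLinearMap e.symm.toLinearMap), ?_⟩
    refine (tensor_extChartAt hx _).trans ?_
    refine congrArg (fun β => chartDeriv I x₀ x (π.sharp x β)) (ContinuousLinearMap.ext fun u => ?_)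
    change ξ (e.symm (e u)) = ξ u
    rw [e.symm_apply_apply]

theorem mem_range_sharp_iff (hx : x ∈ (extChartAt I x₀).source) {v : TangentSpace I x} :
    chartDeriv I x₀ x v ∈ LinearMap.range (π.tensor x₀ (extChartAt I x₀ x)).toLinearMap ↔
      v ∈ LinearMap.range (π.sharp x) := by
  rw [range_tensor hx]
  constructor
  · rintro ⟨w, hw, h⟩
    rwa [← (chartDeriv_bijective (I := I) hx).1 h]
  · exact fun h => ⟨v, h, rfl⟩

theorem finrank_range_tensor (hx : x ∈ (extChartAt I x₀).source) :
    Module.finrank ℝ (LinearMap.range (π.tensor x₀ (extChartAt I x₀ x)).toLinearMap) =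
      Module.finrank ℝ (LinearMap.range (π.sharp x)) := by
  rw [range_tensor hx]
  exact (Submodule.equivMapOfInjective _ (chartDeriv_bijective (I := I) hx).1 _).finrank_eq.symm

variable [I.Boundaryless]

theorem chartDeriv_hamiltonian (hx : x ∈ (extChartAt I x₀).source) {f : N → ℝ}
    (hf : ContMDiffAt I 𝓘(ℝ, ℝ) ∞ f x) :
    chartDeriv I x₀ x (π.hamiltonian f x) = π.tensor x₀ (extChartAt I x₀ x)
      (fderiv ℝ (f ∘ (extChartAt I x₀).symm) (extChartAt I x₀ x)) := by
  rw [tensor_extChartAt hx, hamiltonian, mvfderiv_eq_fderiv_comp_chartDeriv hx hf]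

theorem bracket_eq (hx : x ∈ (extChartAt I x₀).source) {f g : N → ℝ}
    (hf : ContMDiffAt I 𝓘(ℝ, ℝ) ∞ f x) (hg : ContMDiffAt I 𝓘(ℝ, ℝ) ∞ g x) :
    π.bracket f g x = fderiv ℝ (g ∘ (extChartAt I x₀).symm) (extChartAt I x₀ x)
      (π.tensor x₀ (extChartAt I x₀ x)
        (fderiv ℝ (f ∘ (extChartAt I x₀).symm) (extChartAt I x₀ x))) := by
  rw [← chartDeriv_hamiltonian hx hf, bracket, mvfderiv_eq_fderiv_comp_chartDeriv hx hg]
  rfl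

end BivectorField
end ChartTensor
end

noncomputable section

set_option maxSynthPendingDepth 3
set_option linter.unusedSectionVars false

/-! ### Products of Poisson tensors. -/

section ProductTensor

variable {E : Type*} [NormedAddCommGroup E] [NormedSpace ℝ E]
  {E' : Type*} [NormedAddCommGroup E'] [NormedSpace ℝ E']

theorem contDiffOn_of_dual {F : Type*} [NormedAddCommGroup F] [NormedSpace ℝ F]
    [FiniteDimensional ℝ F] {f : E → F} {s : Set E}
    (h : ∀ β : F →L[ℝ] ℝ, ContDiffOn ℝ ∞ (fun z => β (f z)) s) : ContDiffOn ℝ ∞ f s := by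
  let e := (Module.finBasis ℝ F).equivFunL
  refine (e.comp_contDiffOn_iff (f := f)).1 ?_
  rw [contDiffOn_pi]
  exact fun i => h ((ContinuousLinearMap.proj (R := ℝ) (φ := fun _ => ℝ) i).comp
    e.toContinuousLinearMap)

theorem PoissonTensorOn.congr {Q Q' : E → (E →L[ℝ] ℝ) →L[ℝ] E} {Ω : Set E}
    (h : PoissonTensorOn Q Ω) (he : ∀ z ∈ Ω, Q' z = Q z) : PoissonTensorOn Q' Ω where
  isOpen := h.isOpen
  contDiffOn := h.contDiffOn.congr he
  skew z hz α β := by rw [he z hz]; exact h.skew z hz α β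
  jacobi z hz α β γ := by
    have h1 : Q' =ᶠ[𝓝 z] Q := Filter.mem_of_superset (h.isOpen.mem_nhds hz) he
    rw [he z hz, h1.fderiv_eq]
    exact h.jacobi z hz α β γ

/-- The pushforward of a tensor along a linear map. -/
def tensorPush (ι : E →L[ℝ] E') : ((E →L[ℝ] ℝ) →L[ℝ] E) →L[ℝ] ((E' →L[ℝ] ℝ) →L[ℝ] E') :=
  ((ContinuousLinearMap.compL ℝ (E' →L[ℝ] ℝ) E E') ι).comp
    ((ContinuousLinearMap.compL ℝ (E' →L[ℝ] ℝ) (E →L[ℝ] ℝ) E).flip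
      ((ContinuousLinearMap.compL ℝ E E' ℝ).flip ι))

@[simp]
theorem tensorPush_apply (ι : E →L[ℝ] E') (T : (E →L[ℝ] ℝ) →L[ℝ] E) (α : E' →L[ℝ] ℝ) :
    tensorPush ι T α = ι (T (α.comp ι)) := rfl

/-- The product of two tensors. -/
def prodTensor (Q : E → (E →L[ℝ] ℝ) →L[ℝ] E) (Q' : E' → (E' →L[ℝ] ℝ) →L[ℝ] E') (z : E × E') :
    (E × E' →L[ℝ] ℝ) →L[ℝ] E × E' :=
  tensorPush (ContinuousLinearMap.inl ℝ E E') (Q z.1)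
    + tensorPush (ContinuousLinearMap.inr ℝ E E') (Q' z.2)

theorem HasFDerivAt.tensorPush {B : Type*} [NormedAddCommGroup B] [NormedSpace ℝ B]
    {ι : E →L[ℝ] E'} {c : B → (E →L[ℝ] ℝ) →L[ℝ] E} {c' : B →L[ℝ] (E →L[ℝ] ℝ) →L[ℝ] E} {z : B}
    (h : HasFDerivAt c c' z) :
    HasFDerivAt (fun y => tensorPush ι (c y)) ((_root_.tensorPush ι).comp c') z :=
  (_root_.tensorPush ι).hasFDerivAt.comp z h

/-- The tensor is block diagonal and each block depends on its own variable only, so the Jacobi sum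
splits into those of the factors. -/
theorem PoissonTensorOn.prod {Q : E → (E →L[ℝ] ℝ) →L[ℝ] E} {Q' : E' → (E' →L[ℝ] ℝ) →L[ℝ] E'}
    {Ω : Set E} {Ω' : Set E'} (h : PoissonTensorOn Q Ω) (h' : PoissonTensorOn Q' Ω') :
    PoissonTensorOn (prodTensor Q Q') (Ω ×ˢ Ω') where
  isOpen := h.isOpen.prod h'.isOpen
  contDiffOn := by
    have h1 : ContDiffOn ℝ ∞ (fun z : E × E' => Q z.1) (Ω ×ˢ Ω') :=
      h.contDiffOn.comp contDiff_fst.contDiffOn fun z hz => hz.1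
    have h2 : ContDiffOn ℝ ∞ (fun z : E × E' => Q' z.2) (Ω ×ˢ Ω') :=
      h'.contDiffOn.comp contDiff_snd.contDiffOn fun z hz => hz.2
    exact ((tensorPush (ContinuousLinearMap.inl ℝ E E')).contDiff.comp_contDiffOn h1).add
      ((tensorPush (ContinuousLinearMap.inr ℝ E E')).contDiff.comp_contDiffOn h2)
  skew z hz α β := by
    have h1 := h.skew z.1 hz.1 (α.comp (ContinuousLinearMap.inl ℝ E E'))
      (β.comp (ContinuousLinearMap.inl ℝ E E'))
    have h2 := h'.skew z.2 hz.2 (α.comp (ContinuousLinearMap.inr ℝ E E'))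
      (β.comp (ContinuousLinearMap.inr ℝ E E'))
    simp only [ContinuousLinearMap.comp_apply] at h1 h2
    simp only [prodTensor, add_apply, tensorPush_apply, map_add]
    rw [h1, h2]
    ring
  jacobi z hz α β γ := by
    have hd : HasFDerivAt (prodTensor Q Q')
        ((tensorPush (ContinuousLinearMap.inl ℝ E E')).comp
            ((fderiv ℝ Q z.1).comp (ContinuousLinearMap.fst ℝ E E'))
          + (tensorPush (ContinuousLinearMap.inr ℝ E E')).comp
            ((fderiv ℝ Q' z.2).comp (ContinuousLinearMap.snd ℝ E E'))) z := by
      have h1 : HasFDerivAt (fun y : E × E' => Q y.1) _ z :=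
        (h.differentiableAt hz.1).hasFDerivAt.comp z hasFDerivAt_fst
      have h2 : HasFDerivAt (fun y : E × E' => Q' y.2) _ z :=
        (h'.differentiableAt hz.2).hasFDerivAt.comp z hasFDerivAt_snd
      exact h1.tensorPush.add h2.tensorPush
    have j1 := h.jacobi z.1 hz.1 (α.comp (ContinuousLinearMap.inl ℝ E E'))
      (β.comp (ContinuousLinearMap.inl ℝ E E')) (γ.comp (ContinuousLinearMap.inl ℝ E E'))
    have j2 := h'.jacobi z.2 hz.2 (α.comp (ContinuousLinearMap.inr ℝ E E'))
      (β.comp (ContinuousLinearMap.inr ℝ E E')) (γ.comp (ContinuousLinearMap.inr ℝ E E'))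
    have h1 : ∀ δ : E × E' →L[ℝ] ℝ, (prodTensor Q Q' z δ).1 =
        Q z.1 (δ.comp (ContinuousLinearMap.inl ℝ E E')) := fun δ => by simp [prodTensor]
    have h2 : ∀ δ : E × E' →L[ℝ] ℝ, (prodTensor Q Q' z δ).2 =
        Q' z.2 (δ.comp (ContinuousLinearMap.inr ℝ E E')) := fun δ => by simp [prodTensor]
    rw [hd.fderiv]
    simp only [add_apply, ContinuousLinearMap.comp_apply, tensorPush_apply, map_add,
      ContinuousLinearMap.coe_fst', ContinuousLinearMap.coe_snd', h1, h2]
    simp only [ContinuousLinearMap.comp_apply] at j1 j2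
    linear_combination j1 + j2

end ProductTensor

/-! ### Equivalence of the global and the chartwise notions of Poisson structure. -/

section IsPoisson

open Filter

variable {E : Type*} [NormedAddCommGroup E] [NormedSpace ℝ E] [FiniteDimensional ℝ E]
  {H : Type*} [TopologicalSpace H] {I : ModelWithCorners ℝ E H} [I.Boundaryless]
  {N : Type*} [TopologicalSpace N] [ChartedSpace H N] [IsManifold I ∞ N]

namespace BivectorField

variable {π : BivectorField I N}

theorem tensor_skew (x₀ : N) (z : E) (α β : E →L[ℝ] ℝ) :
    β (π.tensor x₀ z α) = -α (π.tensor x₀ z β) :=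
  π.skew _ (α.comp (chartDeriv I x₀ _)) (β.comp (chartDeriv I x₀ _))

theorem bracket_congr {f g f' g' : N → ℝ} {x : N} (hf : f =ᶠ[𝓝 x] f') (hg : g =ᶠ[𝓝 x] g') :
    π.bracket f g x = π.bracket f' g' x := by
  rw [bracket, bracket, hamiltonian, hamiltonian, mvfderiv_congr hf, mvfderiv_congr hg]

theorem bracket_comp_extChartAt {x₀ x : N} (hx : x ∈ (extChartAt I x₀).source) (α : E →L[ℝ] ℝ)
    {g : E → ℝ} (hg : DifferentiableAt ℝ g (extChartAt I x₀ x)) :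
    π.bracket (α ∘ extChartAt I x₀) (g ∘ extChartAt I x₀) x =
      fderiv ℝ g (extChartAt I x₀ x) (π.tensor x₀ (extChartAt I x₀ x) α) := by
  rw [bracket, hamiltonian, mvfderiv_comp_extChartAt hx hg,
    mvfderiv_comp_extChartAt hx α.differentiableAt, tensor_extChartAt hx]
  simp

/-- A Poisson structure is given by Poisson tensors in charts. -/
theorem IsPoisson.poissonTensorOn [T2Space N] (hπ : π.IsPoisson) (x₀ : N) :
    PoissonTensorOn (π.tensor x₀) (extChartAt I x₀).target := by
  have ho := isOpen_extChartAt_target (I := I) x₀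
  -- Smoothness and Jacobi are assumed for globally defined functions, so linear functions of the
  -- coordinates are first extended as germs.
  have hf : ∀ z ∈ (extChartAt I x₀).target, ∀ α : E →L[ℝ] ℝ, ∃ f : N → ℝ,
      ContMDiff I 𝓘(ℝ, ℝ) ∞ f ∧ f =ᶠ[𝓝 ((extChartAt I x₀).symm z)] α ∘ extChartAt I x₀ := by
    intro z hz α
    have hs := (extChartAt I x₀).map_target hz
    refine exists_contMDiff_germ ((isOpen_extChartAt_source (I := I) x₀).mem_nhds hs) ?_
    have h1 := contMDiffOn_extChartAt (I := I) (n := ∞) (x := x₀)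
    rw [← extChartAt_source I] at h1
    exact α.contDiff.contMDiff.comp_contMDiffOn h1
  have hbr : ∀ z ∈ (extChartAt I x₀).target, ∀ (α β : E →L[ℝ] ℝ) (f g : N → ℝ),
      f =ᶠ[𝓝 ((extChartAt I x₀).symm z)] α ∘ extChartAt I x₀ →
      g =ᶠ[𝓝 ((extChartAt I x₀).symm z)] β ∘ extChartAt I x₀ →
      π.bracket f g =ᶠ[𝓝 ((extChartAt I x₀).symm z)]
        (fun y => β (π.tensor x₀ y α)) ∘ extChartAt I x₀ := by
    intro z hz α β f g h1 h2
    have hs := (extChartAt I x₀).map_target hz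
    filter_upwards [h1.eventuallyEq_nhds, h2.eventuallyEq_nhds,
      (isOpen_extChartAt_source (I := I) x₀).mem_nhds hs] with y hy1 hy2 hy3
    rw [bracket_congr hy1 hy2, bracket_comp_extChartAt hy3 α β.differentiableAt]
    simp
  have hsm : ContDiffOn ℝ ∞ (π.tensor x₀) (extChartAt I x₀).target := by
    rw [contDiffOn_clm_apply]
    intro α
    refine contDiffOn_of_dual fun β z hz => ContDiffAt.contDiffWithinAt ?_
    obtain ⟨f, hf1, hf2⟩ := hf z hz α
    obtain ⟨g, hg1, hg2⟩ := hf z hz β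
    have hs := (extChartAt I x₀).map_target hz
    have h1 := contDiffAt_comp_extChartAt_symm (I := I) hs
      ((hπ.smooth f g hf1 hg1).contMDiffAt (x := (extChartAt I x₀).symm z))
    rw [(extChartAt I x₀).right_inv hz] at h1
    refine h1.congr_of_eventuallyEq ?_
    have h2 : Tendsto (extChartAt I x₀).symm (𝓝 z) (𝓝 ((extChartAt I x₀).symm z)) :=
      (continuousOn_extChartAt_symm x₀).continuousAt (ho.mem_nhds hz)
    filter_upwards [h2 (hbr z hz α β f g hf2 hg2), ho.mem_nhds hz] with y hy hy'
    rw [Function.comp_apply, hy, Function.comp_apply, (extChartAt I x₀).right_inv hy']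
  refine ⟨ho, hsm, fun z _ => tensor_skew x₀ z, fun z hz α β γ => ?_⟩
  have hs := (extChartAt I x₀).map_target hz
  have hd : DifferentiableAt ℝ (π.tensor x₀) z :=
    (hsm.contDiffAt (ho.mem_nhds hz)).differentiableAt (by simp)
  obtain ⟨f, hf1, hf2⟩ := hf z hz α
  obtain ⟨g, hg1, hg2⟩ := hf z hz β
  obtain ⟨k, hk1, hk2⟩ := hf z hz γ
  have key : ∀ (α β γ : E →L[ℝ] ℝ) (f g k : N → ℝ),
      f =ᶠ[𝓝 ((extChartAt I x₀).symm z)] α ∘ extChartAt I x₀ →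
      g =ᶠ[𝓝 ((extChartAt I x₀).symm z)] β ∘ extChartAt I x₀ →
      k =ᶠ[𝓝 ((extChartAt I x₀).symm z)] γ ∘ extChartAt I x₀ →
      π.bracket f (π.bracket g k) ((extChartAt I x₀).symm z) =
        γ (fderiv ℝ (π.tensor x₀) z (π.tensor x₀ z α) β) := by
    intro α β γ f g k h1 h2 h3
    have h4 := PoissonTensorOn.hasFDerivAt_pairing hd β γ
    rw [bracket_congr h1 (hbr z hz β γ g k h2 h3), bracket_comp_extChartAt hs,
      (extChartAt I x₀).right_inv hz, h4.fderiv]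
    · rfl
    · rw [(extChartAt I x₀).right_inv hz]
      exact h4.differentiableAt
  have h := hπ.jacobi f g k hf1 hg1 hk1 ((extChartAt I x₀).symm z)
  rw [key α β γ f g k hf2 hg2 hk2, key β γ α g k f hg2 hk2 hf2,
    key γ α β k f g hk2 hf2 hg2] at h
  exact h

/-- Smoothness and Jacobi are local, so at each point the tensor in the chart centred there
suffices, on some open set around the point. -/
theorem isPoisson_of_tensor
    (h : ∀ x : N, ∃ Ω : Set E, extChartAt I x x ∈ Ω ∧ PoissonTensorOn (π.tensor x) Ω) :
    π.IsPoisson := by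
  have hbr : ∀ (x : N) {f g : N → ℝ}, ContMDiff I 𝓘(ℝ, ℝ) ∞ f → ContMDiff I 𝓘(ℝ, ℝ) ∞ g →
      π.bracket f g =ᶠ[𝓝 x] (fun z => fderiv ℝ (g ∘ (extChartAt I x).symm) z
        (π.tensor x z (fderiv ℝ (f ∘ (extChartAt I x).symm) z))) ∘ extChartAt I x := by
    intro x f g hf hg
    filter_upwards [extChartAt_source_mem_nhds (I := I) x] with y hy
    exact bracket_eq hy hf.contMDiffAt hg.contMDiffAt
  have hc : ∀ (x : N) {f : N → ℝ}, ContMDiff I 𝓘(ℝ, ℝ) ∞ f →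
      ContDiffAt ℝ ∞ (f ∘ (extChartAt I x).symm) (extChartAt I x x) := fun x f hf =>
    contDiffAt_comp_extChartAt_symm (mem_extChartAt_source x) hf.contMDiffAt
  have hsm : ∀ f g : N → ℝ, ContMDiff I 𝓘(ℝ, ℝ) ∞ f → ContMDiff I 𝓘(ℝ, ℝ) ∞ g →
    ContMDiff I 𝓘(ℝ, ℝ) ∞ (π.bracket f g) := by
    intro f g hf hg x
    obtain ⟨Ω, hx, hΩ⟩ := h x
    refine ContMDiffAt.congr_of_eventuallyEq ?_ (hbr x hf hg)
    have h1 := ((hc x hg).fderiv_right (m := ∞) (by norm_cast)).clm_apply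
      ((hΩ.contDiffAt hx).clm_apply ((hc x hf).fderiv_right (m := ∞) (by norm_cast)))
    exact (h1.contMDiffAt).comp x contMDiffAt_extChartAt
  refine ⟨hsm, fun f g k hf hg hk x => ?_⟩
  obtain ⟨Ω, hx, hΩ⟩ := h x
  have ht : Tendsto (extChartAt I x).symm (𝓝 (extChartAt I x x)) (𝓝 x) := by
    have := continuousAt_extChartAt_symm (I := I) x
    rwa [ContinuousAt, (extChartAt I x).left_inv (mem_extChartAt_source x)] at this
  have key : ∀ {f g k : N → ℝ}, ContMDiff I 𝓘(ℝ, ℝ) ∞ f → ContMDiff I 𝓘(ℝ, ℝ) ∞ g →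
      ContMDiff I 𝓘(ℝ, ℝ) ∞ k → π.bracket f (π.bracket g k) x =
      fderiv ℝ (fun z => fderiv ℝ (k ∘ (extChartAt I x).symm) z
        (π.tensor x z (fderiv ℝ (g ∘ (extChartAt I x).symm) z))) (extChartAt I x x)
        (π.tensor x (extChartAt I x x)
          (fderiv ℝ (f ∘ (extChartAt I x).symm) (extChartAt I x x))) := by
    intro f g k hf hg hk
    rw [bracket_eq (mem_extChartAt_source x) hf.contMDiffAt (hsm g k hg hk).contMDiffAt]
    congr 1
    refine Filter.EventuallyEq.fderiv_eq ?_
    filter_upwards [ht (hbr x hg hk), extChartAt_target_mem_nhds (I := I) x] with z hz hz'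
    rw [Function.comp_apply, hz, Function.comp_apply, (extChartAt I x).right_inv hz']
  rw [key hf hg hk, key hg hk hf, key hk hf hg]
  exact hΩ.jacobi_functions hx (hc x hf) (hc x hg) (hc x hk)

variable {E' : Type*} [NormedAddCommGroup E'] [NormedSpace ℝ E'] [FiniteDimensional ℝ E']
  {H' : Type*} [TopologicalSpace H'] {I' : ModelWithCorners ℝ E' H'} [I'.Boundaryless]
  {N' : Type*} [TopologicalSpace N'] [ChartedSpace H' N'] [IsManifold I' ∞ N']
  {π' : BivectorField I' N'}

theorem chartDeriv_prod {z₀ z : N × N'} (h1 : z.1 ∈ (extChartAt I z₀.1).source)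
    (h2 : z.2 ∈ (extChartAt I' z₀.2).source) (u : TangentSpace I z.1)
    (v : TangentSpace I' z.2) :
    chartDeriv (I.prod I') z₀ z (u, v) = (chartDeriv I z₀.1 z.1 u, chartDeriv I' z₀.2 z.2 v) := by
  have h1' : z.1 ∈ (chartAt H z₀.1).source := by rwa [← extChartAt_source I]
  have h2' : z.2 ∈ (chartAt H' z₀.2).source := by rwa [← extChartAt_source I']
  have h3 := mfderiv_prodMap (p := z)
    (mdifferentiableAt_extChartAt (I := I) h1') (mdifferentiableAt_extChartAt (I := I') h2')
  have h4 : (extChartAt (I.prod I') z₀ : N × N' → E × E') =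
      Prod.map (extChartAt I z₀.1) (extChartAt I' z₀.2) := by
    rw [extChartAt_prod]; rfl
  rw [← modelWithCornersSelf_prod, chartedSpaceSelf_prod] at h3
  unfold chartDeriv mvfderiv
  rw [h4]
  exact DFunLike.congr_fun h3 (u, v)

theorem tensor_prod {z₀ : N × N'} {z : E × E'} (h1 : z.1 ∈ (extChartAt I z₀.1).target)
    (h2 : z.2 ∈ (extChartAt I' z₀.2).target) :
    (π.prod π').tensor z₀ z = prodTensor (π.tensor z₀.1) (π'.tensor z₀.2) z := by
  set x := (extChartAt I z₀.1).symm z.1 with hx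
  set y := (extChartAt I' z₀.2).symm z.2 with hy
  have hxs : x ∈ (extChartAt I z₀.1).source := (extChartAt I z₀.1).map_target h1
  have hys : y ∈ (extChartAt I' z₀.2).source := (extChartAt I' z₀.2).map_target h2
  have hz : z = extChartAt (I.prod I') z₀ (x, y) := by
    rw [extChartAt_prod]
    exact Prod.ext ((extChartAt I z₀.1).right_inv h1).symm
      ((extChartAt I' z₀.2).right_inv h2).symm
  have hs : (x, y) ∈ (extChartAt (I.prod I') z₀).source := by
    rw [extChartAt_prod]
    exact ⟨hxs, hys⟩
  ext α : 1
  have e1 := tensor_extChartAt (π := π) hxs (α.comp (ContinuousLinearMap.inl ℝ E E'))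
  have e2 := tensor_extChartAt (π := π') hys (α.comp (ContinuousLinearMap.inr ℝ E E'))
  rw [(extChartAt I z₀.1).right_inv h1] at e1
  rw [(extChartAt I' z₀.2).right_inv h2] at e2
  have e3 : prodTensor (π.tensor z₀.1) (π'.tensor z₀.2) z α =
      (π.tensor z₀.1 z.1 (α.comp (ContinuousLinearMap.inl ℝ E E')),
        π'.tensor z₀.2 z.2 (α.comp (ContinuousLinearMap.inr ℝ E E'))) := by
    simp [prodTensor]
  rw [e3, e1, e2]
  have e4 := tensor_extChartAt (π := π.prod π') hs α
  rw [← hz] at e4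
  rw [e4]
  refine (chartDeriv_prod hxs hys _ _).trans (Prod.ext ?_ ?_)
  · refine congrArg (fun β => chartDeriv I z₀.1 x (π.sharp x β))
      (ContinuousLinearMap.ext fun u => ?_)
    refine congrArg α ((chartDeriv_prod hxs hys u 0).trans ?_)
    exact Prod.ext rfl (map_zero _)
  · refine congrArg (fun β => chartDeriv I' z₀.2 y (π'.sharp y β))
      (ContinuousLinearMap.ext fun u => ?_)
    refine congrArg α ((chartDeriv_prod hxs hys 0 u).trans ?_)
    exact Prod.ext (map_zero _) rfl

/-- Proved through charts: a smooth function on a product is not made of functions on the factors,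
whereas its tensor is. -/
theorem IsPoisson.prod [T2Space N] [T2Space N'] (h : π.IsPoisson) (h' : π'.IsPoisson) :
    (π.prod π').IsPoisson := by
  refine isPoisson_of_tensor fun z => ⟨_, ?_,
    ((h.poissonTensorOn z.1).prod (h'.poissonTensorOn z.2)).congr
      fun w hw => tensor_prod hw.1 hw.2⟩
  rw [extChartAt_prod]
  exact ⟨mem_extChartAt_target z.1, mem_extChartAt_target z.2⟩

end BivectorField
end IsPoisson
end

noncomputable section

set_option maxSynthPendingDepth 3
set_option linter.unusedSectionVars false

/-! ### Foliated boxes. -/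

section PoissonBox

open Filter Metric

variable {E : Type*} [NormedAddCommGroup E] [NormedSpace ℝ E]
  {H : Type*} [TopologicalSpace H] {I : ModelWithCorners ℝ E H}
  {N : Type*} [TopologicalSpace N] [ChartedSpace H N]

namespace BivectorField

/-- The rank of a bivector field at a point. -/
def rank (π : BivectorField I N) (x : N) : ℕ := Module.finrank ℝ (LinearMap.range (π.sharp x))

/-- A curve on `[a, b]` with velocities in the range of `π♯`. -/
def IsTangentCurve (π : BivectorField I N) (γ : ℝ → N) (a b : ℝ) : Prop :=
  ∀ t ∈ Icc a b, ∃ v ∈ LinearMap.range (π.sharp (γ t)), HasVelocityWithinAt I γ (Icc a b) t v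

theorem IsTangentCurve.mono {π : BivectorField I N} {γ : ℝ → N} {a b a' b' : ℝ}
    (h : π.IsTangentCurve γ a b) (hs : Icc a' b' ⊆ Icc a b) : π.IsTangentCurve γ a' b' := by
  intro t ht
  obtain ⟨v, hv, hd⟩ := h t (hs ht)
  exact ⟨v, hv, HasMFDerivWithinAt.mono hd hs⟩

theorem IsTangentCurve.continuousOn {π : BivectorField I N} {γ : ℝ → N} {a b : ℝ}
    (h : π.IsTangentCurve γ a b) : ContinuousOn γ (Icc a b) := fun t ht => by
  obtain ⟨v, -, hd⟩ := h t ht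
  exact HasMFDerivWithinAt.continuousWithinAt hd

/-- The leaf relation on `W` as a setoid. -/
def leafSetoidOn (π : BivectorField I N) (W : Set N) : Setoid N where
  r := π.LeafRelOn W
  iseqv := Relation.EqvGen.is_equivalence _

/-- The union of the leaves which meet `V`. -/
def saturation (π : BivectorField I N) (V : Set N) : Set N :=
  {y | ∃ x ∈ V, π.LeafRelOn univ x y}

theorem subset_saturation (π : BivectorField I N) (V : Set N) : V ⊆ π.saturation V :=
  fun x hx => ⟨x, hx, (π.leafSetoidOn univ).refl x⟩

theorem saturation_saturation (π : BivectorField I N) (V : Set N) :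
    π.saturation (π.saturation V) = π.saturation V := by
  refine Subset.antisymm ?_ (π.subset_saturation _)
  rintro y ⟨x, ⟨z, hz, hzx⟩, hxy⟩
  exact ⟨z, hz, (π.leafSetoidOn univ).trans hzx hxy⟩

/-- Two points are related if the saturations of neighbourhoods of either of them are
neighbourhoods of the other. -/
def nhdsSetoid (π : BivectorField I N) : Setoid N where
  r x y := (∀ V ∈ 𝓝 x, π.saturation V ∈ 𝓝 y) ∧ ∀ V ∈ 𝓝 y, π.saturation V ∈ 𝓝 x
  iseqv :=
    { refl := fun _ => ⟨fun V hV => mem_of_superset hV (π.subset_saturation V),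
        fun V hV => mem_of_superset hV (π.subset_saturation V)⟩
      symm := fun h => ⟨h.2, h.1⟩
      trans := fun h h' => ⟨fun V hV => π.saturation_saturation V ▸ h'.1 _ (h.1 V hV),
        fun V hV => π.saturation_saturation V ▸ h.2 _ (h'.2 V hV)⟩ }

/-- A foliated neighbourhood of a point `z₀`, inside `W`: the level sets of `β` are pieces of
leaves, at the points which have the same rank as `z₀`. -/
structure Box (π : BivectorField I N) (W : Set N) (z₀ : N) where
  O : Set N
  β : N → E
  isOpen : IsOpen O
  mem : z₀ ∈ O
  subset : O ⊆ W
  continuousOn : ContinuousOn β O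
  eq_of_curve : ∀ (γ : ℝ → N) (a b : ℝ), a ≤ b →
    (∀ t ∈ Icc a b, γ t ∈ O ∧ π.rank (γ t) = π.rank z₀) → π.IsTangentCurve γ a b →
    β (γ b) = β (γ a)
  rel : ∀ z ∈ O, ∀ z' ∈ O, β z = β z' → π.LeafRelOn W z z'
  saturation_mem : ∀ z ∈ O, ∀ z' ∈ O, β z = β z' → ∀ V ∈ 𝓝 z,
    {y | ∃ x ∈ V, π.LeafRelOn W x y} ∈ 𝓝 z'
  exists_curve : ∀ z ∈ O, π.rank z = π.rank z₀ → ∀ V ∈ 𝓝 z, ∃ V' ∈ 𝓝 z, ∀ z' ∈ V' ∩ O,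
    β z' = β z → ∃ γ : ℝ → N, γ 0 = z ∧ γ 1 = z' ∧ π.IsTangentCurve γ 0 1 ∧
      ∀ t ∈ Icc (0 : ℝ) 1, γ t ∈ V ∩ O ∧ π.rank (γ t) = π.rank z₀
  velocity_mem : ∀ (c : ℝ → N) (v : TangentSpace I (c 0)), HasVelocityWithinAt I c univ 0 v →
    c 0 = z₀ → (∀ᶠ t in 𝓝 0, c t ∈ O ∧ β (c t) = β z₀) → v ∈ LinearMap.range (π.sharp (c 0))

variable [FiniteDimensional ℝ E] [I.Boundaryless] [IsManifold I ∞ N] [T2Space N]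
  {π : BivectorField I N}

/-- Every point has a foliated neighbourhood. -/
theorem IsPoisson.exists_box (hπ : π.IsPoisson) {W : Set N} (hW : IsOpen W) {z₀ : N}
    (hz₀ : z₀ ∈ W) : Nonempty (π.Box W z₀) := by
  set φ := extChartAt I z₀ with hφ
  set Q := π.tensor z₀ with hQ
  -- Hamiltonians found in the chart are made global by the cutoff `χ`; on `S`, where `χ` is locally
  -- 1, their Hamiltonian fields are unchanged. The whole construction therefore takes place over `W
  -- ∩ S`.
  obtain ⟨χ⟩ : Nonempty (SmoothBumpFunction I z₀) := inferInstance
  set S : Set N := interior {y | χ y = 1} with hS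
  have hz₀S : z₀ ∈ S := mem_interior_iff_mem_nhds.2 χ.eventuallyEq_one
  have hT : IsOpen φ.target := isOpen_extChartAt_target z₀
  have hsrc : IsOpen φ.source := isOpen_extChartAt_source z₀
  have hφc : ContinuousOn φ.symm φ.target := continuousOn_extChartAt_symm z₀
  have hzs : z₀ ∈ φ.source := mem_extChartAt_source z₀
  have hΩo : IsOpen (φ.target ∩ φ.symm ⁻¹' (W ∩ S)) :=
    hφc.isOpen_inter_preimage hT (hW.inter isOpen_interior)
  have hΩ := (hπ.poissonTensorOn z₀).mono hΩo inter_subset_left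
  have hzΩ : φ z₀ ∈ φ.target ∩ φ.symm ⁻¹' (W ∩ S) := by
    refine ⟨φ.map_source hzs, ?_⟩
    rw [mem_preimage, φ.left_inv hzs]
    exact ⟨hz₀, hz₀S⟩
  obtain ⟨U, hUo, hzU, hUΩ, ⟨F⟩⟩ := PoissonFrame.exists_frame hΩ hzΩ
  have hU := hΩ.mono hUo hUΩ
  obtain ⟨L⟩ := LineChart.exists_lineChart F hU hzU
  have hrank : ∀ y ∈ φ.source, Module.finrank ℝ (LinearMap.range (Q (φ y)).toLinearMap) =
      π.rank y := fun y hy => finrank_range_tensor hy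
  have hrank' : ∀ z ∈ φ.target, π.rank (φ.symm z) =
      Module.finrank ℝ (LinearMap.range (Q z).toLinearMap) := fun z hz => by
    rw [← hrank _ (φ.map_target hz), φ.right_inv hz]
  have hUT : U ⊆ φ.target := fun z hz => (hUΩ hz).1
  -- lines are Hamiltonian curves
  have hvel : ∀ z ∈ closedBall (φ z₀) L.r, ∀ w, ‖w‖ ≤ L.ρ → ∀ t ∈ Icc (0 : ℝ) 1,
      ∀ v : TangentSpace I (φ.symm (L.Γ z w t)),
      chartDeriv I z₀ (φ.symm (L.Γ z w t)) v = F.Y (L.Γ z w t) w →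
      HasVelocityWithinAt I (fun t => φ.symm (L.Γ z w t)) (Icc 0 1) t v := by
    intro z hz w hw t ht v hv
    have hm : ∀ s ∈ Icc (0 : ℝ) 1, L.Γ z w s ∈ φ.target := fun s hs =>
      hUT (L.mem_U (L.Γ_mem_unit hz hw hs))
    have hd := L.hasDeriv_unit hz hw ht
    refine (hasVelocityWithinAt_iff (x₀ := z₀) (φ.map_target (hm t ht))).2 ⟨?_, ?_⟩
    · exact ((hφc _ (hm t ht)).continuousAt (hT.mem_nhds (hm t ht))).comp_continuousWithinAt
        hd.continuousWithinAt
    · rw [hv]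
      exact hd.congr_of_mem (fun s hs => φ.right_inv (hm s hs)) ht
  have hline : ∀ z ∈ closedBall (φ z₀) L.r, ∀ w, ‖w‖ ≤ L.ρ →
      π.LeafRelOn W (φ.symm z) (φ.symm (L.Γ z w 1)) := by
    intro z hz w hw
    obtain ⟨f, hf, hfd⟩ := L.exists_hamiltonian hU hz hw
    refine Relation.EqvGen.rel _ _ ⟨fun y => χ y • f (φ y), ?_, fun t => φ.symm (L.Γ z w t),
      fun t ht => (hUΩ (L.mem_U (L.Γ_mem_unit hz hw ht))).2.1, fun t ht => ?_, ?_, rfl⟩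
    · refine (χ.contMDiff_smul ?_).contMDiffOn
      exact hf.contMDiff.comp_contMDiffOn contMDiffOn_extChartAt
    · refine hvel z hz w hw t ht _ ?_
      set y := φ.symm (L.Γ z w t) with hy
      have hΓ := hUΩ (L.mem_U (L.Γ_mem_unit hz hw ht))
      have hys : y ∈ φ.source := φ.map_target hΓ.1
      have hyφ : φ y = L.Γ z w t := φ.right_inv hΓ.1
      have he : (fun y => χ y • f (φ y)) =ᶠ[𝓝 y] f ∘ extChartAt I z₀ := by
        filter_upwards [isOpen_interior.mem_nhds hΓ.2.2] with x hx
        have : χ x = 1 := interior_subset (s := {y | χ y = 1}) hx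
        simp [this, hφ]
      have h1 := hfd t ht
      have h2 : HasFDerivAt f (F.θ (L.Γ z w t) w) (extChartAt I z₀ y) := by rw [← hφ, hyφ]; exact h1
      rw [hamiltonian, mvfderiv_congr he, mvfderiv_comp_extChartAt hys h2.differentiableAt,
        ← tensor_extChartAt hys, h2.fderiv, F.Y_apply]
      rw [← hφ, hyφ]
    · change φ.symm (L.Γ z w 0) = _
      rw [L.Γ_zero z hz w hw]
  have hOmem : ∀ y ∈ φ.source ∩ φ ⁻¹' L.dom, π.LeafRelOn W y (φ.symm (L.β (φ y))) := by
    rintro y ⟨hy, hy'⟩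
    have := hline (φ y) (L.dom_subset hy') (F.p (φ z₀) - F.p (φ y)) (L.norm_p_sub_le hy' L.mem_dom)
    rwa [φ.left_inv hy] at this
  refine ⟨{
    O := φ.source ∩ φ ⁻¹' L.dom
    β := L.β ∘ φ
    isOpen := (continuousOn_extChartAt z₀).isOpen_inter_preimage hsrc L.isOpen_dom
    mem := ⟨hzs, L.mem_dom⟩
    subset := ?_
    continuousOn := L.continuousOn_β.comp ((continuousOn_extChartAt z₀).mono inter_subset_left)
      fun y hy => hy.2
    eq_of_curve := ?_
    rel := ?_
    saturation_mem := ?_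
    exists_curve := ?_
    velocity_mem := ?_ }⟩
  · rintro y ⟨hy, hy'⟩
    have := (hUΩ (L.dom_subset_U hy')).2.1
    rwa [φ.left_inv hy] at this
  · intro γ a b hab hγ hT
    refine L.β_eq_of_curve (γ := φ ∘ γ) hU hab (fun t ht => (hγ t ht).1.2) (fun t ht => ?_)
      fun t ht => ?_
    · rw [Function.comp_apply, hrank _ (hγ t ht).1.1, (hγ t ht).2, ← hrank z₀ hzs]
    · obtain ⟨v, hv, hd⟩ := hT t ht
      exact ⟨_, (mem_range_sharp_iff (hγ t ht).1.1).2 hv,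
        ((hasVelocityWithinAt_iff (hγ t ht).1.1).1 hd).2⟩
  · intro z hz z' hz' hβ
    have h1 := hOmem z hz
    have h2 := hOmem z' hz'
    rw [← show L.β (φ z) = L.β (φ z') from hβ] at h2
    exact (π.leafSetoidOn W).trans h1 ((π.leafSetoidOn W).symm h2)
  · intro z hz z' hz' hβ V hV
    -- In the chart, `y ↦ Γ (β y) (p z - p z₀) 1` is continuous, keeps each point in its leaf, and
    -- sends `z'` to `z` because `β z' = β z`. It pulls `V` back to a neighbourhood of `z'`
    -- contained in the saturation. No condition on the rank is needed.
    have hw : ‖F.p (φ z) - F.p (φ z₀)‖ ≤ L.ρ := L.norm_p_sub_le L.mem_dom hz.2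
    have hc : ContinuousOn (fun y => L.Γ (L.β (φ y)) (F.p (φ z) - F.p (φ z₀)) 1)
        (φ.source ∩ φ ⁻¹' L.dom) := by
      have h1 : ContinuousOn (fun y => L.β (φ y)) (φ.source ∩ φ ⁻¹' L.dom) :=
        L.continuousOn_β.comp ((continuousOn_extChartAt z₀).mono inter_subset_left)
          fun y hy => hy.2
      exact L.continuousOn_Γ_one.comp (h1.prodMk continuousOn_const) fun y hy =>
        ⟨L.β_mem hy.2, mem_closedBall_zero_iff.2 hw⟩
    have ho : IsOpen (φ.source ∩ φ ⁻¹' L.dom) :=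
      (continuousOn_extChartAt z₀).isOpen_inter_preimage hsrc L.isOpen_dom
    have hval : L.Γ (L.β (φ z')) (F.p (φ z) - F.p (φ z₀)) 1 = φ z := by
      rw [← show L.β (φ z) = L.β (φ z') from hβ, L.Γ_β hz.2]
    have hc1 : ContinuousAt φ.symm (L.Γ (L.β (φ z')) (F.p (φ z) - F.p (φ z₀)) 1) := by
      rw [hval]
      exact (hφc _ (φ.map_source hz.1)).continuousAt (hT.mem_nhds (φ.map_source hz.1))
    have hc2 : ContinuousAt (fun y => φ.symm (L.Γ (L.β (φ y)) (F.p (φ z) - F.p (φ z₀)) 1)) z' :=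
      ContinuousAt.comp (g := φ.symm) hc1 (hc.continuousAt (ho.mem_nhds hz'))
    have hV' : V ∈ 𝓝 (φ.symm (L.Γ (L.β (φ z')) (F.p (φ z) - F.p (φ z₀)) 1)) := by
      rwa [hval, φ.left_inv hz.1]
    filter_upwards [hc2 hV', ho.mem_nhds hz'] with y hy hyO
    refine ⟨_, hy, ?_⟩
    exact (π.leafSetoidOn W).symm ((π.leafSetoidOn W).trans (hOmem y hyO)
      (hline _ (L.β_mem hyO.2) _ hw))
  · intro z hz hzr V hV
    have h1 : L.dom ∩ φ.symm ⁻¹' V ∈ 𝓝 (φ z) := by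
      refine inter_mem (L.isOpen_dom.mem_nhds hz.2) ?_
      have hz' := φ.map_source hz.1
      refine ((hφc _ hz').continuousAt (hT.mem_nhds hz')).preimage_mem_nhds ?_
      rwa [φ.left_inv hz.1]
    obtain ⟨ε, hε, hεs⟩ := Metric.mem_nhds_iff.1 h1
    have hc : ContinuousAt (fun y => L.K * ‖F.p (φ y) - F.p (φ z)‖) z := by
      have h2 : ContinuousAt φ z := (continuousOn_extChartAt z₀).continuousAt (hsrc.mem_nhds hz.1)
      have h3 : ContinuousAt (fun y => F.p (φ y)) z := F.p.continuous.continuousAt.comp h2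
      exact continuousAt_const.mul (h3.sub continuousAt_const).norm
    refine ⟨_, hc.eventually_lt continuousAt_const (by simpa using hε), ?_⟩
    rintro z' ⟨hz'V, hz'⟩ hβ
    set w := F.p (φ z') - F.p (φ z) with hw
    have hwρ : ‖w‖ ≤ L.ρ := L.norm_p_sub_le hz.2 hz'.2
    have hzr' := L.dom_subset hz.2
    have hmem : ∀ t ∈ Icc (0 : ℝ) 1, L.Γ (φ z) w t ∈ L.dom ∩ φ.symm ⁻¹' V := fun t ht => by
      refine hεs ?_
      rw [mem_ball, dist_eq_norm]
      exact (L.norm_Γ_sub_le hzr' hwρ ht).trans_lt hz'V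
    have hrk : ∀ t ∈ Icc (0 : ℝ) 1,
        Module.finrank ℝ (LinearMap.range (Q (L.Γ (φ z) w t)).toLinearMap) = π.rank z₀ :=
      fun t ht => by rw [L.finrank_Γ hU hzr' hwρ ht, hrank z hz.1, hzr]
    -- The end of the line from `z` with coefficient `p z' - p z` has the same `β` as `z'`, by
    -- constancy of `β` along it, and the same `p`; these determine a point.
    have hend : L.Γ (φ z) w 1 = φ z' := by
      have h01 : (1 : ℝ) ∈ Icc (0 : ℝ) 1 := right_mem_Icc.2 zero_le_one
      refine L.eq_of_β_eq (hmem 1 h01).1 hz'.2 ?_ ?_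
      · have h3 := L.β_eq_of_curve (γ := L.Γ (φ z) w) hU zero_le_one (fun t ht => (hmem t ht).1)
          (fun t ht => by rw [hrk t ht, ← hrank z₀ hzs])
          fun t ht => ⟨_, ⟨_, rfl⟩, L.hasDeriv_unit hzr' hwρ ht⟩
        rw [h3, L.Γ_zero _ hzr' w hwρ]
        exact hβ.symm
      · rw [L.p_Γ hzr' hwρ h01, hw, one_smul, add_sub_cancel]
    refine ⟨fun t => φ.symm (L.Γ (φ z) w t), ?_, ?_, fun t ht => ?_, fun t ht => ⟨⟨?_, ?_, ?_⟩, ?_⟩⟩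
    · change φ.symm (L.Γ (φ z) w 0) = z
      rw [L.Γ_zero _ hzr' w hwρ, φ.left_inv hz.1]
    · change φ.symm (L.Γ (φ z) w 1) = z'
      rw [hend, φ.left_inv hz'.1]
    · have hΓT := hUT (L.dom_subset_U (hmem t ht).1)
      have hs := φ.map_target hΓT
      obtain ⟨v, hv⟩ := (chartDeriv_bijective (I := I) (x₀ := z₀) hs).2 (F.Y (L.Γ (φ z) w t) w)
      refine ⟨v, ?_, hvel _ hzr' w hwρ t ht v hv⟩
      rw [← mem_range_sharp_iff (x₀ := z₀) hs, hv, ← hφ, φ.right_inv hΓT]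
      exact ⟨_, rfl⟩
    · exact (hmem t ht).2
    · exact φ.map_target (hUT (L.dom_subset_U (hmem t ht).1))
    · change φ (φ.symm _) ∈ L.dom
      rw [φ.right_inv (hUT (L.dom_subset_U (hmem t ht).1))]
      exact (hmem t ht).1
    · rw [hrank' _ (hUT (L.dom_subset_U (hmem t ht).1)), hrk t ht]
  · intro c v hv h0 hm
    have hc0 : c 0 ∈ φ.source := h0 ▸ hzs
    have hd := ((hasVelocityWithinAt_iff hc0).1 hv).2
    rw [hasDerivWithinAt_univ] at hd
    have hβ0 : (L.β ∘ φ) z₀ = φ z₀ := L.β_self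
    have h1 := L.deriv_eq_of_β_eq hd (by rw [Function.comp_apply, h0]) (by
      filter_upwards [hm] with t ht
      exact ⟨ht.1.2, ht.2.trans hβ0⟩)
    rw [← mem_range_sharp_iff hc0, h1, ← hφ, h0]
    exact ⟨_, rfl⟩

end BivectorField
end PoissonBox
end

noncomputable section

set_option maxSynthPendingDepth 3
set_option linter.unusedSectionVars false

/-! ### Leaves through tangent curves of constant rank. -/

section Leaves

open Filter Metric

/-- A function which is constant along the pieces of a curve in small open sets takes the same
values at the ends of the curve. -/
theorem eq_of_curve_of_local {N α : Type*} [TopologicalSpace N] {F : N → α} {γ : ℝ → N} {a b : ℝ}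
    (hγ : ContinuousOn γ (Icc a b))
    (h : ∀ t ∈ Icc a b, ∃ O : Set N, IsOpen O ∧ γ t ∈ O ∧ ∀ s s', s ≤ s' →
      Icc s s' ⊆ Icc a b → (∀ r ∈ Icc s s', γ r ∈ O) → F (γ s') = F (γ s)) :
    ∀ t ∈ Icc a b, F (γ t) = F (γ a) := by
  refine eq_left_of_eventually_eq (F := F ∘ γ) fun t ht => ?_
  obtain ⟨O, hO, htO, hc⟩ := h t ht
  obtain ⟨ε, hε, hs⟩ := Metric.mem_nhdsWithin_iff.1 (hγ t ht (hO.mem_nhds htO))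
  refine Metric.mem_nhdsWithin_iff.2 ⟨ε, hε, ?_⟩
  rintro s ⟨hs1, hs2⟩
  have hsub : ∀ {u v : ℝ}, u ∈ ball t ε ∩ Icc a b → v ∈ ball t ε ∩ Icc a b →
      Icc u v ⊆ ball t ε ∩ Icc a b := by
    intro u v hu hv
    have h1 : (ball t ε).OrdConnected := by rw [Real.ball_eq_Ioo]; exact ordConnected_Ioo
    exact (h1.inter ordConnected_Icc).out hu hv
  have ht' : t ∈ ball t ε ∩ Icc a b := ⟨mem_ball_self hε, ht⟩
  rcases le_total s t with hst | hst
  · have h1 := hsub ⟨hs1, hs2⟩ ht'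
    exact (hc s t hst (h1.trans inter_subset_right) fun r hr => hs (h1 hr)).symm
  · have h1 := hsub ht' ⟨hs1, hs2⟩
    exact hc t s hst (h1.trans inter_subset_right) fun r hr => hs (h1 hr)

variable {E : Type*} [NormedAddCommGroup E] [NormedSpace ℝ E]
  {H : Type*} [TopologicalSpace H] {I : ModelWithCorners ℝ E H}
  {N : Type*} [TopologicalSpace N] [ChartedSpace H N]
  [FiniteDimensional ℝ E] [I.Boundaryless] [IsManifold I ∞ N] [T2Space N]
  {π : BivectorField I N}

namespace BivectorField

theorem IsPoisson.eventually_rank_ge (hπ : π.IsPoisson) (x : N) :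
    ∀ᶠ y in 𝓝 x, π.rank x ≤ π.rank y := by
  have h1 := (hπ.poissonTensorOn x).eventually_finrank_ge (mem_extChartAt_target x)
  have h2 : Tendsto (extChartAt I x) (𝓝 x) (𝓝 (extChartAt I x x)) := continuousAt_extChartAt x
  filter_upwards [h2 h1, extChartAt_source_mem_nhds (I := I) x] with y hy hy'
  have h3 : Module.finrank ℝ (LinearMap.range (π.tensor x (extChartAt I x x)).toLinearMap) ≤
    Module.finrank ℝ (LinearMap.range (π.tensor x (extChartAt I x y)).toLinearMap) := hy
  rwa [finrank_range_tensor (mem_extChartAt_source x), finrank_range_tensor hy'] at h3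

/-- A tangent curve along which the rank is constant stays in a leaf. -/
theorem IsPoisson.leafRelOn_of_isTangentCurve (hπ : π.IsPoisson) {W : Set N} (hW : IsOpen W)
    {γ : ℝ → N} {a b : ℝ} (hab : a ≤ b) (hγ : π.IsTangentCurve γ a b) {k : ℕ}
    (hk : ∀ t ∈ Icc a b, γ t ∈ W ∧ π.rank (γ t) = k) : π.LeafRelOn W (γ a) (γ b) := by
  have h1 := eq_of_curve_of_local (F := fun x => Quotient.mk (π.leafSetoidOn W) x)
    hγ.continuousOn (fun t ht => ?_) b (right_mem_Icc.2 hab)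
  · exact (π.leafSetoidOn W).symm (Quotient.exact h1)
  · obtain ⟨B⟩ := hπ.exists_box hW (hk t ht).1
    refine ⟨B.O, B.isOpen, B.mem, fun s s' hs hsub hO => Quotient.sound ?_⟩
    refine B.rel _ (hO s' (right_mem_Icc.2 hs)) _ (hO s (left_mem_Icc.2 hs))
      (B.eq_of_curve γ s s' hs (fun r hr => ⟨hO r hr, ?_⟩) (hγ.mono hsub))
    rw [(hk r (hsub hr)).2, (hk t ht).2]

/-- Locally the curve stays in a plaque of a box, where following lines transports neighbourhoods
within leaves; compactness of the interval is replaced by its connectedness. -/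
theorem IsPoisson.nhdsSetoid_of_isTangentCurve (hπ : π.IsPoisson)
    {γ : ℝ → N} {a b : ℝ} (hab : a ≤ b) (hγ : π.IsTangentCurve γ a b) {k : ℕ}
    (hk : ∀ t ∈ Icc a b, π.rank (γ t) = k) : π.nhdsSetoid (γ a) (γ b) := by
  have h1 := eq_of_curve_of_local (F := fun x => Quotient.mk π.nhdsSetoid x)
    hγ.continuousOn (fun t ht => ?_) b (right_mem_Icc.2 hab)
  · exact π.nhdsSetoid.symm (Quotient.exact h1)
  · obtain ⟨B⟩ := hπ.exists_box isOpen_univ (mem_univ (γ t))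
    refine ⟨B.O, B.isOpen, B.mem, fun s s' hs hsub hO => Quotient.sound ?_⟩
    have hβ := B.eq_of_curve γ s s' hs
      (fun r hr => ⟨hO r hr, by rw [hk r (hsub hr), hk t ht]⟩) (hγ.mono hsub)
    have hs1 := hO s (left_mem_Icc.2 hs)
    have hs2 := hO s' (right_mem_Icc.2 hs)
    exact ⟨B.saturation_mem _ hs2 _ hs1 hβ, B.saturation_mem _ hs1 _ hs2 hβ.symm⟩

/-- The rank is constant along Hamiltonian curves. -/
theorem IsPoisson.rank_eq_of_isMIntegralCurveOn (hπ : π.IsPoisson) {W : Set N} (hW : IsOpen W)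
    {f : N → ℝ} (hf : ContMDiffOn I 𝓘(ℝ, ℝ) ∞ f W) {γ : ℝ → N}
    (hγW : ∀ t ∈ Icc (0 : ℝ) 1, γ t ∈ W)
    (hγ : IsMIntegralCurveOn γ (π.hamiltonian f) (Icc 0 1)) :
    ∀ t ∈ Icc (0 : ℝ) 1, π.rank (γ t) = π.rank (γ 0) := by
  have hc : ContinuousOn γ (Icc 0 1) := fun t ht => (hγ t ht).continuousWithinAt
  refine eq_of_curve_of_local hc fun t ht => ?_
  set φ := extChartAt I (γ t) with hφ
  refine ⟨φ.source ∩ W, (isOpen_extChartAt_source _).inter hW,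
    ⟨mem_extChartAt_source _, hγW t ht⟩, fun s s' hs hsub hO => ?_⟩
  have hfW : ∀ y ∈ W, ContMDiffAt I 𝓘(ℝ, ℝ) ∞ f y := fun y hy => hf.contMDiffAt (hW.mem_nhds hy)
  have hφγ : ContinuousOn (φ ∘ γ) (Icc s s') :=
    (continuousOn_extChartAt (γ t)).comp (hc.mono hsub) fun r hr => (hO r hr).1
  have h1 := (hπ.poissonTensorOn (γ t)).finrank_eq_of_curve (γ := φ ∘ γ)
    (θ := fun r => fderiv ℝ (f ∘ φ.symm) (φ (γ r))) (a := s) (b := s') ?_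
    (fun r hr => φ.map_source (hO r hr).1) (fun r hr => ?_) s' (right_mem_Icc.2 hs)
  · rw [Function.comp_apply, Function.comp_apply,
      finrank_range_tensor (hO _ (right_mem_Icc.2 hs)).1,
      finrank_range_tensor (hO _ (left_mem_Icc.2 hs)).1] at h1
    exact h1
  · intro r hr
    have h2 := contDiffAt_comp_extChartAt_symm (hO r hr).1 (hfW _ (hO r hr).2)
    have h3 := (h2.fderiv_right (m := 0) (by norm_cast)).continuousAt
    exact ContinuousAt.comp_continuousWithinAt (f := φ ∘ γ) h3 (hφγ r hr)
  · have h2 := (hγ r (hsub hr)).mono hsub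
    have h3 := ((hasVelocityWithinAt_iff (x₀ := γ t) (hO r hr).1).1 h2).2
    rwa [chartDeriv_hamiltonian (hO r hr).1 (hfW _ (hO r hr).2)] at h3

/-- To prove a relation between the points of the leaves in `W`, it is enough to consider the ends
of tangent curves along which the rank is constant. -/
theorem IsPoisson.leafRelOn_induction (hπ : π.IsPoisson) {W : Set N} (hW : IsOpen W)
    (r : Setoid N) (h : ∀ γ : ℝ → N, π.IsTangentCurve γ 0 1 →
      (∀ t ∈ Icc (0 : ℝ) 1, γ t ∈ W) → (∀ t ∈ Icc (0 : ℝ) 1, π.rank (γ t) = π.rank (γ 0)) →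
      r (γ 0) (γ 1)) {x y : N} (hxy : π.LeafRelOn W x y) : r x y := by
  induction hxy with
  | rel x y hxy =>
    obtain ⟨f, hf, γ, hγW, hγ, rfl, rfl⟩ := hxy
    refine h γ (fun t ht => ⟨_, ⟨_, rfl⟩, hγ t ht⟩) hγW ?_
    exact hπ.rank_eq_of_isMIntegralCurveOn hW hf hγW hγ
  | refl x => exact r.refl x
  | symm x y _ ih => exact r.symm ih
  | trans x y z _ _ ih ih' => exact r.trans ih ih'

/-- Along a leaf, neighbourhoods of one point saturate to neighbourhoods of the other. This avoids
flows of Hamiltonian fields, which may be incomplete. -/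
theorem IsPoisson.isOpen_saturation (hπ : π.IsPoisson) {V : Set N} (hV : IsOpen V) :
    IsOpen (π.saturation V) := by
  rw [isOpen_iff_mem_nhds]
  rintro y ⟨x, hx, hxy⟩
  exact (hπ.leafRelOn_induction isOpen_univ π.nhdsSetoid (fun γ hγ _ hk =>
    hπ.nhdsSetoid_of_isTangentCurve zero_le_one hγ hk) hxy).1 V (hV.mem_nhds hx)

theorem IsPoisson.isOpenMap_mk (hπ : π.IsPoisson) :
    IsOpenMap (fun x => (Quotient.mk π.leafSetoid x : π.LeafSpace)) := by
  intro V hV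
  refine (isQuotientMap_quotient_mk' (s := π.leafSetoid)).isOpen_preimage.1 ?_
  convert hπ.isOpen_saturation hV using 1
  ext y
  constructor
  · rintro ⟨x, hx, hxy⟩
    exact ⟨x, hx, Quotient.exact hxy⟩
  · rintro ⟨x, hx, hxy⟩
    exact ⟨x, hx, Quotient.sound hxy⟩

/-! ### Countability of plaques, and tangency of curves contained in a leaf. -/

section Countable

variable [SecondCountableTopology N]

/-- A plaque meets countably many plaques of a box. -/
theorem Box.countable_image {W W' : Set N} {z z' : N} (B : π.Box W z) (B' : π.Box W' z')
    (hz : π.rank z' = π.rank z) (b : E) :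
    (B'.β '' {y | y ∈ B.O ∧ y ∈ B'.O ∧ π.rank y = π.rank z ∧ B.β y = b}).Countable := by
  set S := {y | y ∈ B.O ∧ y ∈ B'.O ∧ π.rank y = π.rank z ∧ B.β y = b} with hS
  -- On a plaque of `B`, `B'.β` is locally constant: nearby points of the plaque are joined by
  -- tangent curves of constant rank inside `B'.O`. By second countability it takes countably many
  -- values.
  have h1 : ∀ y ∈ S, ∃ V ∈ 𝓝[S] y, ∀ y' ∈ V ∩ S, B'.β y' = B'.β y := by
    rintro y ⟨hy1, hy2, hy3, hy4⟩
    obtain ⟨V, hV, h⟩ := B.exists_curve y hy1 hy3 B'.O (B'.isOpen.mem_nhds hy2)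
    refine ⟨V, mem_nhdsWithin_of_mem_nhds hV, ?_⟩
    rintro y' ⟨hyV, hy1', -, -, hy4'⟩
    obtain ⟨γ, rfl, rfl, hγ, hm⟩ := h y' ⟨hyV, hy1'⟩ (hy4'.trans hy4.symm)
    exact B'.eq_of_curve γ 0 1 zero_le_one
      (fun t ht => ⟨(hm t ht).1.1, (hm t ht).2.trans hz.symm⟩) hγ
  choose! V hV hVc using h1
  obtain ⟨T, hTS, hT, hcov⟩ := TopologicalSpace.countable_cover_nhdsWithin hV
  refine (hT.image B'.β).mono ?_
  rintro _ ⟨y, hy, rfl⟩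
  obtain ⟨t, ht, hyt⟩ := mem_iUnion₂.1 (hcov hy)
  exact ⟨t, ht, (hVc t (hTS ht) y ⟨hyt, hy⟩).symm⟩

/-- A curve contained in a leaf has its velocity in the tangent space of the leaf. -/
theorem IsPoisson.velocity_mem_of_leafRelOn (hπ : π.IsPoisson) {c : ℝ → N}
    {v : TangentSpace I (c 0)} (hv : HasVelocityWithinAt I c univ 0 v)
    (hc : ∀ᶠ t in 𝓝 0, ContinuousAt c t) (hl : ∀ t, π.LeafRelOn univ (c 0) (c t)) :
    v ∈ LinearMap.range (π.sharp (c 0)) := by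
  set k := π.rank (c 0) with hk
  have hB : ∀ z : N, Nonempty (π.Box univ z) := fun z => hπ.exists_box isOpen_univ (mem_univ z)
  let B : ∀ z : N, π.Box univ z := fun z => Classical.choice (hB z)
  set S := {z | π.rank z = k} with hS
  -- Countably many boxes, centred at points of rank `k`, cover all points of rank `k`.
  obtain ⟨T, hTS, hT, hcov⟩ := TopologicalSpace.countable_cover_nhdsWithin (s := S)
    (f := fun z => (B z).O) fun z _ =>
      mem_nhdsWithin_of_mem_nhds ((B z).isOpen.mem_nhds (B z).mem)
  have hcov' : ∀ y, π.rank y = k → ∃ z ∈ T, y ∈ (B z).O := fun y hy => by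
    obtain ⟨z, hz, hyz⟩ := mem_iUnion₂.1 (hcov hy)
    exact ⟨z, hz, hyz⟩
  -- A pair `(z, b)` encodes the plaque at level `b` of the box at `z`, and `next` passes to the
  -- plaques that meet a given family. Starting from one plaque through `c 0` and iterating gives
  -- countably many, since a plaque meets countably many plaques of each box.
  let Pl : N × E → Set N := fun q => {y | y ∈ (B q.1).O ∧ π.rank y = k ∧ (B q.1).β y = q.2}
  let next : Set (N × E) → Set (N × E) := fun R =>
    ⋃ q ∈ R ∩ {q | q.1 ∈ T}, {q' | q'.1 ∈ T ∧ (Pl q ∩ Pl q').Nonempty}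
  have hcount : ∀ R : Set (N × E), R.Countable → (next R).Countable := by
    intro R hR
    refine (hR.mono inter_subset_left).biUnion fun q hq => ?_
    have h2 : {q' : N × E | q'.1 ∈ T ∧ (Pl q ∩ Pl q').Nonempty} ⊆ ⋃ z ∈ T, (fun b => (z, b)) ''
        ((B z).β '' {y | y ∈ (B q.1).O ∧ y ∈ (B z).O ∧ π.rank y = π.rank q.1 ∧
          (B q.1).β y = q.2}) := by
      rintro ⟨z, b⟩ ⟨hz, y, hy, hy'⟩
      exact mem_iUnion₂.2 ⟨z, hz, b, ⟨y, ⟨hy.1, hy'.1, hy.2.1.trans (hTS hq.2).symm, hy.2.2⟩,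
        hy'.2.2⟩, rfl⟩
    refine Countable.mono h2 (hT.biUnion fun z hz => Countable.image ?_ _)
    exact (B q.1).countable_image (B z) ((hTS hz).trans (hTS hq.2).symm) q.2
  obtain ⟨z₁, hz₁T, hz₁⟩ := hcov' (c 0) rfl
  let R : ℕ → Set (N × E) := fun n => next^[n] {(z₁, (B z₁).β (c 0))}
  have hR : ∀ n, (R n).Countable := by
    intro n
    induction n with
    | zero => exact countable_singleton _
    | succ n ih =>
      change (next^[n + 1] _).Countable
      rw [Function.iterate_succ_apply']
      exact hcount _ ih
  let Y : Set N := {y | ∃ n, ∃ q ∈ R n, q.1 ∈ T ∧ y ∈ Pl q}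
  have hYstep : ∀ q : N × E, q.1 ∈ T → ∀ y ∈ Pl q, ∀ y' ∈ Pl q, y ∈ Y → y' ∈ Y := by
    rintro q hq y hy y' hy' ⟨n, q', hq', hq'T, hyq'⟩
    refine ⟨n + 1, q, ?_, hq, hy'⟩
    change q ∈ next^[n + 1] _
    rw [Function.iterate_succ_apply']
    exact mem_iUnion₂.2 ⟨q', ⟨hq', hq'T⟩, hq, y, hyq', hy⟩
  have hY0 : c 0 ∈ Y := ⟨0, _, mem_singleton _, hz₁T, hz₁, rfl, rfl⟩
  -- The union `Y` of these plaques contains the leaf: a tangent curve of rank `k` runs locally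
  -- inside single plaques, and a plaque with a point in `Y` lies in `Y`.
  have hYl : ∀ t, π.rank (c t) = k ∧ c t ∈ Y := by
    intro t
    have h2 := hπ.leafRelOn_induction isOpen_univ
      (Setoid.ker fun y : N => (π.rank y, π.rank y = k ∧ y ∈ Y)) (fun γ hγ _ hr => ?_) (hl t)
    · have h3 := congrArg Prod.snd h2
      exact h3.mp ⟨rfl, hY0⟩
    · have hr1 := hr 1 (right_mem_Icc.2 zero_le_one)
      refine Prod.ext hr1.symm ?_
      by_cases hγk : π.rank (γ 0) = k
      · refine (eq_of_curve_of_local (F := fun y => π.rank y = k ∧ y ∈ Y)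
          hγ.continuousOn (fun t ht => ?_) 1 (right_mem_Icc.2 zero_le_one)).symm
        obtain ⟨z, hz, htz⟩ := hcov' (γ t) ((hr t ht).trans hγk)
        refine ⟨(B z).O, (B z).isOpen, htz, fun s s' hs hsub hO => ?_⟩
        have hrk : ∀ r ∈ Icc s s', π.rank (γ r) = k := fun r hr' => (hr r (hsub hr')).trans hγk
        have h4 := (B z).eq_of_curve γ s s' hs
          (fun r hr' => ⟨hO r hr', (hrk r hr').trans (hTS hz).symm⟩) (hγ.mono hsub)
        have hs1 := left_mem_Icc.2 hs
        have hs2 := right_mem_Icc.2 hs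
        have hp1 : γ s ∈ Pl (z, (B z).β (γ s)) := ⟨hO s hs1, hrk s hs1, rfl⟩
        have hp2 : γ s' ∈ Pl (z, (B z).β (γ s)) := ⟨hO s' hs2, hrk s' hs2, h4⟩
        exact propext ⟨fun h => ⟨hrk s hs1, hYstep _ hz _ hp2 _ hp1 h.2⟩,
          fun h => ⟨hrk s' hs2, hYstep _ hz _ hp1 _ hp2 h.2⟩⟩
      · exact propext ⟨fun h => absurd h.1 hγk, fun h => absurd (hr1.symm.trans h.1) hγk⟩
  set B₀ := B (c 0) with hB₀
  have hD : (⋃ n, ⋃ q ∈ R n ∩ {q | q.1 ∈ T}, B₀.β '' {y | y ∈ (B q.1).O ∧ y ∈ B₀.O ∧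
      π.rank y = π.rank q.1 ∧ (B q.1).β y = q.2}).Countable :=
    countable_iUnion fun n => ((hR n).mono inter_subset_left).biUnion fun q hq =>
      (B q.1).countable_image B₀ (hTS hq.2).symm q.2
  have hc0 : ContinuousAt c 0 := hc.self_of_nhds
  obtain ⟨ε, hε, hεs⟩ := Metric.mem_nhds_iff.1
    (inter_mem hc (hc0 (B₀.isOpen.mem_nhds B₀.mem)))
  have hcont : ContinuousOn (fun t => B₀.β (c t)) (ball 0 ε) :=
    B₀.continuousOn.comp (fun t ht => (hεs ht).1.continuousWithinAt) fun t ht => (hεs ht).2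
  have himg : ((fun t => B₀.β (c t)) '' ball 0 ε).Countable := by
    refine hD.mono ?_
    rintro _ ⟨t, ht, rfl⟩
    obtain ⟨n, q, hq, hqT, hm⟩ := (hYl t).2
    exact mem_iUnion.2 ⟨n, mem_iUnion₂.2 ⟨q, ⟨hq, hqT⟩, c t, ⟨hm.1, (hεs ht).2,
      hm.2.1.trans (hTS hqT).symm, hm.2.2⟩, rfl⟩⟩
  -- The image of an interval under the continuous map `β ∘ c` is connected and countable, hence a
  -- point: near 0 the curve stays in one plaque of the box at `c 0`.
  have hpre : IsPreconnected ((fun t => B₀.β (c t)) '' ball 0 ε) :=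
    ((convex_ball (0 : ℝ) ε).isPreconnected).image _ hcont
  have hsub : ((fun t => B₀.β (c t)) '' ball 0 ε).Subsingleton :=
    himg.isTotallyDisconnected _ Subset.rfl hpre
  refine B₀.velocity_mem c v hv rfl ?_
  filter_upwards [ball_mem_nhds (0 : ℝ) hε] with t ht
  exact ⟨(hεs ht).2, hsub ⟨t, ht, rfl⟩ ⟨0, mem_ball_self hε, rfl⟩⟩

end Countable

end BivectorField
end Leaves
end

noncomputable section

set_option maxSynthPendingDepth 3
set_option linter.unusedSectionVars false

/-! ### Operations on velocities. -/

section Velocity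

open Filter

variable {E : Type*} [NormedAddCommGroup E] [NormedSpace ℝ E]
  {H : Type*} [TopologicalSpace H] {I : ModelWithCorners ℝ E H}
  {N : Type*} [TopologicalSpace N] [ChartedSpace H N]
  {E' : Type*} [NormedAddCommGroup E'] [NormedSpace ℝ E']
  {H' : Type*} [TopologicalSpace H'] {I' : ModelWithCorners ℝ E' H'}
  {N' : Type*} [TopologicalSpace N'] [ChartedSpace H' N']

theorem HasVelocityWithinAt.comp {γ : ℝ → N} {s : Set ℝ} {t : ℝ} {v : TangentSpace I (γ t)}
    (h : HasVelocityWithinAt I γ s t v) {f : N → N'} (hf : MDifferentiableAt I I' f (γ t)) :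
    HasVelocityWithinAt I' (fun r => f (γ r)) s t (mfderiv I I' f (γ t) v) := by
  have h1 := hf.hasMFDerivAt.comp_hasMFDerivWithinAt t h
  have h2 : (mfderiv I I' f (γ t)).comp ((1 : ℝ →L[ℝ] ℝ).smulRight v) =
      (1 : ℝ →L[ℝ] ℝ).smulRight (mfderiv I I' f (γ t) v) := comp_smulRight_one rfl
  unfold HasVelocityWithinAt
  exact h2 ▸ h1

theorem HasVelocityWithinAt.prodMk {γ : ℝ → N} {γ' : ℝ → N'} {s : Set ℝ} {t : ℝ}
    {v : TangentSpace I (γ t)} {v' : TangentSpace I' (γ' t)}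
    (h : HasVelocityWithinAt I γ s t v) (h' : HasVelocityWithinAt I' γ' s t v') :
    HasVelocityWithinAt (I.prod I') (fun r => (γ r, γ' r)) s t (v, v') :=
  HasMFDerivWithinAt.prodMk h h'

theorem hasVelocityWithinAt_const (x : N) (s : Set ℝ) (t : ℝ) :
    HasVelocityWithinAt I (fun _ : ℝ => x) s t 0 := by
  have h1 := hasMFDerivWithinAt_const (I := 𝓘(ℝ, ℝ)) (I' := I) x s t
  have h2 : (1 : ℝ →L[ℝ] ℝ).smulRight (0 : TangentSpace I x) = 0 := by
    ext
    simp
  unfold HasVelocityWithinAt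
  rw [h2]
  exact h1

/-- The curve is a straight line in the chart. The velocity is stated through its chart expression
because `c 0 = x` is only a propositional equality. -/
theorem exists_hasVelocityWithinAt [I.Boundaryless] [IsManifold I ∞ N] (x : N)
    (v : TangentSpace I x) : ∃ c : ℝ → N, c 0 = x ∧ (∀ᶠ t in 𝓝 0, ContinuousAt c t) ∧
      ∀ (u : TangentSpace I (c 0)), chartDeriv I x (c 0) u = chartDeriv I x x v →
        HasVelocityWithinAt I c univ 0 u := by
  set φ := extChartAt I x with hφ
  have hx := mem_extChartAt_source (I := I) x
  let l : ℝ → E := fun t => φ x + t • chartDeriv I x x v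
  have hl : Continuous l := by fun_prop
  have hl0 : l 0 = φ x := by simp [l]
  have ht : ∀ᶠ t in 𝓝 0, l t ∈ φ.target := by
    refine hl.continuousAt ?_
    rw [hl0]
    exact (isOpen_extChartAt_target (I := I) x).mem_nhds (φ.map_source hx)
  have hc : ∀ᶠ t in 𝓝 0, ContinuousAt (fun t => φ.symm (l t)) t := by
    filter_upwards [ht] with t ht
    exact ContinuousAt.comp (g := φ.symm) ((continuousOn_extChartAt_symm x).continuousAt
      ((isOpen_extChartAt_target x).mem_nhds ht)) hl.continuousAt
  have h0 : φ.symm (l 0) = x := by rw [hl0, φ.left_inv hx]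
  refine ⟨fun t => φ.symm (l t), h0, hc, fun u hu => ?_⟩
  refine (hasVelocityWithinAt_iff (x₀ := x) (h0.symm ▸ hx)).2
    ⟨hc.self_of_nhds.continuousWithinAt, ?_⟩
  rw [hu, hasDerivWithinAt_univ]
  have h1 : HasDerivAt l (chartDeriv I x x v) 0 := by
    exact (((hasDerivAt_id (0 : ℝ)).smul_const (chartDeriv I x x v)).const_add (φ x)).congr_deriv
      (one_smul _ _)
  refine h1.congr_of_eventuallyEq ?_
  filter_upwards [ht] with t ht
  exact φ.right_inv ht

end Velocity

/-! ### Leaves of product Poisson manifolds, and quotient maps onto leaf spaces. -/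

section Products

open Filter

variable {E : Type*} [NormedAddCommGroup E] [NormedSpace ℝ E]
  {H : Type*} [TopologicalSpace H] {I : ModelWithCorners ℝ E H}
  {N : Type*} [TopologicalSpace N] [ChartedSpace H N]
  {E' : Type*} [NormedAddCommGroup E'] [NormedSpace ℝ E']
  {H' : Type*} [TopologicalSpace H'] {I' : ModelWithCorners ℝ E' H'}
  {N' : Type*} [TopologicalSpace N'] [ChartedSpace H' N']

/-- A map whose image lies in a leaf is tangent to it. -/
theorem BivectorField.IsPoisson.mfderiv_mem_range [FiniteDimensional ℝ E] [I.Boundaryless]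
    [IsManifold I ∞ N] [T2Space N] [SecondCountableTopology N] [I'.Boundaryless]
    [IsManifold I' ∞ N'] {π : BivectorField I N} (hπ : π.IsPoisson) {f : N' → N}
    (hf : ContMDiff I' I ∞ f) (x : N') (hl : ∀ y, π.LeafRelOn univ (f x) (f y))
    (v : TangentSpace I' x) :
    mfderiv I' I f x v ∈ LinearMap.range (π.sharp (f x)) := by
  obtain ⟨c, rfl, hc, hv⟩ := exists_hasVelocityWithinAt x v
  refine hπ.velocity_mem_of_leafRelOn (c := fun t => f (c t))
    ((hv v rfl).comp (hf.mdifferentiableAt (by simp))) ?_ fun t => hl (c t)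
  filter_upwards [hc] with t ht
  exact hf.continuous.continuousAt.comp ht

theorem finrank_submodule_prod [FiniteDimensional ℝ E] [FiniteDimensional ℝ E']
    (A : Submodule ℝ E) (B : Submodule ℝ E') :
    Module.finrank ℝ (A.prod B) = Module.finrank ℝ A + Module.finrank ℝ B := by
  rw [← Module.finrank_prod]
  exact LinearEquiv.finrank_eq
    { toFun := fun z => (⟨z.1.1, z.2.1⟩, ⟨z.1.2, z.2.2⟩)
      invFun := fun z => ⟨(z.1.1, z.2.1), z.1.2, z.2.2⟩
      map_add' := fun _ _ => rfl
      map_smul' := fun _ _ => rfl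
      left_inv := fun _ => rfl
      right_inv := fun _ => rfl }

namespace BivectorField

variable {π : BivectorField I N} {π' : BivectorField I' N'}

theorem range_prod (z : N × N') : LinearMap.range ((π.prod π').sharp z) =
    ((LinearMap.range (π.sharp z.1)).prod (LinearMap.range (π'.sharp z.2)) :
      Submodule ℝ (TangentSpace I z.1 × TangentSpace I' z.2)) := by
  ext v
  constructor
  · rintro ⟨α, rfl⟩
    exact ⟨⟨_, rfl⟩, ⟨_, rfl⟩⟩
  · obtain ⟨v₁, v₂⟩ := v
    rintro ⟨⟨α, hα⟩, ⟨β, hβ⟩⟩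
    have key : ∀ (α : E →L[ℝ] ℝ) (β : E' →L[ℝ] ℝ),
        (α.coprod β).comp (ContinuousLinearMap.inl ℝ E E') = α ∧
        (α.coprod β).comp (ContinuousLinearMap.inr ℝ E E') = β := fun α β => by
      constructor <;> ext <;> simp
    refine ⟨ContinuousLinearMap.coprod (M₁ := E) (M₂ := E') α β, Prod.ext ?_ ?_⟩
    · refine Eq.trans ?_ hα
      exact congrArg (π.sharp z.1) (key α β).1
    · refine Eq.trans ?_ hβ
      exact congrArg (π'.sharp z.2) (key α β).2

variable [FiniteDimensional ℝ E] [I.Boundaryless] [IsManifold I ∞ N] [T2Space N]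
  [FiniteDimensional ℝ E'] [I'.Boundaryless] [IsManifold I' ∞ N'] [T2Space N']

theorem rank_prod (z : N × N') : (π.prod π').rank z = π.rank z.1 + π'.rank z.2 := by
  unfold rank
  rw [range_prod]
  exact finrank_submodule_prod (E := E) (E' := E') _ _

theorem IsTangentCurve.fst {γ : ℝ → N × N'} {a b : ℝ} (h : (π.prod π').IsTangentCurve γ a b) :
    π.IsTangentCurve (fun t => (γ t).1) a b := by
  intro t ht
  obtain ⟨v, hv, hd⟩ := h t ht
  rw [range_prod] at hv
  have h1 := hd.comp (f := Prod.fst) (I' := I) mdifferentiableAt_fst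
  rw [mfderiv_fst] at h1
  exact ⟨_, hv.1, h1⟩

theorem IsTangentCurve.snd {γ : ℝ → N × N'} {a b : ℝ} (h : (π.prod π').IsTangentCurve γ a b) :
    π'.IsTangentCurve (fun t => (γ t).2) a b := by
  intro t ht
  obtain ⟨v, hv, hd⟩ := h t ht
  rw [range_prod] at hv
  have h1 := hd.comp (f := Prod.snd) (I' := I') mdifferentiableAt_snd
  rw [mfderiv_snd] at h1
  exact ⟨_, hv.2, h1⟩

theorem IsTangentCurve.const (x : N) (a b : ℝ) : π.IsTangentCurve (fun _ => x) a b := fun t _ =>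
  ⟨0, Submodule.zero_mem _, hasVelocityWithinAt_const x _ t⟩

theorem IsTangentCurve.prodMk {γ : ℝ → N} {γ' : ℝ → N'} {a b : ℝ} (h : π.IsTangentCurve γ a b)
    (h' : π'.IsTangentCurve γ' a b) :
    (π.prod π').IsTangentCurve (fun t => (γ t, γ' t)) a b := by
  intro t ht
  obtain ⟨v, hv, hd⟩ := h t ht
  obtain ⟨v', hv', hd'⟩ := h' t ht
  refine ⟨(v, v'), ?_, hd.prodMk hd'⟩
  rw [range_prod]
  exact ⟨hv, hv'⟩

/-- Both ranks are lower semicontinuous and their sum is constant, so neither can jump. -/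
theorem IsPoisson.rank_fst_eq (hπ : π.IsPoisson) (hπ' : π'.IsPoisson) {γ : ℝ → N × N'}
    {a b : ℝ} (h : ContinuousOn γ (Icc a b))
    (hr : ∀ t ∈ Icc a b, (π.prod π').rank (γ t) = (π.prod π').rank (γ a)) :
    ∀ t ∈ Icc a b, π.rank (γ t).1 = π.rank (γ a).1 := by
  refine eq_left_of_eventually_eq fun t ht => ?_
  have h1 := (continuous_fst.continuousAt.comp_continuousWithinAt (h t ht)).eventually
    (hπ.eventually_rank_ge (γ t).1)
  have h2 := (continuous_snd.continuousAt.comp_continuousWithinAt (h t ht)).eventually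
    (hπ'.eventually_rank_ge (γ t).2)
  filter_upwards [h1, h2, self_mem_nhdsWithin] with s h1 h2 hs
  have h3 := (hr s hs).trans (hr t ht).symm
  rw [rank_prod, rank_prod] at h3
  dsimp only [Function.comp_apply] at h1 h2
  omega

/-- The leaves of a product are the products of leaves. -/
theorem IsPoisson.leafRelOn_prod_iff (hπ : π.IsPoisson) (hπ' : π'.IsPoisson) {z w : N × N'} :
    (π.prod π').LeafRelOn univ z w ↔
      π.LeafRelOn univ z.1 w.1 ∧ π'.LeafRelOn univ z.2 w.2 := by
  have hpp := hπ.prod hπ'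
  constructor
  · intro h
    refine hpp.leafRelOn_induction isOpen_univ
      ((π.leafSetoidOn univ).prod (π'.leafSetoidOn univ)) (fun γ hγ _ hr => ?_) h
    have hr1 := hπ.rank_fst_eq hπ' hγ.continuousOn hr
    have hr2 : ∀ t ∈ Icc (0 : ℝ) 1, π'.rank (γ t).2 = π'.rank (γ 0).2 := fun t ht => by
      have h3 := hr t ht
      rw [rank_prod, rank_prod, hr1 t ht] at h3
      omega
    exact ⟨hπ.leafRelOn_of_isTangentCurve isOpen_univ zero_le_one hγ.fst
        fun t ht => ⟨mem_univ _, hr1 t ht⟩,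
      hπ'.leafRelOn_of_isTangentCurve isOpen_univ zero_le_one hγ.snd
        fun t ht => ⟨mem_univ _, hr2 t ht⟩⟩
  · rintro ⟨h1, h2⟩
    have key1 : (π.prod π').LeafRelOn univ (z.1, z.2) (w.1, z.2) :=
      hπ.leafRelOn_induction isOpen_univ
        (((π.prod π').leafSetoidOn univ).comap fun x => (x, z.2)) (fun γ hγ _ hr =>
          hpp.leafRelOn_of_isTangentCurve isOpen_univ zero_le_one (hγ.prodMk (.const z.2 0 1))
            (k := π.rank (γ 0) + π'.rank z.2)
            fun t ht => ⟨mem_univ _, by rw [rank_prod, hr t ht]⟩) h1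
    have key2 : (π.prod π').LeafRelOn univ (w.1, z.2) (w.1, w.2) :=
      hπ'.leafRelOn_induction isOpen_univ
        (((π.prod π').leafSetoidOn univ).comap fun x => (w.1, x)) (fun γ hγ _ hr =>
          hpp.leafRelOn_of_isTangentCurve isOpen_univ zero_le_one
            ((IsTangentCurve.const w.1 0 1).prodMk hγ)
            (k := π.rank w.1 + π'.rank (γ 0))
            fun t ht => ⟨mem_univ _, by rw [rank_prod, hr t ht]⟩) h2
    exact key1.trans _ _ _ key2

theorem IsPoisson.isOpenQuotientMap_mk (hπ : π.IsPoisson) :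
    IsOpenQuotientMap (fun x => (Quotient.mk π.leafSetoid x : π.LeafSpace)) where
  surjective := Quotient.mk_surjective
  continuous := continuous_quotient_mk'
  isOpenMap := hπ.isOpenMap_mk

end BivectorField

theorem nonempty_homeomorph_of_quotientMaps {Z A B : Type*} [TopologicalSpace Z]
    [TopologicalSpace A] [TopologicalSpace B] {f : Z → A} {g : Z → B}
    (hf : Topology.IsQuotientMap f) (hg : Topology.IsQuotientMap g)
    (h : ∀ z w, f z = f w ↔ g z = g w) : Nonempty (A ≃ₜ B) := by
  let F : C(Z, A) := ⟨f, hf.continuous⟩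
  let G : C(Z, B) := ⟨g, hg.continuous⟩
  have hk : Setoid.ker F = Setoid.ker G := Setoid.ext h
  have h1 : Quotient (Setoid.ker F) ≃ₜ A := Topology.IsQuotientMap.homeomorph (f := F) hf
  have h2 : Quotient (Setoid.ker G) ≃ₜ B := Topology.IsQuotientMap.homeomorph (f := G) hg
  rw [hk] at h1
  exact ⟨h1.symm.trans h2⟩

end Products
end

noncomputable section

set_option maxSynthPendingDepth 3
set_option linter.unusedSectionVars false

/-! ### The smooth structure of the associated bundle. -/

section Associated

open Filter BivectorField

variable {EP : Type*} [NormedAddCommGroup EP] [NormedSpace ℝ EP]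
  {HP : Type*} [TopologicalSpace HP] {IP : ModelWithCorners ℝ EP HP}
  {P : Type*} [TopologicalSpace P] [ChartedSpace HP P]
  {EM : Type*} [NormedAddCommGroup EM] [NormedSpace ℝ EM]
  {HM : Type*} [TopologicalSpace HM] {IM : ModelWithCorners ℝ EM HM}
  {M : Type*} [TopologicalSpace M] [ChartedSpace HM M]
  {EX : Type*} [NormedAddCommGroup EX] [NormedSpace ℝ EX]
  {HX : Type*} [TopologicalSpace HX] {IX : ModelWithCorners ℝ EX HX}
  {X : Type*} [TopologicalSpace X] [ChartedSpace HX X]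
  {EG : Type*} [NormedAddCommGroup EG] [NormedSpace ℝ EG]
  {HG : Type*} [TopologicalSpace HG] {IG : ModelWithCorners ℝ EG HG}
  {G : Type*} [TopologicalSpace G] [ChartedSpace HG G] [Group G]
  [MulAction Gᵐᵒᵖ P] [MulAction G X] {p : P → M}

namespace AssociatedBundle

section

variable (h : IsPrincipalBundle IP IM IG G p) [ContinuousSMul G X]

theorem mk_surjective : Function.Surjective (mk h : P × X → AssociatedBundle X h) :=
  Quotient.mk_surjective

theorem triv_mk (m : M) {z : P × X} (hz : p z.1 ∈ (principalTriv h m).baseSet) :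
    triv X h m (mk h z) = (p z.1, (principalTriv h m z.1).2 • z.2) :=
  trivFun_mk h _ (principalTriv_act h m) z ((principalTriv h m).mem_source.2 hz)

theorem mk_mem_triv_source (m : M) {z : P × X} :
    mk h z ∈ (triv X h m).source ↔ p z.1 ∈ (principalTriv h m).baseSet := Iff.rfl

/-- Points over different base points are separated in `M`; points of one fibre are separated in a
trivialization. -/
instance [T2Space M] [T2Space X] : T2Space (AssociatedBundle X h) := by
  refine ⟨fun a b hab => ?_⟩
  by_cases hp : proj X h a = proj X h b
  · set e := triv X h (proj X h a) with he
    have ha : a ∈ e.source := e.mem_source.2 (principalTriv_mem h _)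
    have hb : b ∈ e.source := e.mem_source.2 (hp ▸ principalTriv_mem h _)
    have hne : e a ≠ e b := fun hh => hab (e.injOn ha hb hh)
    obtain ⟨u, v, hu, hv, hau, hbv, huv⟩ := t2_separation hne
    refine ⟨e.source ∩ e ⁻¹' u, e.source ∩ e ⁻¹' v,
      e.continuousOn_toFun.isOpen_inter_preimage e.open_source hu,
      e.continuousOn_toFun.isOpen_inter_preimage e.open_source hv, ⟨ha, hau⟩, ⟨hb, hbv⟩, ?_⟩
    exact (huv.preimage e).mono inter_subset_right inter_subset_right
  · obtain ⟨u, v, hu, hv, hau, hbv, huv⟩ := t2_separation hp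
    exact ⟨_, _, hu.preimage (continuous_proj h), hv.preimage (continuous_proj h), hau, hbv,
      huv.preimage _⟩

variable [IsManifold IM ∞ M] [IsManifold IX ∞ X] [ContMDiffSMul IG IX ∞ G X]

/-- The chart of `Σ` at `a` is by definition this trivialization followed by a chart of `M × X`;
composing with the inverse of the latter recovers the trivialization. -/
theorem contMDiffAt_triv_self (a : AssociatedBundle X h) :
    ContMDiffAt (IM.prod IX) (IM.prod IX) ∞ (triv X h (proj X h a)) a := by
  set e := triv X h (proj X h a) with he
  have ha : a ∈ e.source := e.mem_source.2 (principalTriv_mem h _)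
  have hs : a ∈ (chartAt (ModelProd HM HX) a).source := mem_chart_source _ a
  have h1 : ContMDiffAt (IM.prod IX) (IM.prod IX) ∞ (chartAt (ModelProd HM HX) a) a :=
    contMDiffOn_chart.contMDiffAt ((chartAt (ModelProd HM HX) a).open_source.mem_nhds hs)
  have ht : chartAt (ModelProd HM HX) a a ∈ (chartAt (ModelProd HM HX) (e a)).target :=
    (chartAt (ModelProd HM HX) (e a)).map_source (mem_chart_source _ (e a))
  have h2 : ContMDiffAt (IM.prod IX) (IM.prod IX) ∞ (chartAt (ModelProd HM HX) (e a)).symm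
      (chartAt (ModelProd HM HX) a a) :=
    contMDiffOn_chart_symm.contMDiffAt
      ((chartAt (ModelProd HM HX) (e a)).open_target.mem_nhds ht)
  refine (h2.comp a h1).congr_of_eventuallyEq ?_
  filter_upwards [(chartAt (ModelProd HM HX) a).open_source.mem_nhds hs] with b hb
  have hb' : e b ∈ (chartAt (ModelProd HM HX) (e a)).source := hb.2
  exact ((chartAt (ModelProd HM HX) (e a)).left_inv hb').symm

theorem contMDiffAt_triv_self_symm (a : AssociatedBundle X h) :
    ContMDiffAt (IM.prod IX) (IM.prod IX) ∞ (triv X h (proj X h a)).toOpenPartialHomeomorph.symm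
      (triv X h (proj X h a) a) := by
  set e := triv X h (proj X h a) with he
  have ha : a ∈ e.source := e.mem_source.2 (principalTriv_mem h _)
  have hs := mem_chart_source (ModelProd HM HX) (e a)
  have h1 : ContMDiffAt (IM.prod IX) (IM.prod IX) ∞ (chartAt (ModelProd HM HX) (e a)) (e a) :=
    contMDiffOn_chart.contMDiffAt ((chartAt (ModelProd HM HX) (e a)).open_source.mem_nhds hs)
  have ht : chartAt (ModelProd HM HX) (e a) (e a) ∈ (chartAt (ModelProd HM HX) a).target :=
    (chartAt (ModelProd HM HX) a).map_source (mem_chart_source _ a)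
  have h2 : ContMDiffAt (IM.prod IX) (IM.prod IX) ∞ (chartAt (ModelProd HM HX) a).symm
      (chartAt (ModelProd HM HX) (e a) (e a)) :=
    contMDiffOn_chart_symm.contMDiffAt ((chartAt (ModelProd HM HX) a).open_target.mem_nhds ht)
  refine (h2.comp (e a) h1).congr_of_eventuallyEq ?_
  filter_upwards [(chartAt (ModelProd HM HX) (e a)).open_source.mem_nhds hs] with b hb
  exact congrArg e.toOpenPartialHomeomorph.symm
    ((chartAt (ModelProd HM HX) (e a)).left_inv hb).symm

/-- The local trivializations of an associated bundle are smooth. -/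
theorem isSmoothTrivialization_triv (m : M) :
    IsSmoothTrivialization (IM.prod IX) IM IX (triv X h m) where
  contMDiffOn a ha := ContMDiffAt.contMDiffWithinAt <| by
    set e := triv X h m with he
    set e' := triv X h (proj X h a) with he'
    have ha' : a ∈ e'.source := e'.mem_source.2 (principalTriv_mem h _)
    have hcs : e' a ∈ (e'.toOpenPartialHomeomorph.symm ≫ₕ e.toOpenPartialHomeomorph).source :=
      ⟨e'.map_source ha', by
        have h0 : e'.toOpenPartialHomeomorph.symm (e' a) = a := e'.left_inv ha'
        exact (congrArg (· ∈ e.source) h0).mpr ha⟩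
    have h1 := (contMDiffOn_coordChange (IX := IX) (X := X) h (proj X h a) m).contMDiffAt
      ((e'.toOpenPartialHomeomorph.symm ≫ₕ e.toOpenPartialHomeomorph).open_source.mem_nhds hcs)
    refine (h1.comp a (contMDiffAt_triv_self h a)).congr_of_eventuallyEq ?_
    filter_upwards [e'.open_source.mem_nhds ha'] with b hb
    exact congrArg e (e'.left_inv hb).symm
  contMDiffOn_symm w hw := ContMDiffAt.contMDiffWithinAt <| by
    set e := triv X h m with he
    set a := e.toOpenPartialHomeomorph.symm w with ha
    set e' := triv X h (proj X h a) with he'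
    have has : a ∈ e.source := e.map_target hw
    have ha' : a ∈ e'.source := e'.mem_source.2 (principalTriv_mem h _)
    have hea : e a = w := e.right_inv hw
    have hcs : w ∈ (e.toOpenPartialHomeomorph.symm ≫ₕ e'.toOpenPartialHomeomorph).source :=
      ⟨hw, ha'⟩
    have ho := (e.toOpenPartialHomeomorph.symm ≫ₕ e'.toOpenPartialHomeomorph).open_source
    have h1 := (contMDiffOn_coordChange (IX := IX) (X := X) h m (proj X h a)).contMDiffAt
      (ho.mem_nhds hcs)
    have h2 := contMDiffAt_triv_self_symm (IX := IX) h a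
    refine (ContMDiffAt.comp w h2 h1).congr_of_eventuallyEq ?_
    filter_upwards [ho.mem_nhds hcs] with b hb
    exact (e'.left_inv hb.2).symm

theorem contMDiff_mk : ContMDiff (IP.prod IX) (IM.prod IX) ∞
    (mk h : P × X → AssociatedBundle X h) := by
  intro z
  set e := principalTriv h (p z.1) with he
  have ho : IsOpen {w : P × X | p w.1 ∈ e.baseSet} :=
    e.open_baseSet.preimage (h.contMDiff_proj.continuous.comp continuous_fst)
  have hz : z ∈ {w : P × X | p w.1 ∈ e.baseSet} := principalTriv_mem h _
  have h1 : ContMDiffAt (IP.prod IX) (IM.prod IX) ∞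
      (fun w : P × X => (p w.1, (e w.1).2 • w.2)) z := by
    refine (h.contMDiff_proj.comp contMDiff_fst).contMDiffAt.prodMk ?_
    have h2 : ContMDiffAt (IP.prod IX) IG ∞ (fun w : P × X => (e w.1).2) z :=
      contMDiffAt_snd.comp z ((((principalTriv_smooth h (p z.1)).contMDiffOn.contMDiffAt
        (e.open_source.mem_nhds (e.mem_source.2 hz))).comp z contMDiffAt_fst))
    exact (contMDiff_smul (I := IG) (I' := IX) (n := ∞) (G := G) (M := X)).contMDiffAt.comp z
      (h2.prodMk contMDiffAt_snd)
  have hsm := isSmoothTrivialization_triv (IX := IX) (X := X) h (p z.1)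
  have ht : (p z.1, (e z.1).2 • z.2) ∈ (triv X h (p z.1)).target :=
    ⟨principalTriv_mem h _, mem_univ _⟩
  have h3 := hsm.contMDiffOn_symm.contMDiffAt ((triv X h (p z.1)).open_target.mem_nhds ht)
  refine (ContMDiffAt.comp z h3 h1).congr_of_eventuallyEq ?_
  filter_upwards [ho.mem_nhds hz] with w hw
  have h4 := (triv X h (p z.1)).left_inv ((mk_mem_triv_source h (p z.1)).2 hw)
  rw [Function.comp_apply, ← triv_mk h (p z.1) hw]
  exact h4.symm

/-- The quotient map onto an associated bundle has a smooth local section through each point. -/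
theorem exists_section (z : P × X) : ∃ s : AssociatedBundle X h → P × X,
    ContMDiffAt (IM.prod IX) (IP.prod IX) ∞ s (mk h z) ∧ s (mk h z) = z ∧
      ∀ᶠ a in 𝓝 (mk h z), mk h (s a) = a := by
  obtain ⟨y, x⟩ := z
  set m := p y with hm
  set e := principalTriv h m with he
  set t := triv X h m with ht
  set g := (e y).2 with hg
  have hy : p y ∈ e.baseSet := principalTriv_mem h _
  have hys : y ∈ e.source := e.mem_source.2 hy
  have ha : mk h (y, x) ∈ t.source := (mk_mem_triv_source h m).2 hy
  have hta : t (mk h (y, x)) = (p y, g • x) := triv_mk h m hy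
  have hey : (p y, g) = e y := Prod.ext (e.coe_fst hys).symm rfl
  -- The section that freezes the group coordinate at `g = e₂(y)`: a point with trivialized
  -- coordinates `(m, x')` is represented by `(e⁻¹(m, g), g⁻¹ • x')`.
  refine ⟨fun a => (e.toOpenPartialHomeomorph.symm ((t a).1, g), g⁻¹ • (t a).2), ?_, ?_, ?_⟩
  · have h1 : ContMDiffAt (IM.prod IX) (IM.prod IX) ∞ t (mk h (y, x)) :=
      (isSmoothTrivialization_triv (IX := IX) (X := X) h m).contMDiffOn.contMDiffAt
        (t.open_source.mem_nhds ha)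
    have h2 : ContMDiffAt (IM.prod IG) IP ∞ e.toOpenPartialHomeomorph.symm
        ((t (mk h (y, x))).1, g) := by
      refine (principalTriv_smooth h m).contMDiffOn_symm.contMDiffAt (e.open_target.mem_nhds ?_)
      rw [hta]
      exact e.mem_target.2 hy
    have h3 : ContMDiffAt (IM.prod IX) (IM.prod IG) ∞
        (fun a : AssociatedBundle X h => ((t a).1, g)) (mk h (y, x)) :=
      (contMDiffAt_fst.comp _ h1).prodMk contMDiffAt_const
    refine (ContMDiffAt.comp (f := fun a => ((t a).1, g)) (mk h (y, x)) h2 h3).prodMk ?_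
    exact (contMDiff_smul (I := IG) (I' := IX) (n := ∞) (G := G) (M := X)).contMDiffAt.comp _
      (contMDiffAt_const.prodMk (contMDiffAt_snd.comp _ h1))
  · dsimp only
    rw [hta, inv_smul_smul, hey]
    exact Prod.ext (e.left_inv hys) rfl
  · filter_upwards [t.open_source.mem_nhds ha] with a has
    have hb : (t a).1 ∈ e.baseSet := (t.map_source has).1
    have hb' : p (e.toOpenPartialHomeomorph.symm ((t a).1, g)) ∈ e.baseSet := by
      rwa [e.proj_symm_apply' hb]
    refine t.injOn ((mk_mem_triv_source h m).2 hb') has ?_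
    change triv X h m _ = _
    rw [triv_mk h m (z := (e.toOpenPartialHomeomorph.symm ((t a).1, g), g⁻¹ • (t a).2)) hb']
    change (p (e.toOpenPartialHomeomorph.symm ((t a).1, g)),
      (e (e.toOpenPartialHomeomorph.symm ((t a).1, g))).2 • g⁻¹ • (t a).2) = t a
    rw [e.proj_symm_apply' hb, e.apply_symm_apply' hb, smul_inv_smul]

theorem contMDiff_of_comp_mk {f : AssociatedBundle X h → ℝ}
    (hf : ContMDiff (IP.prod IX) 𝓘(ℝ, ℝ) ∞ fun z => f (mk h z)) :
    ContMDiff (IM.prod IX) 𝓘(ℝ, ℝ) ∞ f := by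
  intro a
  obtain ⟨z, rfl⟩ := mk_surjective h a
  obtain ⟨s, hs, hsz, hev⟩ := exists_section (IX := IX) h z
  refine (hf.contMDiffAt.comp _ hs).congr_of_eventuallyEq ?_
  filter_upwards [hev] with b hb
  rw [Function.comp_apply, hb]

/-- Differentiating `q ∘ s = id` for a local section `s` through `z` gives a right inverse. -/
theorem mfderiv_mk_surjective (z : P × X) :
    Function.Surjective (mfderiv (IP.prod IX) (IM.prod IX) (mk h) z) := by
  obtain ⟨s, hs, hsz, hev⟩ := exists_section (IX := IX) h z
  have h1 : HasMFDerivAt (IM.prod IX) (IM.prod IX) (fun a => mk h (s a)) (mk h z)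
      ((mfderiv (IP.prod IX) (IM.prod IX) (mk h) (s (mk h z))).comp
        (mfderiv (IM.prod IX) (IP.prod IX) s (mk h z))) :=
    HasMFDerivAt.comp (mk h z) ((contMDiff_mk h).mdifferentiableAt (by simp)).hasMFDerivAt
      (hs.mdifferentiableAt (by simp)).hasMFDerivAt
  have h2 : HasMFDerivAt (IM.prod IX) (IM.prod IX) (fun a => mk h (s a)) (mk h z)
      (ContinuousLinearMap.id ℝ (TangentSpace (IM.prod IX) (mk h z))) :=
    (hasMFDerivAt_id (mk h z)).congr_of_eventuallyEq hev
  have h3 := hasMFDerivAt_unique h1 h2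
  intro v
  have key : ∀ (w : P × X) (u : EP × EX), w = z →
      (show EM × EX from mfderiv (IP.prod IX) (IM.prod IX) (mk h) w u) = v →
      ∃ u, mfderiv (IP.prod IX) (IM.prod IX) (mk h) z u = v := by
    rintro w u rfl hu
    exact ⟨u, hu⟩
  exact key _ _ hsz (DFunLike.congr_fun h3 v)

end

end AssociatedBundle
end Associated
end

noncomputable section

set_option maxSynthPendingDepth 3
set_option linter.unusedSectionVars false

/-! ### Descent of Poisson structures along quotient maps. -/

section Descent

variable {E : Type*} [NormedAddCommGroup E] [NormedSpace ℝ E]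
  {H : Type*} [TopologicalSpace H] {I : ModelWithCorners ℝ E H}
  {N : Type*} [TopologicalSpace N] [ChartedSpace H N]
  {E' : Type*} [NormedAddCommGroup E'] [NormedSpace ℝ E']
  {H' : Type*} [TopologicalSpace H'] {I' : ModelWithCorners ℝ E' H'}
  {N' : Type*} [TopologicalSpace N'] [ChartedSpace H' N']

namespace BivectorField

variable {π : BivectorField I N} {π' : BivectorField I' N'}

theorem IsPoissonMap.bracket_comp {q : N → N'} (hq : π.IsPoissonMap π' q) {f g : N' → ℝ}
    (hf : ContMDiff I' 𝓘(ℝ, ℝ) ∞ f) (hg : ContMDiff I' 𝓘(ℝ, ℝ) ∞ g) (x : N) :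
    π.bracket (f ∘ q) (g ∘ q) x = π'.bracket f g (q x) := by
  have hqd : MDifferentiableAt I I' q x := hq.contMDiff.mdifferentiableAt (by simp)
  rw [bracket, hamiltonian, bracket, hamiltonian,
    mvfderiv_comp x (hf.mdifferentiableAt (by simp)) hqd,
    mvfderiv_comp x (hg.mdifferentiableAt (by simp)) hqd, ← hq.map_sharp]
  rfl

/-- A Poisson structure descends along a Poisson map onto which smooth functions descend. -/
theorem IsPoisson.of_isPoissonMap (hπ : π.IsPoisson) {q : N → N'} (hq : π.IsPoissonMap π' q)
    (hs : Function.Surjective q)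
    (hd : ∀ f : N' → ℝ, ContMDiff I 𝓘(ℝ, ℝ) ∞ (f ∘ q) → ContMDiff I' 𝓘(ℝ, ℝ) ∞ f) :
    π'.IsPoisson := by
  have hbr : ∀ {f g : N' → ℝ}, ContMDiff I' 𝓘(ℝ, ℝ) ∞ f → ContMDiff I' 𝓘(ℝ, ℝ) ∞ g →
      π'.bracket f g ∘ q = π.bracket (f ∘ q) (g ∘ q) := fun hf hg =>
    funext fun x => (hq.bracket_comp hf hg x).symm
  have hsm : ∀ f g : N' → ℝ, ContMDiff I' 𝓘(ℝ, ℝ) ∞ f → ContMDiff I' 𝓘(ℝ, ℝ) ∞ g →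
      ContMDiff I' 𝓘(ℝ, ℝ) ∞ (π'.bracket f g) := fun f g hf hg => hd _ <| by
    rw [hbr hf hg]
    exact hπ.smooth _ _ (hf.comp hq.contMDiff) (hg.comp hq.contMDiff)
  refine ⟨hsm, fun f g k hf hg hk y => ?_⟩
  obtain ⟨x, rfl⟩ := hs y
  rw [← hq.bracket_comp hf (hsm _ _ hg hk), ← hq.bracket_comp hg (hsm _ _ hk hf),
    ← hq.bracket_comp hk (hsm _ _ hf hg), hbr hg hk, hbr hk hf, hbr hf hg]
  exact hπ.jacobi _ _ _ (hf.comp hq.contMDiff) (hg.comp hq.contMDiff) (hk.comp hq.contMDiff) x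

/-- The bivector field obtained by pushing forward `π` along `q`, at the points of a section `s` of
`q`. -/
def descend (I' : ModelWithCorners ℝ E' H') (π : BivectorField I N) (q : N → N') (s : N' → N) :
    BivectorField I' N' where
  sharp y :=
    { toFun := fun α => mfderiv I I' q (s y)
        (π.sharp (s y) (ContinuousLinearMap.comp (show E' →L[ℝ] ℝ from α)
          (mfderiv I I' q (s y))))
      map_add' := fun α β => by
        have h1 : ContinuousLinearMap.comp (show E' →L[ℝ] ℝ from α + β) (mfderiv I I' q (s y)) =
          ContinuousLinearMap.comp (show E' →L[ℝ] ℝ from α) (mfderiv I I' q (s y)) +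
          ContinuousLinearMap.comp (show E' →L[ℝ] ℝ from β) (mfderiv I I' q (s y)) := rfl
        rw [h1, map_add]
        exact map_add (mfderiv I I' q (s y)) _ _
      map_smul' := fun c α => by
        have h1 : ContinuousLinearMap.comp (show E' →L[ℝ] ℝ from c • α) (mfderiv I I' q (s y)) =
          c • ContinuousLinearMap.comp (show E' →L[ℝ] ℝ from α) (mfderiv I I' q (s y)) := rfl
        rw [h1, map_smul]
        exact map_smul (mfderiv I I' q (s y)) _ _ }
  skew y α β := π.skew (s y) (ContinuousLinearMap.comp (show E' →L[ℝ] ℝ from α)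
      (mfderiv I I' q (s y))) (ContinuousLinearMap.comp (show E' →L[ℝ] ℝ from β)
      (mfderiv I I' q (s y)))

/-- The image of `π` under `dq` is the same at every point of a fibre: a Poisson map `φ` over the
identity carries `x` to the chosen point, and `dq = dq ∘ dφ`. -/
theorem isPoissonMap_descend {q : N → N'} (hq : ContMDiff I I' ∞ q) {s : N' → N}
    (hφ : ∀ x, ∃ φ : N → N, π.IsPoissonMap π φ ∧ φ x = s (q x) ∧ ∀ z, q (φ z) = q z) :
    π.IsPoissonMap (descend I' π q s) q := by
  refine ⟨hq, fun x α => ?_⟩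
  obtain ⟨φ, hφ, hx, hqφ⟩ := hφ x
  have key : ∀ x', φ x = x' →
      (show E' from mfderiv I I' q x (π.sharp x (α.comp (mfderiv I I' q x)))) =
      mfderiv I I' q x' (π.sharp x' (ContinuousLinearMap.comp (show E' →L[ℝ] ℝ from α)
          (mfderiv I I' q x'))) := by
    rintro _ rfl
    have h1 : HasMFDerivAt I I' (fun z => q (φ z)) x
        ((mfderiv I I' q (φ x)).comp (mfderiv I I φ x)) :=
      HasMFDerivAt.comp x (hq.mdifferentiableAt (by simp)).hasMFDerivAt
        (hφ.contMDiff.mdifferentiableAt (by simp)).hasMFDerivAt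
    have h2 : HasMFDerivAt I I' (fun z => q (φ z)) x (mfderiv I I' q x) :=
      (hq.mdifferentiableAt (by simp)).hasMFDerivAt.congr_of_eventuallyEq
        (Filter.Eventually.of_forall hqφ)
    have h3 : (show E →L[ℝ] E' from mfderiv I I' q x) =
        (mfderiv I I' q (φ x)).comp (mfderiv I I φ x) := hasMFDerivAt_unique h2 h1
    have h4 := hφ.map_sharp x (ContinuousLinearMap.comp (show E' →L[ℝ] ℝ from α)
          (mfderiv I I' q (φ x)))
    refine Eq.trans ?_ (congrArg (mfderiv I I' q (φ x)) h4)
    change (show E →L[ℝ] E' from mfderiv I I' q x) (π.sharp x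
      ((show E' →L[ℝ] ℝ from α).comp (show E →L[ℝ] E' from mfderiv I I' q x))) = _
    rw [h3]
    rfl
  exact key _ hx

variable {E₁ : Type*} [NormedAddCommGroup E₁] [NormedSpace ℝ E₁]
  {H₁ : Type*} [TopologicalSpace H₁] {I₁ : ModelWithCorners ℝ E₁ H₁}
  {N₁ : Type*} [TopologicalSpace N₁] [ChartedSpace H₁ N₁]
  {E₁' : Type*} [NormedAddCommGroup E₁'] [NormedSpace ℝ E₁']
  {H₁' : Type*} [TopologicalSpace H₁'] {I₁' : ModelWithCorners ℝ E₁' H₁'}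
  {N₁' : Type*} [TopologicalSpace N₁'] [ChartedSpace H₁' N₁']
  {π₁ : BivectorField I₁ N₁} {π₁' : BivectorField I₁' N₁'}

theorem IsPoissonMap.prodMap {f : N → N₁} {g : N' → N₁'} (hf : π.IsPoissonMap π₁ f)
    (hg : π'.IsPoissonMap π₁' g) :
    (π.prod π').IsPoissonMap (π₁.prod π₁') (Prod.map f g) := by
  refine ⟨hf.contMDiff.prodMap hg.contMDiff, fun z α => ?_⟩
  have h1 := mfderiv_prodMap (p := z) (hf.contMDiff.mdifferentiableAt (x := z.1) (by simp))
    (hg.contMDiff.mdifferentiableAt (x := z.2) (by simp))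
  rw [h1]
  have h2 := hf.map_sharp z.1
    ((show E₁ × E₁' →L[ℝ] ℝ from α).comp (ContinuousLinearMap.inl ℝ E₁ E₁'))
  have h3 := hg.map_sharp z.2
    ((show E₁ × E₁' →L[ℝ] ℝ from α).comp (ContinuousLinearMap.inr ℝ E₁ E₁'))
  refine Prod.ext (Eq.trans ?_ h2) (Eq.trans ?_ h3)
  · refine congrArg (fun β => mfderiv I I₁ f z.1 (π.sharp z.1 β))
      (ContinuousLinearMap.ext fun u => ?_)
    refine congrArg α (Prod.ext rfl ?_)
    exact map_zero (mfderiv I' I₁' g z.2)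
  · refine congrArg (fun β => mfderiv I' I₁' g z.2 (π'.sharp z.2 β))
      (ContinuousLinearMap.ext fun u => ?_)
    refine congrArg α (Prod.ext ?_ rfl)
    exact map_zero (mfderiv I I₁ f z.1)

theorem IsPoissonMap.eq {π'' : BivectorField I' N'} {q : N → N'} (h : π.IsPoissonMap π' q)
    (h' : π.IsPoissonMap π'' q) (hs : Function.Surjective q) : π' = π'' := by
  ext y α
  obtain ⟨x, rfl⟩ := hs y
  rw [← h.map_sharp, ← h'.map_sharp]

end BivectorField
end Descent

/-! ### The Poisson structure of the associated bundle. -/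

section AssociatedPoisson

open BivectorField

variable {EP : Type*} [NormedAddCommGroup EP] [NormedSpace ℝ EP]
  {HP : Type*} [TopologicalSpace HP] {IP : ModelWithCorners ℝ EP HP}
  {P : Type*} [TopologicalSpace P] [ChartedSpace HP P]
  {EM : Type*} [NormedAddCommGroup EM] [NormedSpace ℝ EM]
  {HM : Type*} [TopologicalSpace HM] {IM : ModelWithCorners ℝ EM HM}
  {M : Type*} [TopologicalSpace M] [ChartedSpace HM M]
  {EX : Type*} [NormedAddCommGroup EX] [NormedSpace ℝ EX]
  {HX : Type*} [TopologicalSpace HX] {IX : ModelWithCorners ℝ EX HX}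
  {X : Type*} [TopologicalSpace X] [ChartedSpace HX X]
  {EG : Type*} [NormedAddCommGroup EG] [NormedSpace ℝ EG]
  {HG : Type*} [TopologicalSpace HG] {IG : ModelWithCorners ℝ EG HG}
  {G : Type*} [TopologicalSpace G] [ChartedSpace HG G] [Group G]
  [MulAction Gᵐᵒᵖ P] [MulAction G X] {p : P → M}
  (h : IsPrincipalBundle IP IM IG G p) [ContinuousSMul G X]
  [IsManifold IM ∞ M] [IsManifold IX ∞ X] [ContMDiffSMul IG IX ∞ G X]

/-- The Poisson structure of an associated bundle. -/
theorem AssociatedBundle.existsUnique_poisson {πP : BivectorField IP P} {πX : BivectorField IX X}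
    (hP : (πP.prod πX).IsPoisson) (hinv : πP.IsRightInvariant G) (hact : πX.IsLeftInvariant G) :
    ∃! πS : BivectorField (IM.prod IX) (AssociatedBundle X h),
      πS.IsPoisson ∧ (πP.prod πX).IsPoissonSubmersion πS (mk h) := by
  have hmap : (πP.prod πX).IsPoissonMap (descend (IM.prod IX) (πP.prod πX) (mk h)
      (Quotient.out (s := associatedSetoid P X G))) (mk h) := by
    refine isPoissonMap_descend (contMDiff_mk h) fun z => ?_
    obtain ⟨g, hg⟩ := (associatedSetoid P X G).symm
      (Quotient.mk_out (s := associatedSetoid P X G) z)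
    refine ⟨Prod.map (fun y => y <• g⁻¹) (fun x => g • x), (hinv g⁻¹).prodMap (hact g), hg.symm,
      fun w => ?_⟩
    change mk h (w.1 <• g⁻¹, g • w.2) = mk h w
    rw [mk_act, inv_smul_smul]
  refine ⟨_, ⟨hP.of_isPoissonMap hmap (mk_surjective h) fun f hf => contMDiff_of_comp_mk h hf,
    hmap, mk_surjective h, mfderiv_mk_surjective h⟩, fun π hπ => ?_⟩
  exact hπ.2.toIsPoissonMap.eq hmap (mk_surjective h)

end AssociatedPoisson
end

noncomputable section

set_option maxSynthPendingDepth 3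
set_option linter.unusedSectionVars false

/-! ### Linear algebra of the characteristic distribution. -/

section LinearAlgebra

variable {V : Type*} [NormedAddCommGroup V] [NormedSpace ℝ V]
  {VM : Type*} [NormedAddCommGroup VM] [NormedSpace ℝ VM] [FiniteDimensional ℝ VM]
  {VX : Type*} [NormedAddCommGroup VX] [NormedSpace ℝ VX]
  {VG : Type*} [NormedAddCommGroup VG] [NormedSpace ℝ VG]

/-- The range of a skew map is the annihilator of its kernel. -/
theorem mem_range_of_skew {π : (VM →L[ℝ] ℝ) →ₗ[ℝ] VM}
    (hπ : ∀ α β : VM →L[ℝ] ℝ, β (π α) = -α (π β)) {v : VM}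
    (hv : ∀ α : VM →L[ℝ] ℝ, π α = 0 → α v = 0) : v ∈ LinearMap.range π := by
  by_contra hne
  obtain ⟨f, hf, hle⟩ := Submodule.exists_le_ker_of_notMem hne
  let α : VM →L[ℝ] ℝ := LinearMap.toContinuousLinearMap f
  refine hf (hv α (ext_dual fun β => ?_))
  have h1 : α (π β) = 0 := hle ⟨β, rfl⟩
  rw [hπ, h1, neg_zero, map_zero]

variable {πP : (V →L[ℝ] ℝ) →ₗ[ℝ] V} {πM : (VM →L[ℝ] ℝ) →ₗ[ℝ] VM} {πX : (VX →L[ℝ] ℝ) →ₗ[ℝ] VX}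
  {p : V →L[ℝ] VM} {ε : V →L[ℝ] VG} {ρ : VG →L[ℝ] VX}

/-- The images of Hamiltonian vectors under a coregular Poisson submersion are Hamiltonian. -/
theorem map_mem_range_of_coregular (hP : ∀ α β : V →L[ℝ] ℝ, β (πP α) = -α (πP β))
    (hM : ∀ α β : VM →L[ℝ] ℝ, β (πM α) = -α (πM β)) (h : ∀ α : VM →L[ℝ] ℝ, p (πP (α.comp p)) = πM α)
    (hd : ∀ α : VM →L[ℝ] ℝ, p (πP (α.comp p)) = 0 → πP (α.comp p) = 0) (ξ : V →L[ℝ] ℝ) :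
    p (πP ξ) ∈ LinearMap.range πM := by
  -- If `α` is in the kernel of `πM`, then `p (πP (α ∘ p)) = 0`, so coregularity gives `πP (α ∘ p) =
  -- 0`; by skewness `α` annihilates `p (πP ξ)`.
  refine mem_range_of_skew hM fun α hα => ?_
  have h1 := hP ξ (α.comp p)
  rw [hd α ((h α).trans hα), map_zero, neg_zero] at h1
  exact h1

/-- The inclusion from left to right needs only coregularity and tangency of the action. For the
converse the difficulty is that `ν` enters twice, through `πX ν` and through the covector fed to
`πP`; correcting one entry disturbs the other. Each of the two alternatives breaks this circle. -/
theorem range_associated_iff (hP : ∀ α β : V →L[ℝ] ℝ, β (πP α) = -α (πP β))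
    (hM : ∀ α β : VM →L[ℝ] ℝ, β (πM α) = -α (πM β))
    (h : ∀ α : VM →L[ℝ] ℝ, p (πP (α.comp p)) = πM α)
    (hd : ∀ α : VM →L[ℝ] ℝ, p (πP (α.comp p)) = 0 → πP (α.comp p) = 0)
    (hρ : ∀ v, ρ v ∈ LinearMap.range πX)
    (hab : (∀ ξ : V →L[ℝ] ℝ, p (πP ξ) = 0 → πP ξ = 0) ∨
      ∀ α β : VX →L[ℝ] ℝ, (∃ v, ρ v = πX α) → (∃ w, ρ w = πX β) → β (πX α) = 0) (a : VM) (b : VX) :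
    (∃ (μ : VM →L[ℝ] ℝ) (ν : VX →L[ℝ] ℝ),
      p (πP (μ.comp p + ν.comp (ρ.comp ε))) = a ∧
      ρ (ε (πP (μ.comp p + ν.comp (ρ.comp ε)))) + πX ν = b) ↔
    a ∈ LinearMap.range πM ∧ b ∈ LinearMap.range πX := by
  have hr := map_mem_range_of_coregular hP hM h hd
  -- Whatever `ζ` is, its contribution to the first entry lies in the range of `πM` and can be
  -- absorbed by `μ`.
  have hμ : ∀ (μ₁ : VM →L[ℝ] ℝ) (ζ : V →L[ℝ] ℝ), ∃ μ : VM →L[ℝ] ℝ,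
      p (πP (μ.comp p + ζ)) = πM μ₁ := by
    intro μ₁ ζ
    obtain ⟨μ', hμ'⟩ := hr ζ
    refine ⟨μ₁ - μ', ?_⟩
    rw [map_add, map_add, h, map_sub, hμ', sub_add_cancel]
  constructor
  · rintro ⟨μ, ν, rfl, rfl⟩
    exact ⟨hr _, Submodule.add_mem _ (hρ _) ⟨ν, rfl⟩⟩
  · rintro ⟨⟨μ₁, rfl⟩, ⟨β, rfl⟩⟩
    rcases hab with hab | hab
    -- Alternative a): `πP ξ` is determined by `p (πP ξ)`. So the vertical term is already known
    -- from `μ₁`, before `ν` is chosen, and `ν = β - κ` corrects it.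
    · obtain ⟨κ, hκ⟩ := hρ (ε (πP (μ₁.comp p)))
      obtain ⟨μ, hμ⟩ := hμ μ₁ ((β - κ).comp (ρ.comp ε))
      refine ⟨μ, β - κ, hμ, ?_⟩
      have h1 := hab (μ.comp p + (β - κ).comp (ρ.comp ε) - μ₁.comp p) (by
        rw [map_sub, map_sub, hμ, h, sub_self])
      rw [map_sub, sub_eq_zero] at h1
      rw [h1, ← hκ, map_sub, add_sub_cancel]
    -- Alternative b): the correction `κ` represents a vector tangent to the orbit, so by isotropy
    -- `κ ∘ ρ ∘ ε = 0`, and replacing `ν = β` by `β - κ` leaves the covector fed to `πP` unchanged.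
    · obtain ⟨μ, hμ⟩ := hμ μ₁ (β.comp (ρ.comp ε))
      obtain ⟨κ, hκ⟩ := hρ (ε (πP (μ.comp p + β.comp (ρ.comp ε))))
      have h1 : κ.comp (ρ.comp ε) = 0 := by
        ext u
        obtain ⟨l, hl⟩ := hρ (ε u)
        have h2 := hab l κ ⟨_, hl.symm⟩ ⟨_, hκ.symm⟩
        rw [hl] at h2
        exact h2
      have h3 : (β - κ).comp (ρ.comp ε) = β.comp (ρ.comp ε) := by
        rw [ContinuousLinearMap.sub_comp, h1, sub_zero]
      refine ⟨μ, β - κ, ?_, ?_⟩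
      · rw [h3, hμ]
      · rw [h3, ← hκ, map_sub, add_sub_cancel]

/-- The linear algebra of the characteristic distribution of an associated bundle. -/
theorem mem_map_range_associated_iff {W : Type*} [NormedAddCommGroup W] [NormedSpace ℝ W]
    (hP : ∀ α β : V →L[ℝ] ℝ, β (πP α) = -α (πP β))
    (hM : ∀ α β : VM →L[ℝ] ℝ, β (πM α) = -α (πM β))
    (h : ∀ α : VM →L[ℝ] ℝ, p (πP (α.comp p)) = πM α)
    (hd : ∀ α : VM →L[ℝ] ℝ, p (πP (α.comp p)) = 0 → πP (α.comp p) = 0)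
    (hρ : ∀ v, ρ v ∈ LinearMap.range πX)
    (hab : (∀ ξ : V →L[ℝ] ℝ, p (πP ξ) = 0 → πP ξ = 0) ∨
      ∀ α β : VX →L[ℝ] ℝ, (∃ v, ρ v = πX α) → (∃ w, ρ w = πX β) → β (πX α) = 0)
    {πS : (W →L[ℝ] ℝ) →ₗ[ℝ] W} {q : V × VX →L[ℝ] W} {D : W →L[ℝ] VM × VX} {D' : VM × VX →L[ℝ] W}
    (hD : ∀ w, D' (D w) = w)
    (hq : ∀ α : W →L[ℝ] ℝ, q (πP ((α.comp q).comp (ContinuousLinearMap.inl ℝ V VX)),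
      πX ((α.comp q).comp (ContinuousLinearMap.inr ℝ V VX))) = πS α)
    (hL : ∀ u w, D (q (u, w)) = (p u, ρ (ε u) + w)) (v : VM × VX) :
    v ∈ (LinearMap.range πS).map D.toLinearMap ↔
      v.1 ∈ LinearMap.range πM ∧ v.2 ∈ LinearMap.range πX := by
  have key : ∀ μ ν, D (πS ((ContinuousLinearMap.coprod μ ν).comp D)) =
      (p (πP (μ.comp p + ν.comp (ρ.comp ε))),
        ρ (ε (πP (μ.comp p + ν.comp (ρ.comp ε)))) + πX ν) := by
    intro μ ν
    have h1 : (((ContinuousLinearMap.coprod μ ν).comp D).comp q).comp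
        (ContinuousLinearMap.inl ℝ V VX) = μ.comp p + ν.comp (ρ.comp ε) := by
      ext u
      simp [hL]
    have h2 : (((ContinuousLinearMap.coprod μ ν).comp D).comp q).comp
        (ContinuousLinearMap.inr ℝ V VX) = ν := by
      ext u
      simp [hL]
    rw [← hq, h1, h2, hL]
  rw [← range_associated_iff hP hM h hd hρ hab]
  constructor
  · rintro ⟨_, ⟨α, rfl⟩, rfl⟩
    have h3 : α = (ContinuousLinearMap.coprod
        ((α.comp D').comp (ContinuousLinearMap.inl ℝ VM VX))
        ((α.comp D').comp (ContinuousLinearMap.inr ℝ VM VX))).comp D := by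
      ext w
      simp [hD]
    refine ⟨(α.comp D').comp (ContinuousLinearMap.inl ℝ VM VX),
      (α.comp D').comp (ContinuousLinearMap.inr ℝ VM VX), ?_⟩
    rw [← Prod.mk_inj, ← key, ← h3]
    rfl
  · rintro ⟨μ, ν, h1, h2⟩
    refine ⟨_, ⟨(ContinuousLinearMap.coprod μ ν).comp D, rfl⟩, ?_⟩
    exact (key μ ν).trans (Prod.ext h1 h2)

end LinearAlgebra

/-! ### The distribution of the associated bundle in a trivialization. -/

section Ranges

open BivectorField

variable {EP : Type*} [NormedAddCommGroup EP] [NormedSpace ℝ EP]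
  {HP : Type*} [TopologicalSpace HP] {IP : ModelWithCorners ℝ EP HP}
  {P : Type*} [TopologicalSpace P] [ChartedSpace HP P]
  {EM : Type*} [NormedAddCommGroup EM] [NormedSpace ℝ EM]
  {HM : Type*} [TopologicalSpace HM] {IM : ModelWithCorners ℝ EM HM}
  {M : Type*} [TopologicalSpace M] [ChartedSpace HM M]
  {EX : Type*} [NormedAddCommGroup EX] [NormedSpace ℝ EX]
  {HX : Type*} [TopologicalSpace HX] {IX : ModelWithCorners ℝ EX HX}
  {X : Type*} [TopologicalSpace X] [ChartedSpace HX X]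
  {EG : Type*} [NormedAddCommGroup EG] [NormedSpace ℝ EG]
  {HG : Type*} [TopologicalSpace HG] {IG : ModelWithCorners ℝ EG HG}
  {G : Type*} [TopologicalSpace G] [ChartedSpace HG G] [Group G] [MulAction G X]

/-- The differential of an action at the identity. -/
theorem mfderiv_smul_one [ContMDiffSMul IG IX ∞ G X] {g : G} (hg : g = 1) (x : X) (v : EG)
    (w : EX) : (show EX from mfderiv (IG.prod IX) IX (fun z : G × X => z.1 • z.2) (g, x) (v, w)) =
      (show EX from mfderiv IG IX (fun g : G => g • x) 1 v) + w := by
  subst hg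
  have h1 : MDifferentiableAt (IG.prod IX) IX (fun z : G × X => z.1 • z.2) ((1 : G), x) :=
    (contMDiff_smul (I := IG) (I' := IX) (n := ∞) (G := G) (M := X)).mdifferentiableAt (by simp)
  have h2 := mfderiv_prod_eq_add_apply (v := (v, w)) h1
  have h3 : HasMFDerivAt IX IX (fun z : X => (1 : G) • z) x
      (ContinuousLinearMap.id ℝ (TangentSpace IX x)) :=
    (hasMFDerivAt_id x).congr_of_eventuallyEq (Filter.Eventually.of_forall fun z => one_smul G z)
  exact h2.trans (congrArg (fun u : EX => (show EX from mfderiv IG IX (fun g : G => g • x) 1 v) + u)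
    (DFunLike.congr_fun h3.mfderiv w))


variable [MulAction Gᵐᵒᵖ P] {p : P → M} (h : IsPrincipalBundle IP IM IG G p)
  [ContinuousSMul G X] [IsManifold IP ∞ P]
  [IsManifold IM ∞ M] [IsManifold IX ∞ X] [ContMDiffSMul IG IX ∞ G X]

namespace AssociatedBundle

/-- The differential of `[y, x] ↦ (p y, e₂(y) • x)` where `e₂(y) = 1`. -/
theorem mfderiv_triv_mfderiv_mk (m : M) {y : P} {x : X}
    (hy : p y ∈ (principalTriv h m).baseSet) (hy1 : (principalTriv h m y).2 = 1) (u : EP) (w : EX) :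
    (show EM × EX from mfderiv (IM.prod IX) (IM.prod IX) (triv X h m) (mk h (y, x))
      (mfderiv (IP.prod IX) (IM.prod IX) (mk h) (y, x) (u, w))) =
    (mfderiv IP IM p y u, (show EX from mfderiv IG IX (fun g : G => g • x) 1
      (show EG from mfderiv IP IG (fun y => (principalTriv h m y).2) y u)) + w) := by
  set e := principalTriv h m with he
  have ht : MDifferentiableAt (IM.prod IX) (IM.prod IX) (triv X h m) (mk h (y, x)) :=
    ((isSmoothTrivialization_triv (IX := IX) (X := X) h m).contMDiffOn.contMDiffAt
      ((triv X h m).open_source.mem_nhds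
        ((mk_mem_triv_source h m).2 hy))).mdifferentiableAt (by simp)
  have hmk : MDifferentiableAt (IP.prod IX) (IM.prod IX) (mk h : P × X → _) (y, x) :=
    (contMDiff_mk h).mdifferentiableAt (by simp)
  have h1 : HasMFDerivAt (IP.prod IX) (IM.prod IX) (fun z => triv X h m (mk h z)) (y, x)
      ((mfderiv (IM.prod IX) (IM.prod IX) (triv X h m) (mk h (y, x))).comp
        (mfderiv (IP.prod IX) (IM.prod IX) (mk h) (y, x))) :=
    HasMFDerivAt.comp (y, x) ht.hasMFDerivAt hmk.hasMFDerivAt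
  have hε : MDifferentiableAt IP IG (fun y => (e y).2) y :=
    (contMDiffAt_snd.comp y ((principalTriv_smooth h m).contMDiffOn.contMDiffAt
      (e.open_source.mem_nhds (e.mem_source.2 hy)))).mdifferentiableAt (by simp)
  have hs : MDifferentiableAt (IG.prod IX) IX (fun z : G × X => z.1 • z.2) ((e y).2, x) :=
    (contMDiff_smul (I := IG) (I' := IX) (n := ∞) (G := G) (M := X)).mdifferentiableAt (by simp)
  have hfst := hasMFDerivAt_fst (I := IP) (I' := IX) (y, x)
  have hsnd := hasMFDerivAt_snd (I := IP) (I' := IX) (y, x)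
  have h2 : HasMFDerivAt (IP.prod IX) IM (fun z : P × X => p z.1) (y, x)
      ((mfderiv IP IM p y).comp (ContinuousLinearMap.fst ℝ EP EX)) :=
    HasMFDerivAt.comp (y, x) (h.contMDiff_proj.mdifferentiableAt (by simp)).hasMFDerivAt hfst
  have h3 : HasMFDerivAt (IP.prod IX) IG (fun z : P × X => (e z.1).2) (y, x)
      ((mfderiv IP IG (fun y => (e y).2) y).comp (ContinuousLinearMap.fst ℝ EP EX)) :=
    HasMFDerivAt.comp (f := Prod.fst) (g := fun y => (e y).2) (y, x) hε.hasMFDerivAt hfst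
  have h4 := h3.prodMk hsnd
  have h5 := HasMFDerivAt.comp (y, x) hs.hasMFDerivAt h4
  have h6 := (h2.prodMk h5).congr_of_eventuallyEq (f₁ := fun z => triv X h m (mk h z)) (by
    filter_upwards [(e.open_baseSet.preimage
      (h.contMDiff_proj.continuous.comp continuous_fst)).mem_nhds
        (show (y, x) ∈ (fun z : P × X => p z.1) ⁻¹' e.baseSet from hy)] with z hz
    exact triv_mk h m hz)
  refine (DFunLike.congr_fun (hasMFDerivAt_unique h1 h6) (u, w)).trans ?_
  exact Prod.ext rfl (mfderiv_smul_one hy1 x _ w)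

/-- The geometric heart of the theorem, obtained by applying `mem_map_range_associated_iff` to the
differentials at a representative with trivial group coordinate. -/
theorem map_range_triv {πP : BivectorField IP P} {πM : BivectorField IM M}
    {πX : BivectorField IX X} [FiniteDimensional ℝ EM]
    (hcoreg : πP.IsCoregularPoissonSubmersion πM p)
    (hρ : ∀ (x : X) (v : EG), (show EX from mfderiv IG IX (fun g : G => g • x) 1 v) ∈
      (show Submodule ℝ EX from LinearMap.range (πX.sharp x)))
    (hab : πP.FibresInheritZero IM p ∨ πX.OrbitsIsotropic IG G)
    {πS : BivectorField (IM.prod IX) (AssociatedBundle X h)}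
    (hq : (πP.prod πX).IsPoissonMap πS (mk h)) (m : M) {a : AssociatedBundle X h}
    (ha : a ∈ (triv X h m).source) :
    (LinearMap.range (πS.sharp a)).map
      (mfderiv (IM.prod IX) (IM.prod IX) (triv X h m) a).toLinearMap =
        LinearMap.range ((πM.prod πX).sharp (triv X h m a)) := by
  set e := principalTriv h m with he
  set t := triv X h m with ht
  have hta : (t a).1 ∈ e.baseSet := (t.map_source ha).1
  -- Such a representative makes the derivative of `z ↦ e₂(z) • x'` split as infinitesimal action
  -- plus identity.
  obtain ⟨y, x, rfl, hy, hy1⟩ : ∃ y x, mk h (y, x) = a ∧ p y ∈ e.baseSet ∧ (e y).2 = 1 := by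
    refine ⟨e.toOpenPartialHomeomorph.symm ((t a).1, 1), (t a).2, t.left_inv ha, ?_, ?_⟩
    · rwa [e.proj_symm_apply' hta]
    · rw [e.apply_symm_apply' hta]
  have htz : t (mk h (y, x)) = (p y, x) := by rw [ht, triv_mk h m hy, hy1, one_smul]
  have hsm := isSmoothTrivialization_triv (IX := IX) (X := X) h m
  have hD : ∀ w : EM × EX, (show EM × EX from
      mfderiv (IM.prod IX) (IM.prod IX) t.toOpenPartialHomeomorph.symm (t (mk h (y, x)))
        (mfderiv (IM.prod IX) (IM.prod IX) t (mk h (y, x)) w)) = w := by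
    have hm : t.toOpenPartialHomeomorph.MDifferentiable (IM.prod IX) (IM.prod IX) :=
      ⟨hsm.contMDiffOn.mdifferentiableOn (by simp),
        hsm.contMDiffOn_symm.mdifferentiableOn (by simp)⟩
    exact DFunLike.congr_fun (hm.symm_comp_deriv ha)
  -- Pullbacks `α ∘ dp` are conormal to the fibre, so this is the disjointness in the definition of
  -- coregularity.
  have hd : ∀ α : EM →L[ℝ] ℝ, mfderiv IP IM p y (πP.sharp y (α.comp (mfderiv IP IM p y))) = 0 →
      πP.sharp y (α.comp (mfderiv IP IM p y)) = 0 := by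
    intro α hα
    refine Submodule.disjoint_def.1 ((hcoreg.coregular_fibres (p y)).2 y rfl) _
      ⟨α.comp (mfderiv IP IM p y), fun u hu => ?_, rfl⟩ hα
    exact (congrArg α hu).trans (map_zero α)
  -- In case a), a vector `πP ξ` tangent to the fibre is the first entry of an element of the
  -- induced family, hence zero.
  have habx : (∀ ξ : EP →L[ℝ] ℝ, mfderiv IP IM p y (πP.sharp y ξ) = 0 → πP.sharp y ξ = 0) ∨
      ∀ α β : EX →L[ℝ] ℝ, (∃ v : EG, mfderiv IG IX (fun g : G => g • x) 1 v = πX.sharp x α) →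
        (∃ w : EG, mfderiv IG IX (fun g : G => g • x) 1 w = πX.sharp x β) →
        β (πX.sharp x α) = 0 := by
    refine hab.imp (fun h1 ξ hξ => ?_) fun h1 => h1 x
    have h2 : ((⟨πP.sharp y ξ, hξ⟩, ξ.comp (vertical IP IM p y).subtypeL) :
        vertical IP IM p y × (vertical IP IM p y →L[ℝ] ℝ)) ∈
        πP.inducedFamily y (vertical IP IM p y) := ⟨ξ, rfl, rfl⟩
    rw [h1 y] at h2
    exact congrArg Subtype.val h2
  have key : ∀ (w : M × X) (v : EM × EX), w = (p y, x) →
      (v ∈ (show Submodule ℝ (EM × EX) from LinearMap.range ((πM.prod πX).sharp w)) ↔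
        v.1 ∈ (show Submodule ℝ EM from LinearMap.range (πM.sharp (p y))) ∧
          v.2 ∈ (show Submodule ℝ EX from LinearMap.range (πX.sharp x))) := by
    rintro _ v rfl
    exact SetLike.ext_iff.1 (range_prod (p y, x)) v
  ext v
  refine Iff.trans ?_ (key _ v htz).symm
  exact mem_map_range_associated_iff (V := EP) (VM := EM) (VX := EX) (VG := EG) (W := EM × EX)
    (πP := πP.sharp y) (πM := πM.sharp (p y)) (πX := πX.sharp x) (p := mfderiv IP IM p y)
    (ε := mfderiv IP IG (fun y => (e y).2) y) (ρ := mfderiv IG IX (fun g : G => g • x) 1)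
    (πS := πS.sharp (mk h (y, x))) (q := mfderiv (IP.prod IX) (IM.prod IX) (mk h) (y, x))
    (D := mfderiv (IM.prod IX) (IM.prod IX) t (mk h (y, x)))
    (D' := mfderiv (IM.prod IX) (IM.prod IX) t.toOpenPartialHomeomorph.symm (t (mk h (y, x))))
    (πP.skew y) (πM.skew (p y)) (hcoreg.map_sharp y) hd (hρ x) habx hD (hq.map_sharp (y, x))
    (mfderiv_triv_mfderiv_mk h m hy hy1) v

end AssociatedBundle

end Ranges
end

noncomputable section

set_option maxSynthPendingDepth 3
set_option linter.unusedSectionVars false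

/-! ### Diffeomorphisms that match distributions match leaves. -/

section LeafTransport

open BivectorField

variable {E : Type*} [NormedAddCommGroup E] [NormedSpace ℝ E]
  {H : Type*} [TopologicalSpace H] {I : ModelWithCorners ℝ E H}
  {N : Type*} [TopologicalSpace N] [ChartedSpace H N]
  {E' : Type*} [NormedAddCommGroup E'] [NormedSpace ℝ E']
  {H' : Type*} [TopologicalSpace H'] {I' : ModelWithCorners ℝ E' H'}
  {N' : Type*} [TopologicalSpace N'] [ChartedSpace H' N']
  {π : BivectorField I N} {π' : BivectorField I' N'}

theorem BivectorField.IsTangentCurve.comp {γ : ℝ → N} {a b : ℝ} (hγ : π.IsTangentCurve γ a b)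
    {f : N → N'} (hf : ∀ t ∈ Icc a b, MDifferentiableAt I I' f (γ t) ∧
      (LinearMap.range (π.sharp (γ t))).map (mfderiv I I' f (γ t)).toLinearMap ≤
        LinearMap.range (π'.sharp (f (γ t)))) :
    π'.IsTangentCurve (fun t => f (γ t)) a b := by
  intro t ht
  obtain ⟨v, hv, hd⟩ := hγ t ht
  exact ⟨_, (hf t ht).2 ⟨v, hv, rfl⟩, hd.comp (hf t ht).1⟩

variable {e : OpenPartialHomeomorph N N'} (he : e.MDifferentiable I I')
  (hr : ∀ a ∈ e.source, (LinearMap.range (π.sharp a)).map (mfderiv I I' e a).toLinearMap =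
    LinearMap.range (π'.sharp (e a)))

include he hr

theorem BivectorField.rank_eq_of_map_range [IsManifold I 1 N] [IsManifold I' 1 N'] {a : N}
    (ha : a ∈ e.source) : π'.rank (e a) = π.rank a := by
  unfold rank
  rw [← hr a ha]
  exact (LinearEquiv.finrank_eq (Submodule.equivMapOfInjective (mfderiv I I' e a).toLinearMap
    (he.mfderiv_injective ha) _)).symm

theorem BivectorField.map_range_symm_le [IsManifold I 1 N] [IsManifold I' 1 N'] {w : N'}
    (hw : w ∈ e.target) :
    (LinearMap.range (π'.sharp w)).map (mfderiv I' I e.symm w).toLinearMap ≤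
      LinearMap.range (π.sharp (e.symm w)) := by
  have key : ∀ w' : N', w' = w → ∀ u : E',
      u ∈ (show Submodule ℝ E' from LinearMap.range (π'.sharp w)) →
      u ∈ (show Submodule ℝ E' from LinearMap.range (π'.sharp w')) := by
    rintro _ rfl u hu
    exact hu
  rintro _ ⟨u, hu, rfl⟩
  obtain ⟨v, hv, hvu⟩ := (SetLike.ext_iff.1 (hr _ (e.map_target hw)) u).2
    (key _ (e.right_inv hw) u hu)
  have h1 : mfderiv I I' e (e.symm w) (mfderiv I' I e.symm w u) = u :=
    DFunLike.congr_fun (he.comp_symm_deriv hw) u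
  have h2 := he.mfderiv_injective (e.map_target hw) (h1.trans hvu.symm)
  exact (congrArg (· ∈ LinearMap.range (π.sharp (e.symm w))) h2).mpr hv

variable [FiniteDimensional ℝ E] [I.Boundaryless] [IsManifold I ∞ N] [T2Space N]
  [FiniteDimensional ℝ E'] [I'.Boundaryless] [IsManifold I' ∞ N'] [T2Space N']
  (hπ : π.IsPoisson) (hπ' : π'.IsPoisson)

include hπ' in
/-- A diffeomorphism onto an open set that matches the ranges of two Poisson structures maps
tangent curves of constant rank into leaves. -/
theorem BivectorField.leafRelOn_apply {W : Set N'} (hW : IsOpen W) {γ : ℝ → N} {a b : ℝ}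
    (hab : a ≤ b) (hγ : π.IsTangentCurve γ a b) (hs : ∀ t ∈ Icc a b, γ t ∈ e.source ∧ e (γ t) ∈ W)
    (hk : ∀ t ∈ Icc a b, π.rank (γ t) = π.rank (γ a)) :
    π'.LeafRelOn W (e (γ a)) (e (γ b)) := by
  have : IsManifold I 1 N := .of_le (n := ∞) (by simp)
  have : IsManifold I' 1 N' := .of_le (n := ∞) (by simp)
  exact hπ'.leafRelOn_of_isTangentCurve hW hab
    (hγ.comp fun t ht => ⟨he.mdifferentiableAt (hs t ht).1, (hr _ (hs t ht).1).le⟩)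
    fun t ht => ⟨(hs t ht).2, (rank_eq_of_map_range he hr (hs t ht).1).trans (hk t ht)⟩

include hπ in
theorem BivectorField.leafRelOn_symm_apply {W : Set N} (hW : IsOpen W) {γ : ℝ → N'} {a b : ℝ}
    (hab : a ≤ b) (hγ : π'.IsTangentCurve γ a b)
    (hs : ∀ t ∈ Icc a b, γ t ∈ e.target ∧ e.symm (γ t) ∈ W)
    (hk : ∀ t ∈ Icc a b, π'.rank (γ t) = π'.rank (γ a)) :
    π.LeafRelOn W (e.symm (γ a)) (e.symm (γ b)) := by
  have : IsManifold I 1 N := .of_le (n := ∞) (by simp)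
  have : IsManifold I' 1 N' := .of_le (n := ∞) (by simp)
  refine hπ.leafRelOn_of_isTangentCurve hW hab
    (hγ.comp fun t ht => ⟨he.mdifferentiableAt_symm (hs t ht).1,
      map_range_symm_le he hr (hs t ht).1⟩)
    fun t ht => ⟨(hs t ht).2, Eq.trans ?_ (hk t ht)⟩
  rw [← rank_eq_of_map_range he hr (e.map_target (hs t ht).1), e.right_inv (hs t ht).1]

-- Hamiltonian functions need not correspond, but tangent curves of constant rank do, in both
-- directions, and they generate the leaf relations inside the open sets.
include hπ hπ' in
theorem BivectorField.leafRelOn_iff_of_map_range {a b : N} (ha : a ∈ e.source)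
    (hb : b ∈ e.source) :
    π.LeafRelOn e.source a b ↔ π'.LeafRelOn e.target (e a) (e b) := by
  constructor
  · exact hπ.leafRelOn_induction e.open_source ((π'.leafSetoidOn e.target).comap e)
      fun γ hγ hs hk => leafRelOn_apply he hr hπ' e.open_target zero_le_one hγ
        (fun t ht => ⟨hs t ht, e.map_source (hs t ht)⟩) hk
  · intro h1
    have h2 := hπ'.leafRelOn_induction e.open_target ((π.leafSetoidOn e.source).comap e.symm)
      (fun γ hγ hs hk => leafRelOn_symm_apply he hr hπ e.open_source zero_le_one hγ
        (fun t ht => ⟨hs t ht, e.map_target (hs t ht)⟩) hk) h1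
    have h3 : π.LeafRelOn e.source (e.symm (e a)) (e.symm (e b)) := h2
    rwa [e.left_inv ha, e.left_inv hb] at h3

end LeafTransport

/-! ### The leaves of the associated bundle, and the main theorem. -/

section Leaves

open BivectorField

variable {EP : Type*} [NormedAddCommGroup EP] [NormedSpace ℝ EP]
  {HP : Type*} [TopologicalSpace HP] {IP : ModelWithCorners ℝ EP HP}
  {P : Type*} [TopologicalSpace P] [ChartedSpace HP P]
  {EM : Type*} [NormedAddCommGroup EM] [NormedSpace ℝ EM] [FiniteDimensional ℝ EM]
  {HM : Type*} [TopologicalSpace HM] {IM : ModelWithCorners ℝ EM HM} [IM.Boundaryless]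
  {M : Type*} [TopologicalSpace M] [ChartedSpace HM M] [IsManifold IM ∞ M] [T2Space M]
  {EX : Type*} [NormedAddCommGroup EX] [NormedSpace ℝ EX] [FiniteDimensional ℝ EX]
  {HX : Type*} [TopologicalSpace HX] {IX : ModelWithCorners ℝ EX HX} [IX.Boundaryless]
  {X : Type*} [TopologicalSpace X] [ChartedSpace HX X] [IsManifold IX ∞ X] [T2Space X]
  {EG : Type*} [NormedAddCommGroup EG] [NormedSpace ℝ EG]
  {HG : Type*} [TopologicalSpace HG] {IG : ModelWithCorners ℝ EG HG}
  {G : Type*} [TopologicalSpace G] [ChartedSpace HG G] [Group G] [MulAction G X]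

/-- If the orbits are contained in leaves, then the fundamental vector fields are tangent to the
leaves. -/
theorem mfderiv_smul_mem_range [SecondCountableTopology X] [IG.Boundaryless] [IsManifold IG ∞ G]
    [ContMDiffSMul IG IX ∞ G X] {πX : BivectorField IX X} (hπX : πX.IsPoisson)
    (horb : ∀ (g : G) (x : X), πX.LeafRelOn univ x (g • x)) (x : X) (v : EG) :
    (show EX from mfderiv IG IX (fun g : G => g • x) 1 v) ∈
      (show Submodule ℝ EX from LinearMap.range (πX.sharp x)) := by
  have hf : ContMDiff IG IX ∞ fun g : G => g • x :=
    (contMDiff_smul (I := IG) (I' := IX) (n := ∞) (G := G) (M := X)).comp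
      (contMDiff_id.prodMk contMDiff_const)
  have h1 := hπX.mfderiv_mem_range hf (1 : G) (fun g => by
    rw [one_smul]
    exact horb g x) v
  have key : ∀ (x' : X) (u : EX), x' = x →
      u ∈ (show Submodule ℝ EX from LinearMap.range (πX.sharp x')) →
      u ∈ (show Submodule ℝ EX from LinearMap.range (πX.sharp x)) := by
    rintro _ u rfl hu
    exact hu
  exact key _ _ (one_smul G x) h1

namespace AssociatedBundle

variable [MulAction Gᵐᵒᵖ P] {p : P → M} (h : IsPrincipalBundle IP IM IG G p)
  [ContinuousSMul G X] [ContMDiffSMul IG IX ∞ G X]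
  {πM : BivectorField IM M} {πX : BivectorField IX X}
  {πS : BivectorField (IM.prod IX) (AssociatedBundle X h)}

theorem mdifferentiable_triv (m : M) :
    (triv X h m).toOpenPartialHomeomorph.MDifferentiable (IM.prod IX) (IM.prod IX) :=
  have hsm := isSmoothTrivialization_triv (IX := IX) (X := X) h m
  ⟨hsm.contMDiffOn.mdifferentiableOn (by simp), hsm.contMDiffOn_symm.mdifferentiableOn (by simp)⟩

variable (hπS : πS.IsPoisson) (hπM : πM.IsPoisson) (hπX : πX.IsPoisson)
  (hr : ∀ (m : M), ∀ a ∈ (triv X h m).source, (LinearMap.range (πS.sharp a)).map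
      (mfderiv (IM.prod IX) (IM.prod IX) (triv X h m) a).toLinearMap =
        LinearMap.range ((πM.prod πX).sharp (triv X h m a)))
  (horb : ∀ (g : G) (x : X), πX.LeafRelOn univ x (g • x))

include hπS hπM hπX hr in
theorem hasLocallyTrivialFoliation :
    HasLocallyTrivialFoliation (proj X h) πS πM πX := fun m =>
  ⟨triv X h m, principalTriv_mem h m, isSmoothTrivialization_triv h m,
    fun _ ha _ hb => leafRelOn_iff_of_map_range (mdifferentiable_triv h m) (hr m) hπS
      (hπM.prod hπX) ha hb, hr m⟩

theorem triv_symm_apply (m : M) {y : P} (hy : p y ∈ (principalTriv h m).baseSet) (x : X) :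
    (triv X h m).toOpenPartialHomeomorph.symm (p y, (principalTriv h m y).2 • x) =
      mk h (y, x) := by
  rw [← triv_mk h m (z := (y, x)) hy]
  exact (triv X h m).left_inv ((mk_mem_triv_source h m).2 hy)

include hπS hπX hr in
theorem leafRelOn_triv_symm (m : M) {m' : M} (hm : m' ∈ (principalTriv h m).baseSet) {x x' : X}
    (hx : πX.LeafRelOn univ x x') :
    πS.LeafRelOn univ ((triv X h m).toOpenPartialHomeomorph.symm (m', x))
      ((triv X h m).toOpenPartialHomeomorph.symm (m', x')) := by
  refine hπX.leafRelOn_induction isOpen_univ ((πS.leafSetoidOn univ).comap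
    fun x => (triv X h m).toOpenPartialHomeomorph.symm (m', x)) (fun γ hγ _ hk => ?_) hx
  exact leafRelOn_symm_apply (mdifferentiable_triv h m) (hr m) hπS isOpen_univ zero_le_one
    ((IsTangentCurve.const (π := πM) m' 0 1).prodMk hγ)
    (fun t _ => ⟨⟨hm, mem_univ _⟩, mem_univ _⟩)
    fun t ht => by rw [BivectorField.rank_prod, BivectorField.rank_prod, hk t ht]

-- In a trivialization the two points lie over the same base point, with fibre coordinates in the
-- orbits of `x` and `x'`; orbits lie in leaves, so these coordinates share a leaf of `X`.
include hπS hπX hr horb in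
theorem leafRelOn_mk_of_proj_eq {y y' : P} (hy : p y = p y') {x x' : X}
    (hx : πX.LeafRelOn univ x x') : πS.LeafRelOn univ (mk h (y, x)) (mk h (y', x')) := by
  have h1 := principalTriv_mem h (p y)
  rw [← triv_symm_apply h (p y) h1, ← triv_symm_apply h (p y) (y := y') (hy ▸ h1), ← hy]
  refine leafRelOn_triv_symm h hπS hπX hr _ h1 ?_
  exact ((horb _ _).symm.trans _ _ _ hx).trans _ _ _ (horb _ _)

include hπS hπM hπX hr horb in
/-- The leaves of an associated bundle. -/
theorem leafRelOn_mk_iff (hp : Function.Surjective p) {z w : P × X} :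
    πS.LeafRelOn univ (mk h z) (mk h w) ↔
      πM.LeafRelOn univ (p z.1) (p w.1) ∧ πX.LeafRelOn univ z.2 w.2 := by
  constructor
  · intro hzw
    -- `F [y, x] = (leaf of p y, leaf of x)` is well defined because orbits lie in leaves. In every
    -- trivialization it is the product of the two leaf projections, hence locally constant along
    -- tangent curves of constant rank.
    let F : AssociatedBundle X h → πM.LeafSpace × πX.LeafSpace :=
      Quotient.lift (fun z : P × X =>
        (Quotient.mk πM.leafSetoid (p z.1), Quotient.mk πX.leafSetoid z.2)) (by
          rintro z _ ⟨g, rfl⟩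
          refine Prod.ext ?_ (Quotient.sound (horb g z.2))
          dsimp only
          rw [h.proj_act])
    have hF : ∀ m, ∀ a ∈ (triv X h m).source, F a =
        (Quotient.mk πM.leafSetoid (triv X h m a).1,
          Quotient.mk πX.leafSetoid (triv X h m a).2) := by
      intro m a ha
      obtain ⟨z, rfl⟩ := mk_surjective h a
      rw [triv_mk h m ha]
      exact Prod.ext rfl (Quotient.sound (horb _ z.2))
    have hFzw := hπS.leafRelOn_induction isOpen_univ (Setoid.ker F) (fun γ hγ _ hk => ?_) hzw
    · exact ⟨Quotient.exact (congrArg Prod.fst hFzw), Quotient.exact (congrArg Prod.snd hFzw)⟩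
    · refine (eq_of_curve_of_local (F := F) hγ.continuousOn (fun t ht => ?_) 1
        (right_mem_Icc.2 zero_le_one)).symm
      refine ⟨(triv X h (proj X h (γ t))).source, (triv X h (proj X h (γ t))).open_source,
        (triv X h _).mem_source.2 (principalTriv_mem h _), fun s s' hs hsub hO => ?_⟩
      rw [hF _ _ (hO s (left_mem_Icc.2 hs)), hF _ _ (hO s' (right_mem_Icc.2 hs))]
      have h1 := leafRelOn_apply (mdifferentiable_triv h _) (hr _) (hπM.prod hπX) isOpen_univ hs
        (hγ.mono hsub) (fun r hr => ⟨hO r hr, mem_univ _⟩)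
        (fun r hr => (hk r (hsub hr)).trans (hk s (hsub (left_mem_Icc.2 hs))).symm)
      have h2 := (hπM.leafRelOn_prod_iff hπX).1 h1
      exact Prod.ext (Quotient.sound h2.1.symm) (Quotient.sound h2.2.symm)
  · rintro ⟨h1, h2⟩
    have hsec := Function.rightInverse_surjInv hp
    -- The leaf of `[y, x]` for fixed `x` depends only on `p y`, so an arbitrary lift of the base
    -- point may be used. Along a tangent curve in `M`, the constant fibre coordinate of a
    -- trivialization gives a tangent curve in `Σ`.
    let F : M → πS.LeafSpace := fun m =>
      Quotient.mk πS.leafSetoid (mk h (Function.surjInv hp m, z.2))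
    have hF : ∀ y, F (p y) = Quotient.mk πS.leafSetoid (mk h (y, z.2)) := fun y =>
      Quotient.sound (leafRelOn_mk_of_proj_eq h hπS hπX hr horb (hsec _) (.refl _))
    have h3 : F (p z.1) = F (p w.1) := by
      refine hπM.leafRelOn_induction isOpen_univ (Setoid.ker F) (fun γ hγ _ hk => ?_) h1
      refine (eq_of_curve_of_local (F := F) hγ.continuousOn (fun t ht => ?_) 1
        (right_mem_Icc.2 zero_le_one)).symm
      set e := principalTriv h (γ t) with he
      refine ⟨e.baseSet, e.open_baseSet, principalTriv_mem h _, fun s s' hs hsub hO => ?_⟩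
      have hFe : ∀ m ∈ e.baseSet, F m = Quotient.mk πS.leafSetoid
          ((triv X h (γ t)).toOpenPartialHomeomorph.symm (m, z.2)) := by
        intro m hm
        have h4 := hF (e.toOpenPartialHomeomorph.symm (m, 1))
        rwa [e.proj_symm_apply' hm] at h4
      rw [hFe _ (hO s (left_mem_Icc.2 hs)), hFe _ (hO s' (right_mem_Icc.2 hs))]
      refine Quotient.sound (Relation.EqvGen.symm _ _ ?_)
      exact leafRelOn_symm_apply (mdifferentiable_triv h _) (hr _) hπS isOpen_univ hs
        ((hγ.mono hsub).prodMk (IsTangentCurve.const (π := πX) z.2 s s'))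
        (fun r hr => ⟨⟨hO r hr, mem_univ _⟩, mem_univ _⟩)
        fun r hr => by
          rw [BivectorField.rank_prod, BivectorField.rank_prod, hk r (hsub hr),
            hk s (hsub (left_mem_Icc.2 hs))]
    rw [hF, hF] at h3
    exact (Quotient.exact h3).trans _ _ _ (leafRelOn_mk_of_proj_eq h hπS hπX hr horb rfl h2)

end AssociatedBundle

end Leaves
end

theorem mainTheorem11
    {EG : Type*} [NormedAddCommGroup EG] [NormedSpace ℝ EG] [FiniteDimensional ℝ EG]
    {EP : Type*} [NormedAddCommGroup EP] [NormedSpace ℝ EP] [FiniteDimensional ℝ EP]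
    {EM : Type*} [NormedAddCommGroup EM] [NormedSpace ℝ EM] [FiniteDimensional ℝ EM]
    {EX : Type*} [NormedAddCommGroup EX] [NormedSpace ℝ EX] [FiniteDimensional ℝ EX]
    -- a Lie group `G` and smooth manifolds `P`, `M`, `X`
    {G : Type*} [TopologicalSpace G] [ChartedSpace EG G] [Group G] [LieGroup 𝓘(ℝ, EG) ∞ G]
    {P : Type*} [TopologicalSpace P] [T2Space P] [SecondCountableTopology P]
    [ChartedSpace EP P] [IsManifold 𝓘(ℝ, EP) ∞ P]
    {M : Type*} [TopologicalSpace M] [T2Space M] [SecondCountableTopology M]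
    [ChartedSpace EM M] [IsManifold 𝓘(ℝ, EM) ∞ M]
    {X : Type*} [TopologicalSpace X] [T2Space X] [SecondCountableTopology X]
    [ChartedSpace EX X] [IsManifold 𝓘(ℝ, EX) ∞ X]
    -- a right principal `G`-bundle with an invariant Poisson structure on its total space which
    -- makes it into a coregular Poisson submersion
    [MulAction Gᵐᵒᵖ P] {p : P → M}
    (hp : IsPrincipalBundle 𝓘(ℝ, EP) 𝓘(ℝ, EM) 𝓘(ℝ, EG) G p)
    (πP : BivectorField 𝓘(ℝ, EP) P) (hπP : πP.IsPoisson) (hinv : πP.IsRightInvariant G)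
    (πM : BivectorField 𝓘(ℝ, EM) M) (hπM : πM.IsPoisson)
    (hcoreg : πP.IsCoregularPoissonSubmersion πM p)
    -- a smooth left action by Poisson diffeomorphisms with orbits contained in symplectic leaves
    [MulAction G X] [ContinuousSMul G X] [ContMDiffSMul 𝓘(ℝ, EG) 𝓘(ℝ, EX) ∞ G X]
    (πX : BivectorField 𝓘(ℝ, EX) X) (hπX : πX.IsPoisson) (hact : πX.IsLeftInvariant G)
    (horb : ∀ (g : G) (x : X), g • x ∈ πX.leaf x)
    (hab : πP.FibresInheritZero 𝓘(ℝ, EM) p ∨ πX.OrbitsIsotropic 𝓘(ℝ, EG) G) :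
    -- there is a unique Poisson structure on `Σ = P ×_G X` making `P × X → Σ` Poisson
    (∃! πS : BivectorField (𝓘(ℝ, EM).prod 𝓘(ℝ, EX)) (AssociatedBundle X hp),
      πS.IsPoisson ∧ (πP.prod πX).IsPoissonSubmersion πS (AssociatedBundle.mk hp)) ∧
    ∀ πS : BivectorField (𝓘(ℝ, EM).prod 𝓘(ℝ, EX)) (AssociatedBundle X hp),
      πS.IsPoisson → (πP.prod πX).IsPoissonSubmersion πS (AssociatedBundle.mk hp) →
      -- it has locally trivial foliation, and its leaf space is as claimed
      HasLocallyTrivialFoliation (AssociatedBundle.proj X hp) πS πM πX ∧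
      Nonempty (πS.LeafSpace ≃ₜ (πM.prod πX).LeafSpace) ∧
      Nonempty (πS.LeafSpace ≃ₜ πM.LeafSpace × πX.LeafSpace) := by
  have hp1 : Function.Surjective p := hcoreg.surjective
  have horb' : ∀ (g : G) (x : X), πX.LeafRelOn univ x (g • x) := horb
  have : IsManifold 𝓘(ℝ, EG) ∞ G := LieGroup.toContMDiffMul.toIsManifold
  have hρ := mfderiv_smul_mem_range (IG := 𝓘(ℝ, EG)) hπX horb'
  refine ⟨AssociatedBundle.existsUnique_poisson hp (hπP.prod hπX) hinv hact, fun πS hπS hq => ?_⟩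
  have hr := AssociatedBundle.map_range_triv hp hcoreg hρ hab hq.toIsPoissonMap
  have hleaf := fun z w => AssociatedBundle.leafRelOn_mk_iff hp hπS hπM hπX
    (fun m _ ha => hr m ha) horb' hp1 (z := z) (w := w)
  -- `p` is locally a product projection, hence open; openness, unlike being a quotient map,
  -- survives the product with the identity of `X`.
  have hpo : IsOpenQuotientMap p := ⟨hp1, hp.contMDiff_proj.continuous,
    isOpenMap_iff_nhds_le.2 fun y => ((AssociatedBundle.principalTriv hp (p y)).map_proj_nhds
      ((AssociatedBundle.principalTriv hp (p y)).mem_source.2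
        (AssociatedBundle.principalTriv_mem hp _))).ge⟩
  -- The leaf spaces are compared as quotients of `P × X`: one through `Σ`, the others through `M ×
  -- X`. It then suffices that the fibres of the quotient maps agree.
  have hS : Topology.IsQuotientMap fun z : P × X =>
      (Quotient.mk πS.leafSetoid (AssociatedBundle.mk hp z) : πS.LeafSpace) :=
    hπS.isOpenQuotientMap_mk.isQuotientMap.comp (AssociatedBundle.isQuotientMap_mk hp)
  have hpX : IsOpenQuotientMap (Prod.map p (id : X → X)) := hpo.prodMap .id
  refine ⟨AssociatedBundle.hasLocallyTrivialFoliation hp hπS hπM hπX fun m _ ha => hr m ha, ?_, ?_⟩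
  · refine nonempty_homeomorph_of_quotientMaps hS
      (((hπM.prod hπX).isOpenQuotientMap_mk.comp hpX).isQuotientMap) fun z w => ?_
    refine Quotient.eq.trans (Iff.trans ?_ Quotient.eq.symm)
    exact (hleaf z w).trans (hπM.leafRelOn_prod_iff hπX
      (z := (p z.1, z.2)) (w := (p w.1, w.2))).symm
  · refine nonempty_homeomorph_of_quotientMaps hS
      (((hπM.isOpenQuotientMap_mk.prodMap hπX.isOpenQuotientMap_mk).comp hpX).isQuotientMap)
      fun z w => ?_
    refine Quotient.eq.trans ((hleaf z w).trans ?_)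
    exact (Iff.and (Quotient.eq (r := πM.leafSetoid)).symm
      (Quotient.eq (r := πX.leafSetoid)).symm).trans Prod.mk_inj.symm
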